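/- Let $p$ be a prime. A discrete $\mathbb{Z}_p$-module is a $\mathbb{Q}$-module with a linear action of $\mathbb{Z}_p$ such that the action on each element factors through some $\mathbb{Z}_p/p^n$. Let $\mathcal{A}$ be the category whose objects $M$ consist of $\mathbb{Q}[\mathbb{Z}_p/p^k]$-modules $M_k$ for $k\ge 0$, a discrete $\mathbb{Z}_p$-module $M_\infty$, and a map of $\mathbb{Z}_p$-modules $M_\infty\to \mathrm{tails}(M):=\operatorname{colim}_n\prod_{k\ge n}M_k$; morphisms are families of equivariant linear maps $f_k$ and $f_\infty$ compatible with these structure maps. For $n\ge 0$ let $A(n)\in\mathcal{A}$ have value $\mathbb{Q}[\mathbb{Z}_p/p^n]$ at all $k\ge n$ and at $\infty$, and $0$ elsewhere, with the diagonal as structure map. Let $\mathcal{S}\mathbb{Z}_p$ be the space of closed subgroups of $\mathbb{Z}_p$, that is, the subspace $\{p^{-n}: n\ge 0\}\cup\{0\}$ of $\mathbb{R}$, with $p^{-n}$ corresponding to $p^n\mathbb{Z}_p$ and $0$ to the trivial group, and let $S_n$ be the open set consisting of the trivial group and all $p^k\mathbb{Z}_p$ with $k\ge n$. Let $\mathcal{B}$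 be the category of sheaves on $\mathcal{S}\mathbb{Z}_p$ with values in the category of discrete $\mathbb{Z}_p$-modules. For $M\in\mathcal{A}$ let $UM\in\mathcal{B}$ be the sheaf with $UM(\{p^n\mathbb{Z}_p\})=M_n$ and $UM(S_n)=M_\infty\times_{\mathrm{tails}(M)}\prod_{k\ge n}M_k$. For $N\in\mathcal{B}$ let $RN\in\mathcal{A}$ have value $N(\{p^k\mathbb{Z}_p\})^{p^k\mathbb{Z}_p}$ at $k$, and at $\infty$ the pullback of the stalk $N_e=\operatorname{colim}_n N(S_n)$ at the trivial group and $\operatorname{colim}_n\prod_{k\ge n}N(\{p^k\mathbb{Z}_p\})^{p^k\mathbb{Z}_p}$ over $\operatorname{colim}_n\prod_{k\ge n}N(\{p^k\mathbb{Z}_p\})$, with the projection as structure map. Write $dg\mathcal{A}$, $dg\mathcal{B}$ for the categories of ($\mathbb{Z}$-graded) differential graded objects. Then: 1. $U$ is left adjoint to $R$, and $U$ is full and faithful. 2. $dg\mathcal{A}$ is a model category whose fibrations (respectively weak equivalences) are the maps which are surjections (respectively homology isomorphisms) at each $n$ and at $\infty$; the maps $A(n)\otimes(S^{j}\to D^{j+1})$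 and $A(n)\otimes(0\to D^{j+1})$, for $n\ge 0$ and $j\in\mathbb{Z}$, detect its acyclic fibrations and its fibrations respectively, by right lifting. $dg\mathcal{B}$ is a model category with the levelwise structure, whose fibrations (respectively weak equivalences) are the maps which are surjections (respectively homology isomorphisms) on the sections over each open set. For these structures the adjunction $(U,R)$ on differential graded objects is a Quillen pair. 3. The images under $U$ of the maps $A(n)\otimes(S^{j}\to D^{j+1})$ and $A(n)\otimes(0\to D^{j+1})$ determine a model structure on $dg\mathcal{B}$ with these as generating cofibrations and generating acyclic cofibrations. Its weak equivalences are the $UA(n)$-cellular equivalences, that is, the maps $f$ such that $\operatorname{Hom}_{\mathcal{B}}(UA(n),f)$ is a homology isomorphism for all $n\ge 0$. For this structure on $dg\mathcal{B}$, and the structure of 2 on $dg\mathcal{A}$, the pair $(U,R)$ is a Quillen equivalence. 4. Likewise the levelwise fibrations and the $UA(n)$-cellular equivalences are the fibrations and weak equivalences of a model structure on $dg\mathcal{B}$ (the cellularisation, or right Bousfield localisation, of the levelwise structure at the $UA(n)$), and $(U,R)$ is a Quillen equivalence for this structure as well. -/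

import Mathlib

open CategoryTheory Opposite TopologicalSpace

noncomputable section

namespace PadicModel

/-! ### Rational representations of `ℤ_p`, and discrete modules -/

/-- `ℚ`-modules with a `ℚ`-linear action of the group `ℤ_p`. -/
abbrev ZpRep (p : ℕ) [Fact p.Prime] := Rep.{0} ℚ (Multiplicative ℤ_[p])

/-- The open subgroup `p ^ n ℤ_p` of `ℤ_p`. -/
def level (p : ℕ) [Fact p.Prime] (n : ℕ) : Subgroup (Multiplicative ℤ_[p]) :=
  AddSubgroup.toSubgroup (Ideal.span {(p : ℤ_[p]) ^ n}).toAddSubgroup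

variable {p : ℕ} [Fact p.Prime]

/-- An equivariant linear map as a morphism of representations. -/
def homOf {V W : ZpRep p} (f : V.V →ₗ[ℚ] W.V)
    (h : ∀ g v, f (V.ρ g v) = W.ρ g (f v)) : V ⟶ W :=
  Rep.ofHom ⟨f, fun g => LinearMap.ext fun v => h g v⟩

@[simp] theorem homOf_apply {V W : ZpRep p} (f : V.V →ₗ[ℚ] W.V)
    (h : ∀ g v, f (V.ρ g v) = W.ρ g (f v)) (v : V.V) : (homOf f h).hom v = f v := rfl

/-- The fixed points `V ^ (p ^ n ℤ_p)`. -/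
def fixedPts (V : ZpRep p) (n : ℕ) : Submodule ℚ V.V where
  carrier := {v | ∀ g ∈ level p n, V.ρ g v = v}
  add_mem' ha hb g hg := by rw [map_add, ha g hg, hb g hg]
  zero_mem' g _ := map_zero _
  smul_mem' c v hv g hg := by rw [map_smul, hv g hg]

theorem mem_fixedPts {V : ZpRep p} {n : ℕ} {v : V.V} :
    v ∈ fixedPts V n ↔ ∀ g ∈ level p n, V.ρ g v = v := Iff.rfl

theorem level_anti {m n : ℕ} (h : m ≤ n) : level p n ≤ level p m := by
  intro g hg
  have hg' : g.toAdd ∈ Ideal.span {(p : ℤ_[p]) ^ n} := hg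
  change g.toAdd ∈ Ideal.span {(p : ℤ_[p]) ^ m}
  rw [Ideal.mem_span_singleton] at hg' ⊢
  exact (pow_dvd_pow _ h).trans hg'

theorem fixedPts_mono (V : ZpRep p) {m n : ℕ} (h : m ≤ n) : fixedPts V m ≤ fixedPts V n :=
  fun _ hv g hg => hv g (level_anti h hg)

theorem ρ_comm (V : ZpRep p) (g h : Multiplicative ℤ_[p]) (v : V.V) :
    V.ρ g (V.ρ h v) = V.ρ h (V.ρ g v) := by
  rw [← Module.End.mul_apply, ← Module.End.mul_apply, ← map_mul, ← map_mul, mul_comm]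

theorem fixedPts_invariant (V : ZpRep p) (n : ℕ) (g : Multiplicative ℤ_[p]) {v : V.V}
    (hv : v ∈ fixedPts V n) : V.ρ g v ∈ fixedPts V n := by
  intro h hh
  rw [ρ_comm, hv h hh]

theorem map_mem_fixedPts {V W : ZpRep p} (f : V ⟶ W) {n : ℕ} {v : V.V}
    (hv : v ∈ fixedPts V n) : f.hom v ∈ fixedPts W n := by
  intro g hg
  rw [← Rep.hom_comm_apply, hv g hg]

/-- A representation is discrete if the action of `ℤ_p` on each vector factors through a
finite quotient `ℤ_p / p ^ n`. -/
def isDiscrete (p : ℕ) [Fact p.Prime] : ObjectProperty (ZpRep p) :=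
  fun V => ∀ v : V.V, ∃ n, v ∈ fixedPts V n

/-- The category of discrete (rational) `ℤ_p`-modules. -/
abbrev DiscMod (p : ℕ) [Fact p.Prime] := (isDiscrete p).FullSubcategory

/-- The representation on an invariant subspace. -/
abbrev subRep (V : ZpRep p) (W : Submodule ℚ V.V) (hW : ∀ g, ∀ v ∈ W, V.ρ g v ∈ W) : ZpRep p :=
  Rep.of (X := W)
    { toFun := fun g => (V.ρ g).restrict (hW g)
      map_one' := by ext v; simp
      map_mul' := fun g h => by ext v; simp }

/-- The product of a family of representations, with pointwise action. -/
abbrev piRep {ι : Type} (M : ι → ZpRep p) : ZpRep p :=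
  Rep.of (X := ∀ i, (M i).V)
    { toFun := fun g => LinearMap.pi fun i => (M i).ρ g ∘ₗ LinearMap.proj i
      map_one' := by ext v; simp
      map_mul' := fun g h => by ext v; simp }

@[simp] theorem piRep_ρ {ι : Type} (M : ι → ZpRep p) (g) (v : ∀ i, (M i).V) (i : ι) :
    (show ∀ i, (M i).V from (piRep M).ρ g v) i = (M i).ρ g (v i) := rfl

/-- The binary product of representations. -/
abbrev prodRep (V W : ZpRep p) : ZpRep p :=
  Rep.of (X := V.V × W.V)
    { toFun := fun g => (V.ρ g).prodMap (W.ρ g)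
      map_one' := by ext v <;> simp
      map_mul' := fun g h => by ext v <;> simp }

@[simp] theorem prodRep_ρ (V W : ZpRep p) (g) (v : V.V × W.V) :
    (prodRep V W).ρ g v = (V.ρ g v.1, W.ρ g v.2) := rfl

/-- The zero representation. -/
abbrev zeroRep (p : ℕ) [Fact p.Prime] : ZpRep p := Rep.trivial ℚ (Multiplicative ℤ_[p]) PUnit

/-- The permutation module `ℚ[ℤ_p / p ^ n]`. -/
abbrev permRep (p : ℕ) [Fact p.Prime] (n : ℕ) : ZpRep p :=
  Rep.ofMulAction ℚ (Multiplicative ℤ_[p]) (Multiplicative ℤ_[p] ⧸ level p n)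

theorem permRep_fixed (n : ℕ) (v : (permRep p n).V) : v ∈ fixedPts (permRep p n) n := by
  intro g hg
  have : (fun x : Multiplicative ℤ_[p] ⧸ level p n => g • x) = id := by
    funext x
    induction x using QuotientGroup.induction_on with
    | H x =>
      change ((g * x : Multiplicative ℤ_[p]) : _ ⧸ level p n) = x
      rw [eq_comm, QuotientGroup.eq, mul_comm g x]
      simpa using hg
  have h2 : Representation.ofMulAction ℚ (Multiplicative ℤ_[p])
      (Multiplicative ℤ_[p] ⧸ level p n) g = LinearMap.id := by
    rw [Representation.ofMulAction_def, this, Finsupp.lmapDomain_id]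
    rfl
  exact LinearMap.congr_fun h2 v

/-! ### Sequential colimits of representations -/

/-- The colimit of `F 0 ⟶ F 1 ⟶ ⋯`; the group acts through the terms of the system. -/
abbrev seqColim (F : ℕ → ZpRep p) (t : ∀ i j, i ≤ j → (F i ⟶ F j)) : ZpRep p :=
  Rep.of (X := Module.DirectLimit (fun i => (F i).V) fun i j h => (t i j h).hom.toLinearMap)
    { toFun := fun g => Module.DirectLimit.map (fun i => (F i).ρ g) fun i j h => by
        ext v; exact (Rep.hom_comm_apply (t i j h) g v).symm
      map_one' := by
        refine Module.DirectLimit.hom_ext fun i => LinearMap.ext fun x => ?_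
        simp
      map_mul' := fun g h => by
        refine Module.DirectLimit.hom_ext fun i => LinearMap.ext fun x => ?_
        simp }

/-- The canonical map from a term to the colimit. -/
def seqColim.ι (F : ℕ → ZpRep p) (t : ∀ i j, i ≤ j → (F i ⟶ F j)) (i : ℕ) :
    F i ⟶ seqColim F t :=
  homOf (Module.DirectLimit.of ℚ ℕ (fun i => (F i).V) (fun i j h => (t i j h).hom.toLinearMap) i)
    fun g v => by
      have hc : ∀ i j h, (F j).ρ g ∘ₗ (t i j h).hom.toLinearMap =
          (t i j h).hom.toLinearMap ∘ₗ (F i).ρ g := fun i j h => by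
        ext v; exact (Rep.hom_comm_apply (t i j h) g v).symm
      exact (Module.DirectLimit.map_apply_of (fun i => (F i).ρ g) hc v).symm

section seqColim

variable {F F' F'' : ℕ → ZpRep p} {t : ∀ i j, i ≤ j → (F i ⟶ F j)}
  {t' : ∀ i j, i ≤ j → (F' i ⟶ F' j)} {t'' : ∀ i j, i ≤ j → (F'' i ⟶ F'' j)}

theorem seqColim.exists_ι (x : (seqColim F t).V) : ∃ i y, (seqColim.ι F t i).hom y = x :=
  Module.DirectLimit.exists_of (G := fun i => (F i).V)
    (f := fun i j h => (t i j h).hom.toLinearMap) x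

theorem seqColim.ι_trans {i j : ℕ} (h : i ≤ j) (x : (F i).V) :
    (seqColim.ι F t j).hom ((t i j h).hom x) = (seqColim.ι F t i).hom x :=
  Module.DirectLimit.of_f (R := ℚ) (G := fun i => (F i).V)
    (f := fun i j h => (t i j h).hom.toLinearMap) (hij := h) (x := x)

theorem seqColim.hom_ext {V : ZpRep p} {f g : seqColim F t ⟶ V}
    (h : ∀ i x, f.hom ((seqColim.ι F t i).hom x) = g.hom ((seqColim.ι F t i).hom x)) : f = g := by
  refine Rep.hom_ext (Representation.IntertwiningMap.ext (LinearMap.ext fun x => ?_))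
  obtain ⟨i, y, rfl⟩ := seqColim.exists_ι x
  exact h i y

/-- The underlying linear map of `seqColim.map`. -/
def seqColim.lmap (f : ∀ i, F i ⟶ F' i) (hf : ∀ i j h, t i j h ≫ f j = f i ≫ t' i j h) :
    (seqColim F t).V →ₗ[ℚ] (seqColim F' t').V :=
  Module.DirectLimit.map (fun i => (f i).hom.toLinearMap) fun i j h => by
      ext x; exact congrArg (fun k => k.hom x) (hf i j h)

theorem seqColim.lmap_ι (f : ∀ i, F i ⟶ F' i)
    (hf : ∀ i j h, t i j h ≫ f j = f i ≫ t' i j h) (i : ℕ) (x : (F i).V) :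
    seqColim.lmap f hf ((seqColim.ι F t i).hom x) =
      (seqColim.ι F' t' i).hom ((f i).hom x) :=
  Module.DirectLimit.map_apply_of (fun i => (f i).hom.toLinearMap) _ x

/-- The map of colimits induced by a map of systems. -/
def seqColim.map (f : ∀ i, F i ⟶ F' i) (hf : ∀ i j h, t i j h ≫ f j = f i ≫ t' i j h) :
    seqColim F t ⟶ seqColim F' t' :=
  homOf (seqColim.lmap f hf) fun g x => by
    obtain ⟨i, y, rfl⟩ := seqColim.exists_ι x
    rw [← Rep.hom_comm_apply, seqColim.lmap_ι, seqColim.lmap_ι, Rep.hom_comm_apply,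
      Rep.hom_comm_apply]

@[simp] theorem seqColim.map_ι (f : ∀ i, F i ⟶ F' i)
    (hf : ∀ i j h, t i j h ≫ f j = f i ≫ t' i j h) (i : ℕ) (x : (F i).V) :
    (seqColim.map f hf).hom ((seqColim.ι F t i).hom x) =
      (seqColim.ι F' t' i).hom ((f i).hom x) :=
  seqColim.lmap_ι f hf i x

end seqColim

/-! ### Tails: `colim_n ∏_{k ≥ n} M_k` -/

/-- `∏_{k ≥ n} M_k` -/
abbrev seqFrom (M : ℕ → ZpRep p) (n : ℕ) : ZpRep p := piRep fun k : {k // n ≤ k} => M k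

/-- Truncation of sequences. -/
def seqFrom.trunc (M : ℕ → ZpRep p) (m n : ℕ) (h : m ≤ n) : seqFrom M m ⟶ seqFrom M n :=
  homOf (LinearMap.pi fun k : {k // n ≤ k} =>
    LinearMap.proj (φ := fun k : {k // m ≤ k} => (M k).V) ⟨k.1, h.trans k.2⟩)
    fun _ _ => by rfl

/-- `colim_n ∏_{k ≥ n} M_k`; this need not be discrete. -/
abbrev tails (M : ℕ → ZpRep p) : ZpRep p := seqColim (seqFrom M) (seqFrom.trunc M)

/-- The class in `tails M` of a sequence starting at `n`. -/
def tails.germ (M : ℕ → ZpRep p) (n : ℕ) : seqFrom M n ⟶ tails M := seqColim.ι _ _ n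

/-- Functoriality of `tails`. -/
def tails.map {M N : ℕ → ZpRep p} (f : ∀ k, M k ⟶ N k) : tails M ⟶ tails N :=
  seqColim.map (fun n => homOf (LinearMap.pi fun k => (f k).hom.toLinearMap ∘ₗ LinearMap.proj k)
    fun g v => funext fun k => Rep.hom_comm_apply (f k) g (v k)) fun _ _ _ => by rfl

theorem tails.map_germ {M N : ℕ → ZpRep p} (f : ∀ k, M k ⟶ N k) (n : ℕ)
    (s : ∀ k : {k // n ≤ k}, (M k).V) :
    (tails.map f).hom ((tails.germ M n).hom s) =
      (tails.germ N n).hom (fun k => (f k).hom (s k)) :=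
  seqColim.map_ι (F := seqFrom M) (t := seqFrom.trunc M) (F' := seqFrom N)
    (t' := seqFrom.trunc N) _ _ n s

theorem tails.exists_germ {M : ℕ → ZpRep p} (x : (tails M).V) :
    ∃ (n : ℕ) (s : ∀ k : {k // n ≤ k}, (M k).V), (tails.germ M n).hom s = x :=
  seqColim.exists_ι x

theorem tails.germ_trunc {M : ℕ → ZpRep p} {m n : ℕ} (h : m ≤ n)
    (s : ∀ k : {k // m ≤ k}, (M k).V) :
    (tails.germ M n).hom (fun k => s ⟨k.1, h.trans k.2⟩) = (tails.germ M m).hom s :=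
  seqColim.ι_trans (F := seqFrom M) (t := seqFrom.trunc M) h s

theorem tails.hom_ext {M : ℕ → ZpRep p} {V : ZpRep p} {f g : tails M ⟶ V}
    (h : ∀ (n : ℕ) (s : ∀ k : {k // n ≤ k}, (M k).V),
      f.hom ((tails.germ M n).hom s) = g.hom ((tails.germ M n).hom s)) : f = g :=
  seqColim.hom_ext h

theorem tails.map_id (M : ℕ → ZpRep p) : tails.map (fun k => 𝟙 (M k)) = 𝟙 _ :=
  tails.hom_ext fun n s => by rw [tails.map_germ]; rfl

theorem tails.map_comp {M N P : ℕ → ZpRep p} (f : ∀ k, M k ⟶ N k) (g : ∀ k, N k ⟶ P k) :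
    tails.map (fun k => f k ≫ g k) = tails.map f ≫ tails.map g :=
  tails.hom_ext fun n s => by
    rw [tails.map_germ, Rep.hom_comp, Representation.IntertwiningMap.comp_apply,
      tails.map_germ, tails.map_germ]; rfl

theorem tails.map_zero (M N : ℕ → ZpRep p) :
    tails.map (fun k => (0 : M k ⟶ N k)) = 0 :=
  tails.hom_ext fun n s => by
    rw [tails.map_germ]
    exact _root_.map_zero (tails.germ N n).hom

theorem tails.map_add {M N : ℕ → ZpRep p} (f g : ∀ k, M k ⟶ N k) :
    tails.map (fun k => f k + g k) = tails.map f + tails.map g :=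
  tails.hom_ext fun n s => by
    have h : (tails.map f + tails.map g).hom ((tails.germ M n).hom s) =
      (tails.map f).hom ((tails.germ M n).hom s) + (tails.map g).hom ((tails.germ M n).hom s) := rfl
    rw [h, tails.map_germ, tails.map_germ, tails.map_germ]
    exact _root_.map_add (tails.germ N n).hom
      (show (seqFrom N n).V from fun k => (f k).hom (s k)) (fun k => (g k).hom (s k))

theorem tails.map_injective {M N : ℕ → ZpRep p} (f : ∀ k, M k ⟶ N k)
    (hf : ∀ k, Function.Injective (f k).hom) : Function.Injective (tails.map f).hom := by
  refine (injective_iff_map_eq_zero _).2 fun x hx => ?_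
  obtain ⟨n, s, rfl⟩ := tails.exists_germ x
  rw [tails.map_germ] at hx
  have : DirectedSystem (fun i => (seqFrom N i).V)
      (fun i j h => (seqFrom.trunc N i j h).hom.toLinearMap) :=
    ⟨fun _ _ => by rfl, fun _ _ _ _ _ _ => by rfl⟩
  obtain ⟨m, hm, h0⟩ := Module.DirectLimit.of.zero_exact
    (f := fun i j h => (seqFrom.trunc N i j h).hom.toLinearMap) hx
  rw [← tails.germ_trunc hm]
  have : (fun k : {k // m ≤ k} => s ⟨k.1, hm.trans k.2⟩) = 0 := by
    funext k
    apply hf k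
    exact (congrFun h0 k).trans (_root_.map_zero (f k).hom).symm
  rw [this]
  exact _root_.map_zero (tails.germ M m).hom

/-! ### The algebraic model -/

/-- An object of the algebraic model: `ℚ[ℤ_p / p ^ k]`-modules `M_k` (that is, representations of
`ℤ_p` on which `p ^ k ℤ_p` acts trivially), a discrete `ℤ_p`-module `M_∞`, and a map of
`ℤ_p`-modules from `M_∞` to `colim_n ∏_{k ≥ n} M_k`. -/
structure AlgModel (p : ℕ) [Fact p.Prime] where
  fin : ℕ → ZpRep p
  fin_fixed : ∀ k (v : (fin k).V), v ∈ fixedPts (fin k) k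
  inf : ZpRep p
  inf_discrete : isDiscrete p inf
  str : inf ⟶ tails fin

namespace AlgModel

/-- A morphism of the algebraic model. -/
@[ext]
structure Hom (M N : AlgModel p) where
  fin : ∀ k, M.fin k ⟶ N.fin k
  inf : M.inf ⟶ N.inf
  comm : M.str ≫ tails.map fin = inf ≫ N.str

instance : Category (AlgModel p) where
  Hom := Hom
  id M := ⟨fun _ => 𝟙 _, 𝟙 _, by rw [tails.map_id]; simp⟩
  comp f g := ⟨fun k => f.fin k ≫ g.fin k, f.inf ≫ g.inf, by
    rw [tails.map_comp, ← Category.assoc, f.comm, Category.assoc, g.comm, Category.assoc]⟩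
  id_comp f := Hom.ext (funext fun _ => Category.id_comp _) (Category.id_comp _)
  comp_id f := Hom.ext (funext fun _ => Category.comp_id _) (Category.comp_id _)
  assoc f g h := Hom.ext (funext fun _ => Category.assoc _ _ _) (Category.assoc _ _ _)

@[ext] theorem hom_ext {M N : AlgModel p} {f g : M ⟶ N} (h : ∀ k, f.fin k = g.fin k)
    (h' : f.inf = g.inf) : f = g := Hom.ext (funext h) h'

@[simp] theorem id_fin (M : AlgModel p) (k : ℕ) : Hom.fin (𝟙 M) k = 𝟙 _ := rfl
@[simp] theorem id_inf (M : AlgModel p) : Hom.inf (𝟙 M) = 𝟙 _ := rfl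
@[simp] theorem comp_fin {M N P : AlgModel p} (f : M ⟶ N) (g : N ⟶ P) (k : ℕ) :
    (f ≫ g).fin k = f.fin k ≫ g.fin k := rfl
@[simp] theorem comp_inf {M N P : AlgModel p} (f : M ⟶ N) (g : N ⟶ P) :
    (f ≫ g).inf = f.inf ≫ g.inf := rfl

theorem tails_map_neg {M N : ℕ → ZpRep p} (f : ∀ k, M k ⟶ N k) :
    tails.map (fun k => -f k) = -tails.map f := by
  rw [eq_neg_iff_add_eq_zero, ← tails.map_add]
  simp [tails.map_zero]

instance (M N : AlgModel p) : Zero (M ⟶ N) :=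
  ⟨⟨fun _ => 0, 0, by rw [tails.map_zero]; simp⟩⟩
instance (M N : AlgModel p) : Add (M ⟶ N) :=
  ⟨fun f g => ⟨fun k => f.fin k + g.fin k, f.inf + g.inf, by
    rw [tails.map_add, Preadditive.comp_add, f.comm, g.comm, Preadditive.add_comp]⟩⟩
instance (M N : AlgModel p) : Neg (M ⟶ N) :=
  ⟨fun f => ⟨fun k => -f.fin k, -f.inf, by
    rw [tails_map_neg, Preadditive.comp_neg, f.comm, Preadditive.neg_comp]⟩⟩

@[simp] theorem zero_fin (M N : AlgModel p) (k : ℕ) : (0 : M ⟶ N).fin k = 0 := rfl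
@[simp] theorem zero_inf (M N : AlgModel p) : (0 : M ⟶ N).inf = 0 := rfl
@[simp] theorem add_fin {M N : AlgModel p} (f g : M ⟶ N) (k : ℕ) :
    (f + g).fin k = f.fin k + g.fin k := rfl
@[simp] theorem add_inf {M N : AlgModel p} (f g : M ⟶ N) : (f + g).inf = f.inf + g.inf := rfl
@[simp] theorem neg_fin {M N : AlgModel p} (f : M ⟶ N) (k : ℕ) : (-f).fin k = -f.fin k := rfl
@[simp] theorem neg_inf {M N : AlgModel p} (f : M ⟶ N) : (-f).inf = -f.inf := rfl

instance (M N : AlgModel p) : AddCommGroup (M ⟶ N) where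
  add_assoc f g h := by ext1 <;> simp [add_assoc]
  zero_add f := by ext1 <;> simp
  add_zero f := by ext1 <;> simp
  neg_add_cancel f := by ext1 <;> simp
  add_comm f g := by ext1 <;> simp [add_comm]
  nsmul := nsmulRec
  zsmul := zsmulRec

instance : Preadditive (AlgModel p) where
  add_comp _ _ _ f g h := by ext1 <;> simp
  comp_add _ _ _ f g h := by ext1 <;> simp

/-- The value at `n`. -/
@[simps] def evFin (p : ℕ) [Fact p.Prime] (k : ℕ) : AlgModel p ⥤ ZpRep p where
  obj M := M.fin k
  map f := f.fin k

/-- The value at infinity. -/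
@[simps] def evInf (p : ℕ) [Fact p.Prime] : AlgModel p ⥤ ZpRep p where
  obj M := M.inf
  map f := f.inf

instance (k : ℕ) : (evFin p k).Additive where
instance : (evInf p).Additive where

/-- The object `A(n)`, with value `ℚ[ℤ_p / p ^ n]` in all entries `k ≥ n` (including infinity)
and zero elsewhere, with the diagonal as structure map.
The value at `k` is written as the product of copies of `ℚ[ℤ_p / p ^ n]` indexed by the proofs of
`n ≤ k`, which is one copy if `n ≤ k` and zero otherwise. -/
def A (p : ℕ) [Fact p.Prime] (n : ℕ) : AlgModel p where
  fin k := piRep fun _ : PLift (n ≤ k) => permRep p n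
  fin_fixed k v g hg := funext fun h => permRep_fixed n (v h) g (level_anti h.down hg)
  inf := permRep p n
  inf_discrete v := ⟨n, permRep_fixed n v⟩
  str := homOf (LinearMap.pi fun _ => LinearMap.pi fun _ => LinearMap.id) (by
      intro g v
      rfl) ≫ tails.germ (fun k => piRep fun _ : PLift (n ≤ k) => permRep p n) n

/-- The zero object. -/
def zero (p : ℕ) [Fact p.Prime] : AlgModel p where
  fin _ := zeroRep p
  fin_fixed _ _ _ _ := rfl
  inf := zeroRep p
  inf_discrete _ := ⟨0, fun _ _ => rfl⟩
  str := 0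

instance : Limits.HasZeroObject (AlgModel p) where
  zero := ⟨zero p, by
    have h : 𝟙 (zero p) = 0 := by
      ext1 <;> exact Rep.hom_ext (Representation.IntertwiningMap.ext
        (LinearMap.ext fun x => Subsingleton.elim (α := PUnit) _ _))
    exact (Limits.IsZero.iff_id_eq_zero _).2 h⟩

end AlgModel

/-! ### The space of closed subgroups, and sheaves on it -/

/-- The space `𝒮 ℤ_p` of closed subgroups of `ℤ_p`: the subspace of `ℝ` consisting of the points
`p⁻ⁿ` (corresponding to `p ^ n ℤ_p`) and the point `0` (corresponding to the trivial group). -/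
abbrev SubgroupSpace (p : ℕ) : TopCat.{0} :=
  TopCat.of {x : ℝ // x = 0 ∨ ∃ n : ℕ, x = ((p : ℝ) ^ n)⁻¹}

/-- The point of `𝒮 ℤ_p` given by `p ^ n ℤ_p`, respectively (for `none`) by the trivial group. -/
def pt (p : ℕ) : Option ℕ → SubgroupSpace p
  | none => ⟨0, Or.inl rfl⟩
  | some n => ⟨((p : ℝ) ^ n)⁻¹, Or.inr ⟨n, rfl⟩⟩

theorem inv_pow_le_iff {m n : ℕ} : ((p : ℝ) ^ m)⁻¹ ≤ ((p : ℝ) ^ n)⁻¹ ↔ n ≤ m := by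
  have h1 : (1 : ℝ) < p := by exact_mod_cast (Fact.out : p.Prime).one_lt
  rw [inv_le_inv₀ (by positivity) (by positivity)]
  exact pow_le_pow_iff_right₀ h1

theorem inv_pow_lt_iff {m n : ℕ} : ((p : ℝ) ^ m)⁻¹ < ((p : ℝ) ^ n)⁻¹ ↔ n < m := by
  rw [lt_iff_not_ge, inv_pow_le_iff, not_le]

/-- The open set `S_n`: all points `p ^ k ℤ_p` with `k ≥ n`, and the trivial group. -/
def S (p : ℕ) [Fact p.Prime] (n : ℕ) : Opens (SubgroupSpace p) where
  carrier := {x | x.1 ≤ ((p : ℝ) ^ n)⁻¹}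
  is_open' := by
    have hp : (0 : ℝ) < p := by exact_mod_cast (Fact.out : p.Prime).pos
    rcases n with _ | n
    · convert isOpen_univ
      rw [Set.eq_univ_iff_forall]
      rintro ⟨x, rfl | ⟨m, rfl⟩⟩
      · simp
      · exact inv_pow_le_iff.2 m.zero_le
    · have : {x : SubgroupSpace p | x.1 ≤ ((p : ℝ) ^ (n + 1))⁻¹} =
          {x : SubgroupSpace p | x.1 < ((p : ℝ) ^ n)⁻¹} := by
        ext ⟨x, rfl | ⟨m, rfl⟩⟩
        · have h1 : (0 : ℝ) < ((p : ℝ) ^ n)⁻¹ := by positivity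
          have h2 : (0 : ℝ) < ((p : ℝ) ^ (n + 1))⁻¹ := by positivity
          simp only [Set.mem_ofPred_eq]
          exact ⟨fun _ => h1, fun _ => h2.le⟩
        · simp only [Set.mem_ofPred_eq]
          rw [inv_pow_le_iff, inv_pow_lt_iff]
          rfl
      rw [this]
      exact isOpen_lt continuous_subtype_val continuous_const

/-- The open set consisting of the single point `p ^ n ℤ_p`. -/
def single (p : ℕ) [Fact p.Prime] (n : ℕ) : Opens (SubgroupSpace p) where
  carrier := {pt p (some n)}
  is_open' := by
    have hp : (0 : ℝ) < p := by exact_mod_cast (Fact.out : p.Prime).pos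
    have : ({pt p (some n)} : Set (SubgroupSpace p)) =
        (S p n : Set (SubgroupSpace p)) ∩ {x | ((p : ℝ) ^ (n + 1))⁻¹ < x.1} := by
      ext ⟨x, hx⟩
      simp only [Set.mem_singleton_iff, S, pt, Opens.coe_mk, Set.mem_inter_iff, Set.mem_ofPred_eq,
        Subtype.mk.injEq]
      constructor
      · rintro rfl
        exact ⟨le_rfl, inv_pow_lt_iff.2 n.lt_succ_self⟩
      · rcases hx with rfl | ⟨m, rfl⟩
        · rintro ⟨-, h⟩
          have : (0 : ℝ) < ((p : ℝ) ^ (n + 1))⁻¹ := by positivity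
          exact absurd h this.not_gt
        · rw [inv_pow_le_iff, inv_pow_lt_iff]
          rintro ⟨h1, h2⟩
          rw [show m = n by omega]
    rw [this]
    exact (S p n).isOpen.inter (isOpen_lt continuous_const continuous_subtype_val)

theorem mem_S_some {n k : ℕ} : pt p (some k) ∈ S p n ↔ n ≤ k := inv_pow_le_iff

theorem mem_S_none (n : ℕ) : pt p none ∈ S p n := by
  change (0 : ℝ) ≤ _
  positivity

theorem S_anti {m n : ℕ} (h : m ≤ n) : S p n ≤ S p m :=
  fun _ hx => le_trans (show _ ≤ ((p : ℝ) ^ n)⁻¹ from hx) (inv_pow_le_iff.2 h)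

theorem single_le_S {n k : ℕ} (h : n ≤ k) : single p k ≤ S p n := by
  rintro x rfl
  exact mem_S_some.2 h

/-- The sets `S_n` form a neighbourhood basis of the trivial group. -/
theorem exists_S_le {O : Opens (SubgroupSpace p)} (h : pt p none ∈ O) : ∃ n, S p n ≤ O := by
  obtain ⟨ε, hε, hO⟩ := Metric.isOpen_iff.1 O.isOpen _ h
  have h1 : (1 : ℝ) < p := by exact_mod_cast (Fact.out : p.Prime).one_lt
  obtain ⟨n, hn⟩ := exists_pow_lt_of_lt_one hε (inv_lt_one_of_one_lt₀ h1)
  refine ⟨n, fun x hx => hO ?_⟩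
  have hx' : x.1 ≤ ((p : ℝ) ^ n)⁻¹ := hx
  have h0 : 0 ≤ x.1 := by
    obtain ⟨x, rfl | ⟨n, rfl⟩⟩ := x
    · exact le_rfl
    · positivity
  change dist x.1 (0 : ℝ) < ε
  rw [Real.dist_eq, sub_zero, abs_of_nonneg h0]
  rw [inv_pow] at hn
  exact hx'.trans_lt hn

/-- The sheaf model: sheaves on `𝒮 ℤ_p` with values in the category of discrete `ℤ_p`-modules. -/
abbrev SheafModel (p : ℕ) [Fact p.Prime] := TopCat.Sheaf (DiscMod p) (SubgroupSpace p)

instance : Preadditive (SheafModel p) :=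
  inferInstanceAs (Preadditive (CategoryTheory.Sheaf (Opens.grothendieckTopology _) (DiscMod p)))

/-! ### The functor `U` -/

namespace AlgModel

/-- The value of an object at a point of `𝒮 ℤ_p`. -/
def fib (M : AlgModel p) : Option ℕ → ZpRep p
  | none => M.inf
  | some k => M.fin k

theorem fib_discrete (M : AlgModel p) : ∀ a, isDiscrete p (M.fib a)
  | none => M.inf_discrete
  | some k => fun v => ⟨k, M.fin_fixed k v⟩

/-- The map on values at a point. -/
def Hom.fib {M N : AlgModel p} (f : Hom M N) : ∀ a, M.fib a ⟶ N.fib a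
  | none => f.inf
  | some k => f.fin k

/-- The sections of `U M` over an open set `O`, as a subspace of the product of the values of `M`
at the points of `O`: if `O` contains the trivial group (equivalently, contains some `S_n`), then
the sequence `(s_k)` has to be eventually specified by `s_∞`, i.e. it has to represent the image of
`s_∞` in `colim_n ∏_{k ≥ n} M_k`. Moreover the whole family is required to be fixed by some
`p ^ j ℤ_p`, since products of discrete modules are formed in the category of discrete modules
(this is automatic if `O` contains the trivial group or is finite). -/
def sections (M : AlgModel p) (O : Opens (SubgroupSpace p)) :
    Submodule ℚ (piRep fun a : {a // pt p a ∈ O} => M.fib a).V where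
  carrier := {s | (∀ (n : ℕ) (h : S p n ≤ O),
      M.str.hom (s ⟨none, h (mem_S_none n)⟩) =
        (tails.germ M.fin n).hom (fun k => s ⟨some k.1, h (mem_S_some.2 k.2)⟩)) ∧
      ∃ j, s ∈ fixedPts (piRep fun a : {a // pt p a ∈ O} => M.fib a) j}
  add_mem' := by
    rintro s t ⟨hs, i, hi⟩ ⟨ht, j, hj⟩
    refine ⟨fun n h => ?_, max i j, Submodule.add_mem _ (fixedPts_mono _ (le_max_left _ _) hi)
      (fixedPts_mono _ (le_max_right _ _) hj)⟩
    exact (map_add M.str.hom _ _).trans ((congrArg₂ (· + ·) (hs n h) (ht n h)).trans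
      (map_add (tails.germ M.fin n).hom _ _).symm)
  zero_mem' := ⟨fun n h => (map_zero M.str.hom).trans (map_zero (tails.germ M.fin n).hom).symm,
    0, Submodule.zero_mem _⟩
  smul_mem' := by
    rintro c s ⟨hs, i, hi⟩
    refine ⟨fun n h => ?_, i, Submodule.smul_mem _ c hi⟩
    exact (map_smul M.str.hom c _).trans ((congrArg (c • ·) (hs n h)).trans
      (map_smul (tails.germ M.fin n).hom c _).symm)

theorem sections_invariant (M : AlgModel p) (O : Opens (SubgroupSpace p)) (g)
    (s : (piRep fun a : {a // pt p a ∈ O} => M.fib a).V) (hs : s ∈ M.sections O) :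
    (piRep fun a : {a // pt p a ∈ O} => M.fib a).ρ g s ∈ M.sections O := by
  obtain ⟨hs, i, hi⟩ := hs
  refine ⟨fun n h => ?_, i, fixedPts_invariant _ _ _ hi⟩
  exact (Rep.hom_comm_apply M.str g _).trans ((congrArg ((tails M.fin).ρ g) (hs n h)).trans
    (Rep.hom_comm_apply (tails.germ M.fin n) g _).symm)

/-- The discrete `ℤ_p`-module of sections of `U M` over `O`. -/
def sectionsMod (M : AlgModel p) (O : Opens (SubgroupSpace p)) : DiscMod p :=
  ⟨subRep _ (M.sections O) (M.sections_invariant O), fun v => by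
    obtain ⟨j, hj⟩ := v.2.2
    exact ⟨j, fun g hg => Subtype.ext (hj g hg)⟩⟩

/-- The restriction of sections. -/
def sectionsRes (M : AlgModel p) {O O' : Opens (SubgroupSpace p)} (h : O' ≤ O) :
    M.sectionsMod O ⟶ M.sectionsMod O' :=
  ObjectProperty.homMk <| homOf
    { toFun := fun s => ⟨fun a => s.1 ⟨a.1, h a.2⟩, fun n hn => s.2.1 n (hn.trans h), by
        obtain ⟨j, hj⟩ := s.2.2
        exact ⟨j, fun g hg => funext fun a => congrFun (hj g hg) ⟨a.1, h a.2⟩⟩⟩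
      map_add' := fun _ _ => rfl
      map_smul' := fun _ _ => rfl } fun _ _ => rfl

/-- The map on sections induced by a morphism. -/
def sectionsMap {M N : AlgModel p} (f : M ⟶ N) (O : Opens (SubgroupSpace p)) :
    M.sectionsMod O ⟶ N.sectionsMod O :=
  ObjectProperty.homMk <| homOf
    { toFun := fun s => ⟨fun a => (f.fib a.1).hom (s.1 a), fun n hn => by
          have h1 := congrArg (fun l => l.hom (s.1 ⟨none, hn (mem_S_none n)⟩)) f.comm
          have h2 := congrArg (tails.map f.fin).hom (s.2.1 n hn)
          exact h1.symm.trans (h2.trans (tails.map_germ f.fin n _)), by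
        obtain ⟨j, hj⟩ := s.2.2
        refine ⟨j, fun g hg => funext fun a => ?_⟩
        exact (Rep.hom_comm_apply (f.fib a.1) g _).symm.trans
          (congrArg (f.fib a.1).hom (congrFun (hj g hg) a))⟩
      map_add' := fun s t => Subtype.ext (funext fun a => map_add (f.fib a.1).hom _ _)
      map_smul' := fun c s => Subtype.ext (funext fun a => map_smul (f.fib a.1).hom c _) }
    fun g s => Subtype.ext (funext fun a => Rep.hom_comm_apply (f.fib a.1) g _)

/-- The presheaf underlying `U M`. -/
def presheaf (M : AlgModel p) : TopCat.Presheaf (DiscMod p) (SubgroupSpace p) where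
  obj O := M.sectionsMod O.unop
  map i := M.sectionsRes i.unop.le
  map_id _ := rfl
  map_comp _ _ := rfl

theorem presheaf_isSheaf (M : AlgModel p) : M.presheaf.IsSheaf := by
  intro E O R hR x hx
  have hcov : ∀ a : {a // pt p a ∈ O}, ∃ (W : Opens (SubgroupSpace p)) (f : W ⟶ O),
      R f ∧ pt p a ∈ W := fun a => by
    obtain ⟨W, f, hf, ha⟩ := hR (pt p a) a.2
    exact ⟨W, f, hf, ha⟩
  choose W f hf ha using hcov
  -- two members of the family agree at common points
  have key : ∀ (W₁ W₂ : Opens (SubgroupSpace p)) (f₁ : W₁ ⟶ O) (f₂ : W₂ ⟶ O) (h₁ : R f₁)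
      (h₂ : R f₂) (a : Option ℕ) (ha₁ : pt p a ∈ W₁) (ha₂ : pt p a ∈ W₂) (e : E.obj.V),
      ((x f₁ h₁).hom.hom e).1 ⟨a, ha₁⟩ = ((x f₂ h₂).hom.hom e).1 ⟨a, ha₂⟩ := by
    intro W₁ W₂ f₁ f₂ h₁ h₂ a ha₁ ha₂ e
    have := hx (Y₁ := W₁) (Y₂ := W₂) (Z := W₁ ⊓ W₂) (homOfLE inf_le_left) (homOfLE inf_le_right)
      h₁ h₂ (Subsingleton.elim _ _)
    exact congrArg (fun l : E ⟶ M.sectionsMod (W₁ ⊓ W₂) => (l.hom.hom e).1 ⟨a, ha₁, ha₂⟩) this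
  let t : E ⟶ M.sectionsMod O := ObjectProperty.homMk <| homOf
    { toFun := fun e => ⟨fun a => ((x (f a) (hf a)).hom.hom e).1 ⟨a.1, ha a⟩, by
        refine ⟨fun n h => ?_, ?_⟩
        · let a₀ : {a // pt p a ∈ O} := ⟨none, h (mem_S_none n)⟩
          obtain ⟨m, hm⟩ := exists_S_le (ha a₀)
          have h1 := ((x (f a₀) (hf a₀)).hom.hom e).2.1 (max m n)
            ((S_anti (le_max_left m n)).trans hm)
          refine h1.trans (Eq.trans ?_ (tails.germ_trunc (le_max_right m n) _))
          refine congrArg (tails.germ M.fin (max m n)).hom (funext fun k => ?_)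
          exact key _ _ _ _ _ _ _ _ _ e
        · obtain ⟨j, hj⟩ := E.property e
          refine ⟨j, fun g hg => funext fun a => ?_⟩
          have h1 := Rep.hom_comm_apply (x (f a) (hf a)).hom g e
          rw [hj g hg] at h1
          exact (congrArg (fun s => s.1 ⟨a.1, ha a⟩) h1).symm⟩
      map_add' := fun e e' => Subtype.ext (funext fun a =>
        congrArg (fun s => s.1 ⟨a.1, ha a⟩) (map_add (x (f a) (hf a)).hom.hom e e'))
      map_smul' := fun c e => Subtype.ext (funext fun a =>
        congrArg (fun s => s.1 ⟨a.1, ha a⟩) (map_smul (x (f a) (hf a)).hom.hom c e)) }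
    fun g e => Subtype.ext (funext fun a =>
      congrArg (fun s => s.1 ⟨a.1, ha a⟩) (Rep.hom_comm_apply (x (f a) (hf a)).hom g e))
  refine ⟨t, fun W' f' hf' => ?_, fun t' ht' => ?_⟩
  · refine ObjectProperty.hom_ext _ (Rep.hom_ext (Representation.IntertwiningMap.ext
      (LinearMap.ext fun e => Subtype.ext (funext fun a => ?_))))
    exact key _ _ _ _ _ _ _ _ _ e
  · refine ObjectProperty.hom_ext _ (Rep.hom_ext (Representation.IntertwiningMap.ext
      (LinearMap.ext fun e => Subtype.ext (funext fun a => ?_))))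
    exact congrArg (fun l : E ⟶ M.sectionsMod (W a) => (l.hom.hom e).1 ⟨a.1, ha a⟩)
      (ht' (f a) (hf a))

end AlgModel

/-- The functor `U` from the algebraic model to the sheaf model. -/
def U (p : ℕ) [Fact p.Prime] : AlgModel p ⥤ SheafModel p where
  obj M := ⟨M.presheaf, M.presheaf_isSheaf⟩
  map f := ⟨{ app := fun O => AlgModel.sectionsMap f O.unop
              naturality := fun _ _ _ => rfl }⟩
  map_id M := by
    apply CategoryTheory.Sheaf.hom_ext
    ext O : 2
    refine ObjectProperty.hom_ext _ (Rep.hom_ext (Representation.IntertwiningMap.ext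
      (LinearMap.ext fun s => Subtype.ext (funext fun ⟨a, _⟩ => ?_))))
    cases a <;> rfl
  map_comp f g := by
    apply CategoryTheory.Sheaf.hom_ext
    ext O : 2
    refine ObjectProperty.hom_ext _ (Rep.hom_ext (Representation.IntertwiningMap.ext
      (LinearMap.ext fun s => Subtype.ext (funext fun ⟨a, _⟩ => ?_))))
    cases a <;> rfl

instance : (U p).PreservesZeroMorphisms where
  map_zero M N := by
    apply CategoryTheory.Sheaf.hom_ext
    ext O : 2
    refine ObjectProperty.hom_ext _ (Rep.hom_ext (Representation.IntertwiningMap.ext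
      (LinearMap.ext fun s => Subtype.ext (funext fun ⟨a, _⟩ => ?_))))
    cases a <;> rfl

/-! ### The functor `R` -/

/-- The representation on the fixed points `V ^ (p ^ n ℤ_p)`. -/
abbrev fixedRep (V : ZpRep p) (n : ℕ) : ZpRep p :=
  subRep V (fixedPts V n) fun g _ hv => fixedPts_invariant V n g hv

/-- The inclusion of the fixed points. -/
def fixedRep.incl (V : ZpRep p) (n : ℕ) : fixedRep V n ⟶ V :=
  homOf (fixedPts V n).subtype fun _ _ => rfl

/-- Functoriality of fixed points. -/
def fixedRep.map {V W : ZpRep p} (f : V ⟶ W) (n : ℕ) : fixedRep V n ⟶ fixedRep W n :=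
  homOf (f.hom.toLinearMap.restrict fun _ hv => map_mem_fixedPts f hv)
    fun g v => Subtype.ext (Rep.hom_comm_apply f g v.1)

theorem fixedRep.incl_injective (V : ZpRep p) (n : ℕ) :
    Function.Injective (fixedRep.incl V n).hom := fun _ _ h => Subtype.ext h

namespace SheafModel

/-- The sections over `O`, as a representation of `ℤ_p`. -/
abbrev val (N : SheafModel p) (O : Opens (SubgroupSpace p)) : ZpRep p := (N.obj.obj (op O)).obj

/-- Restriction of sections. -/
abbrev res (N : SheafModel p) {O O' : Opens (SubgroupSpace p)} (h : O' ≤ O) : N.val O ⟶ N.val O' :=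
  (N.obj.map (homOfLE h).op).hom

/-- The map on sections induced by a morphism of sheaves. -/
abbrev app {M N : SheafModel p} (f : M ⟶ N) (O : Opens (SubgroupSpace p)) : M.val O ⟶ N.val O :=
  (f.hom.app (op O)).hom

theorem res_comp (N : SheafModel p) {O O' O'' : Opens (SubgroupSpace p)} (h : O' ≤ O)
    (h' : O'' ≤ O') : N.res h ≫ N.res h' = N.res (h'.trans h) := by
  change (N.obj.map (homOfLE h).op ≫ N.obj.map (homOfLE h').op).hom = _
  rw [← N.obj.map_comp]
  rfl

theorem res_app {M N : SheafModel p} (f : M ⟶ N) {O O' : Opens (SubgroupSpace p)} (h : O' ≤ O) :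
    M.res h ≫ app f O' = app f O ≫ N.res h :=
  congrArg InducedCategory.Hom.hom (f.hom.naturality (homOfLE h).op)

/-- The stalk at the trivial group, i.e. `colim_n N(S_n)`. -/
abbrev stalk (N : SheafModel p) : ZpRep p :=
  seqColim (fun n => N.val (S p n)) fun _ _ h => N.res (S_anti h)

theorem stalk_discrete (N : SheafModel p) : isDiscrete p N.stalk := by
  intro x
  obtain ⟨i, y, rfl⟩ := seqColim.exists_ι x
  obtain ⟨n, hn⟩ := (N.obj.obj (op (S p i))).property y
  exact ⟨n, map_mem_fixedPts _ hn⟩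

/-- The germ at the trivial group of a section over `S_n`. -/
def germ (N : SheafModel p) (n : ℕ) : N.val (S p n) ⟶ N.stalk :=
  seqColim.ι (fun n => N.val (S p n)) (fun _ _ h => N.res (S_anti h)) n

theorem stalk_hom_ext {N : SheafModel p} {V : ZpRep p} {f g : N.stalk ⟶ V}
    (h : ∀ n, N.germ n ≫ f = N.germ n ≫ g) : f = g :=
  seqColim.hom_ext fun n x => congrArg (fun l => l.hom x) (h n)

/-- The map on stalks at the trivial group. -/
def stalkMap {M N : SheafModel p} (f : M ⟶ N) : M.stalk ⟶ N.stalk :=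
  seqColim.map (fun n => app f (S p n)) fun _ _ h => res_app f (S_anti h)

theorem germ_stalkMap {M N : SheafModel p} (f : M ⟶ N) (n : ℕ) :
    M.germ n ≫ stalkMap f = app f (S p n) ≫ N.germ n := by
  refine Rep.hom_ext (Representation.IntertwiningMap.ext (LinearMap.ext fun x => ?_))
  exact seqColim.lmap_ι (fun n => app f (S p n)) (fun _ _ h => res_app f (S_anti h)) n x

/-- The value of a sheaf at the singletons `{p ^ k ℤ_p}`. -/
abbrev fin (N : SheafModel p) (k : ℕ) : ZpRep p := N.val (single p k)

/-- `N(S_n) → ∏_{k ≥ n} N({p ^ k ℤ_p})`, given by the restrictions. -/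
def toSeq (N : SheafModel p) (n : ℕ) : N.val (S p n) ⟶ seqFrom N.fin n :=
  homOf (LinearMap.pi fun k : {k // n ≤ k} => (N.res (single_le_S k.2)).hom.toLinearMap)
    fun g v => funext fun k => Rep.hom_comm_apply (N.res (single_le_S k.2)) g v

theorem res_toSeq (N : SheafModel p) (m n : ℕ) (h : m ≤ n) :
    N.res (S_anti h) ≫ N.toSeq n = N.toSeq m ≫ seqFrom.trunc N.fin m n h := by
  refine Rep.hom_ext (Representation.IntertwiningMap.ext (LinearMap.ext fun s => ?_))
  refine funext fun k => ?_
  exact congrArg (fun l => l.hom s) (N.res_comp (S_anti h) (single_le_S k.2))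

/-- The map from the stalk at the trivial group to `colim_n ∏_{k ≥ n} N({p ^ k ℤ_p})`. -/
def toTails (N : SheafModel p) : N.stalk ⟶ tails N.fin :=
  seqColim.map N.toSeq N.res_toSeq

theorem germ_toTails (N : SheafModel p) (n : ℕ) :
    N.germ n ≫ N.toTails = N.toSeq n ≫ tails.germ N.fin n := by
  refine Rep.hom_ext (Representation.IntertwiningMap.ext (LinearMap.ext fun x => ?_))
  exact seqColim.lmap_ι (F := fun n => N.val (S p n)) (F' := seqFrom N.fin) N.toSeq N.res_toSeq n x

theorem stalkMap_toTails {M N : SheafModel p} (f : M ⟶ N) :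
    stalkMap f ≫ N.toTails = M.toTails ≫ tails.map fun k => app f (single p k) := by
  refine stalk_hom_ext fun n => ?_
  rw [← Category.assoc, germ_stalkMap, Category.assoc, germ_toTails, ← Category.assoc,
    ← Category.assoc, germ_toTails]
  refine Rep.hom_ext (Representation.IntertwiningMap.ext (LinearMap.ext fun s => ?_))
  refine Eq.trans ?_ (tails.map_germ (fun k => app f (single p k)) n _).symm
  refine congrArg (tails.germ N.fin n).hom (funext fun k => ?_)
  exact (congrArg (fun l => l.hom s) (res_app f (single_le_S k.2))).symm

/-- The value of `R N` at `k`: the fixed points `N({p ^ k ℤ_p}) ^ (p ^ k ℤ_p)`. -/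
abbrev rFin (N : SheafModel p) (k : ℕ) : ZpRep p := fixedRep (N.fin k) k

/-- `colim_n ∏_{k ≥ n} N({p ^ k ℤ_p}) ^ (p ^ k ℤ_p) → colim_n ∏_{k ≥ n} N({p ^ k ℤ_p})` -/
def rTails (N : SheafModel p) : tails N.rFin ⟶ tails N.fin :=
  tails.map fun k => fixedRep.incl (N.fin k) k

theorem rTails_injective (N : SheafModel p) : Function.Injective N.rTails.hom :=
  tails.map_injective _ fun k => fixedRep.incl_injective (N.fin k) k

/-- The underlying space of `(R N)_∞`: the pullback of the stalk at the trivial group and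
`colim_n ∏_{k ≥ n} N({p ^ k ℤ_p}) ^ (p ^ k ℤ_p)`, over `colim_n ∏_{k ≥ n} N({p ^ k ℤ_p})`. -/
def rInfSpace (N : SheafModel p) : Submodule ℚ (prodRep N.stalk (tails N.rFin)).V :=
  LinearMap.eqLocus (N.toTails.hom.toLinearMap ∘ₗ LinearMap.fst ℚ _ _)
    (N.rTails.hom.toLinearMap ∘ₗ LinearMap.snd ℚ _ _)

theorem mem_rInfSpace {N : SheafModel p} {x : N.stalk.V × (tails N.rFin).V} :
    x ∈ N.rInfSpace ↔ N.toTails.hom x.1 = N.rTails.hom x.2 := Iff.rfl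

/-- `(R N)_∞` -/
abbrev rInf (N : SheafModel p) : ZpRep p :=
  subRep (prodRep N.stalk (tails N.rFin)) N.rInfSpace fun g x hx =>
    (Rep.hom_comm_apply N.toTails g x.1).trans
      ((congrArg ((tails N.fin).ρ g) (mem_rInfSpace.1 hx)).trans
        (Rep.hom_comm_apply N.rTails g x.2).symm)

theorem rInf_discrete (N : SheafModel p) : isDiscrete p N.rInf := by
  rintro ⟨⟨x, y⟩, h⟩
  obtain ⟨n, hn⟩ := N.stalk_discrete x
  refine ⟨n, fun g hg => Subtype.ext (Prod.ext (hn g hg) (N.rTails_injective ?_))⟩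
  refine (Rep.hom_comm_apply N.rTails g y).trans ?_
  rw [← mem_rInfSpace.1 h]
  refine (Rep.hom_comm_apply N.toTails g x).symm.trans ?_
  exact congrArg N.toTails.hom (hn g hg)

/-- `R` on objects. -/
def rObj (N : SheafModel p) : AlgModel p where
  fin := N.rFin
  fin_fixed _ v g hg := Subtype.ext (v.2 g hg)
  inf := N.rInf
  inf_discrete := N.rInf_discrete
  str := homOf (LinearMap.snd ℚ _ _ ∘ₗ N.rInfSpace.subtype) fun _ _ => rfl

/-- `R` on morphisms, at `k`. -/
abbrev rMapFin {M N : SheafModel p} (f : M ⟶ N) (k : ℕ) : M.rFin k ⟶ N.rFin k :=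
  fixedRep.map (app f (single p k)) k

theorem rTails_map {M N : SheafModel p} (f : M ⟶ N) :
    tails.map (rMapFin f) ≫ N.rTails =
      M.rTails ≫ tails.map fun k => app f (single p k) := by
  refine (tails.map_comp _ _).symm.trans (Eq.trans ?_ (tails.map_comp _ _))
  rfl

/-- `R` on morphisms. -/
def rMap {M N : SheafModel p} (f : M ⟶ N) : M.rObj ⟶ N.rObj where
  fin := rMapFin f
  inf := homOf (LinearMap.restrict
      ((stalkMap f).hom.toLinearMap.prodMap (tails.map (rMapFin f)).hom.toLinearMap)
      (p := M.rInfSpace) (q := N.rInfSpace) fun x hx => by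
        have h1 := congrArg (fun l => l.hom x.1) (stalkMap_toTails f)
        have h2 := congrArg (fun l => l.hom x.2) (rTails_map f)
        have h3 := congrArg (tails.map fun k => app f (single p k)).hom (mem_rInfSpace.1 hx)
        exact h1.trans (h3.trans h2.symm))
    fun g x => Subtype.ext (Prod.ext (Rep.hom_comm_apply (stalkMap f) g x.1.1)
      (Rep.hom_comm_apply (tails.map (rMapFin f)) g x.1.2))
  comm := rfl

theorem stalkMap_id (N : SheafModel p) : stalkMap (𝟙 N) = 𝟙 _ :=
  stalk_hom_ext fun n => by rw [germ_stalkMap, Category.comp_id]; rfl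

theorem stalkMap_comp {M N P : SheafModel p} (f : M ⟶ N) (g : N ⟶ P) :
    stalkMap (f ≫ g) = stalkMap f ≫ stalkMap g :=
  stalk_hom_ext fun n => by
    rw [germ_stalkMap, ← Category.assoc, germ_stalkMap, Category.assoc, germ_stalkMap]; rfl

theorem stalkMap_zero (M N : SheafModel p) : stalkMap (0 : M ⟶ N) = 0 :=
  stalk_hom_ext fun n => by
    rw [germ_stalkMap, Limits.comp_zero]
    exact Limits.zero_comp

end SheafModel

/-- The functor `R` from the sheaf model to the algebraic model. -/
def R (p : ℕ) [Fact p.Prime] : SheafModel p ⥤ AlgModel p where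
  obj N := N.rObj
  map f := SheafModel.rMap f
  map_id N := by
    refine AlgModel.hom_ext (fun _ => rfl) (Rep.hom_ext (Representation.IntertwiningMap.ext
      (LinearMap.ext fun x => Subtype.ext (Prod.ext ?_ ?_))))
    · exact congrArg (fun l => l.hom x.1.1) (SheafModel.stalkMap_id N)
    · exact congrArg (fun l => l.hom x.1.2) (tails.map_id N.rFin)
  map_comp f g := by
    refine AlgModel.hom_ext (fun _ => rfl) (Rep.hom_ext (Representation.IntertwiningMap.ext
      (LinearMap.ext fun x => Subtype.ext (Prod.ext ?_ ?_))))
    · exact congrArg (fun l => l.hom x.1.1) (SheafModel.stalkMap_comp f g)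
    · exact congrArg (fun l => l.hom x.1.2)
        (tails.map_comp (SheafModel.rMapFin f) (SheafModel.rMapFin g))

instance : (R p).PreservesZeroMorphisms where
  map_zero M N := by
    refine AlgModel.hom_ext (fun _ => rfl) (Rep.hom_ext (Representation.IntertwiningMap.ext
      (LinearMap.ext fun x => Subtype.ext (Prod.ext ?_ ?_))))
    · exact congrArg (fun l => l.hom x.1.1) (SheafModel.stalkMap_zero M N)
    · exact congrArg (fun l => l.hom x.1.2) (tails.map_zero M.rFin N.rFin)

/-! ### Model structures, Quillen pairs and Quillen equivalences -/

section Model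

open Limits HomotopicalAlgebra ZeroObject

/-- Three classes of morphisms in a category. -/
structure ModelData (C : Type*) [Category* C] where
  cof : MorphismProperty C
  fib : MorphismProperty C
  we : MorphismProperty C

namespace ModelData

variable {C D : Type*} [Category* C] [Category* D]

/-- The three classes are the cofibrations, the fibrations and the weak equivalences of a model
category. -/
def IsModel (M : ModelData C) : Prop :=
  ∃ m : ModelCategory C, m.categoryWithCofibrations = ⟨M.cof⟩ ∧
    m.categoryWithFibrations = ⟨M.fib⟩ ∧ m.categoryWithWeakEquivalences = ⟨M.we⟩

/-- An object is cofibrant if the map from an initial object is a cofibration. -/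
def Cofibrant (M : ModelData C) (X : C) : Prop := ∀ (Z : C) (h : IsInitial Z), M.cof (h.to X)

/-- An object is fibrant if the map to a terminal object is a fibration. -/
def Fibrant (M : ModelData C) (X : C) : Prop := ∀ (Z : C) (h : IsTerminal Z), M.fib (h.from X)

/-- The classes with given fibrations and weak equivalences; the cofibrations are defined by the
left lifting property with respect to the acyclic fibrations. -/
def ofFibWe (fib we : MorphismProperty C) : ModelData C where
  cof := (fib ⊓ we).llp
  fib := fib
  we := we

/-- The classes determined by a set `I` of generating cofibrations and a set `J` of generating
acyclic cofibrations: the fibrations are the maps with the right lifting property with respect to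
`J`, the acyclic fibrations are those with respect to `I`, the (acyclic) cofibrations are defined by
the left lifting property with respect to the acyclic fibrations (the fibrations), and the weak
equivalences are the composites of an acyclic cofibration followed by an acyclic fibration. -/
def ofGenerators (I J : MorphismProperty C) : ModelData C where
  cof := I.rlp.llp
  fib := J.rlp
  we X Y f := ∃ (Z : C) (i : X ⟶ Z) (q : Z ⟶ Y), J.rlp.llp i ∧ I.rlp q ∧ i ≫ q = f

/-- An adjunction is a Quillen pair if the left adjoint preserves cofibrations and acyclic
cofibrations. -/
def IsQuillenPair (M : ModelData C) (N : ModelData D) {F : C ⥤ D} {G : D ⥤ C} (_ : F ⊣ G) : Prop :=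
  (∀ ⦃X Y : C⦄ (f : X ⟶ Y), M.cof f → N.cof (F.map f)) ∧
    ∀ ⦃X Y : C⦄ (f : X ⟶ Y), M.cof f → M.we f → N.we (F.map f)

/-- A Quillen pair is a Quillen equivalence if for all cofibrant `X` and fibrant `Y` a map
`F X ⟶ Y` is a weak equivalence if and only if the adjoint map `X ⟶ G Y` is one. -/
def IsQuillenEquivalence (M : ModelData C) (N : ModelData D) {F : C ⥤ D} {G : D ⥤ C}
    (adj : F ⊣ G) : Prop :=
  IsQuillenPair M N adj ∧ ∀ (X : C) (Y : D), M.Cofibrant X → N.Fibrant Y →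
    ∀ f : F.obj X ⟶ Y, N.we f ↔ M.we (adj.homEquiv X Y f)

end ModelData

/-! ### Differential graded objects -/

/-- Differential graded objects of the algebraic model (unbounded chain complexes). -/
abbrev DgAlg (p : ℕ) [Fact p.Prime] := ChainComplex (AlgModel p) ℤ

/-- Differential graded objects of the sheaf model (unbounded chain complexes). -/
abbrev DgSheaf (p : ℕ) [Fact p.Prime] := ChainComplex (SheafModel p) ℤ

/-- `U` on differential graded objects. -/
abbrev dgU (p : ℕ) [Fact p.Prime] : DgAlg p ⥤ DgSheaf p := (U p).mapHomologicalComplex _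

/-- `R` on differential graded objects. -/
abbrev dgR (p : ℕ) [Fact p.Prime] : DgSheaf p ⥤ DgAlg p := (R p).mapHomologicalComplex _

/-- The model structure on `dg 𝒜`: the fibrations are the maps that are surjective at each `n` and
at infinity, the weak equivalences are the maps that are homology isomorphisms at each `n` and at
infinity. -/
def algData (p : ℕ) [Fact p.Prime] : ModelData (DgAlg p) :=
  .ofFibWe
    (fun _ _ f => (∀ k i, Function.Surjective ((f.f i).fin k).hom) ∧
      ∀ i, Function.Surjective (f.f i).inf.hom)
    (fun _ _ f => (∀ k, QuasiIso (((AlgModel.evFin p k).mapHomologicalComplex _).map f)) ∧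
      QuasiIso (((AlgModel.evInf p).mapHomologicalComplex _).map f))

/-- The sections over an open set, as a functor. -/
@[simps] def sectionsFunctor (p : ℕ) [Fact p.Prime] (O : Opens (SubgroupSpace p)) :
    SheafModel p ⥤ ZpRep p where
  obj N := N.val O
  map f := SheafModel.app f O

instance (O : Opens (SubgroupSpace p)) : (sectionsFunctor p O).Additive where

/-- Maps of `dg ℬ` that are surjective at each level, i.e. on the sections over each open set. -/
def levelFib (p : ℕ) [Fact p.Prime] : MorphismProperty (DgSheaf p) :=
  fun _ _ f => ∀ O i, Function.Surjective (SheafModel.app (f.f i) O).hom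

/-- Maps of `dg ℬ` that are homology isomorphisms at each level, i.e. on the sections over each
open set. -/
def levelWe (p : ℕ) [Fact p.Prime] : MorphismProperty (DgSheaf p) :=
  fun _ _ f => ∀ O, QuasiIso (((sectionsFunctor p O).mapHomologicalComplex _).map f)

/-- The levelwise model structure on `dg ℬ`. -/
def levelData (p : ℕ) [Fact p.Prime] : ModelData (DgSheaf p) := .ofFibWe (levelFib p) (levelWe p)

/-- `M ⊗ D^{j+1}`: the complex with `M` in degrees `j + 1` and `j`, and identity differential. -/
def disc (M : AlgModel p) (j : ℤ) : DgAlg p :=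
  HomologicalComplex.double (𝟙 M) (c := ComplexShape.down ℤ) (i₀ := j + 1) (i₁ := j) rfl

/-- `M ⊗ S^j`: the complex with `M` in degree `j`. -/
def sphere (M : AlgModel p) (j : ℤ) : DgAlg p :=
  (HomologicalComplex.single (AlgModel p) (ComplexShape.down ℤ) j).obj M

/-- `M ⊗ (S^j ⟶ D^{j+1})` -/
def sphereToDisc (M : AlgModel p) (j : ℤ) : sphere M j ⟶ disc M j :=
  HomologicalComplex.mkHomFromSingle
    (HomologicalComplex.doubleXIso₁ (𝟙 M) (c := ComplexShape.down ℤ) (i₀ := j + 1) (i₁ := j) rfl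
      (by omega)).inv
    fun k _ => (congrArg _ (HomologicalComplex.double_d_eq_zero₀ (𝟙 M) _ j k (by omega))).trans
      comp_zero

/-- `M ⊗ (0 ⟶ D^{j+1})` -/
def zeroToDisc (M : AlgModel p) (j : ℤ) : (0 : DgAlg p) ⟶ disc M j := 0

/-- The generating cofibrations `A(n) ⊗ (S^j ⟶ D^{j+1})` of `dg 𝒜`. -/
def genCof (p : ℕ) [Fact p.Prime] : MorphismProperty (DgAlg p) :=
  .ofHoms fun x : ℕ × ℤ => sphereToDisc (AlgModel.A p x.1) x.2

/-- The generating acyclic cofibrations `A(n) ⊗ (0 ⟶ D^{j+1})` of `dg 𝒜`. -/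
def genAcyclicCof (p : ℕ) [Fact p.Prime] : MorphismProperty (DgAlg p) :=
  .ofHoms fun x : ℕ × ℤ => zeroToDisc (AlgModel.A p x.1) x.2

/-- The model structure on `dg ℬ` determined by applying `U` to the generating cofibrations and
the generating acyclic cofibrations of `dg 𝒜`. -/
def cellData (p : ℕ) [Fact p.Prime] : ModelData (DgSheaf p) :=
  .ofGenerators
    (.ofHoms fun x : ℕ × ℤ => (dgU p).map (sphereToDisc (AlgModel.A p x.1) x.2))
    (.ofHoms fun x : ℕ × ℤ => (dgU p).map (zeroToDisc (AlgModel.A p x.1) x.2))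

/-- The `U A(n)`-cellular equivalences of `dg ℬ`: the maps that induce homology isomorphisms on the
complexes of morphisms out of `U A(n)`, for all `n`. -/
def cellWe (p : ℕ) [Fact p.Prime] : MorphismProperty (DgSheaf p) :=
  fun _ _ f => ∀ n, QuasiIso
    (((preadditiveCoyoneda.obj (op ((U p).obj (AlgModel.A p n)))).mapHomologicalComplex _).map f)

/-- The cellularisation (right Bousfield localisation) of the levelwise model structure on `dg ℬ` at
the objects `U A(n)`: the fibrations are the levelwise ones, the weak equivalences are the cellular
equivalences. -/
def cellularisation (p : ℕ) [Fact p.Prime] : ModelData (DgSheaf p) :=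
  .ofFibWe (levelFib p) (cellWe p)

end Model

end PadicModel

end

open CategoryTheory Opposite TopologicalSpace Limits HomotopicalAlgebra ZeroObject

noncomputable section

namespace PadicModel

/-! ### Quasi-isomorphisms in terms of elements -/

/-! A sheaf on `𝒮 ℤ_p` amounts to its stalks: a discrete module at each isolated point `p ^ k ℤ_p`,
the stalk at the trivial group, and the map from that stalk to the tails of the sequence. This is
`sheafEquivalence`, with `ShModel` as the category of stalk data. The algebraic model is the full
subcategory of `ShModel` on which `p ^ k ℤ_p` acts trivially on the `k`-th module. So `U` is full
and faithful, and `R` is the coreflection of stalk data onto this subcategory.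

Everything else is expressed by maps out of free objects. For each open `O` and each `j` there is a
sheaf free on one section over `O` fixed by `p ^ j ℤ_p`, and `U A(n)` is free on a section over
`S_n` fixed by `p ^ n ℤ_p` (`isFree_A`, `isFree_UA`). Over `ℚ`, averaging over a finite quotient of
`ℤ_p` makes fixed points exact on discrete modules. Hence surjections and homology isomorphisms over
all open sets can be tested by maps out of the free sheaves (`levelFib_eq`, `levelWe_eq`), and those
of `dg 𝒜` by maps out of the `A(n)` (`algFib_eq`, `algWe_eq`).

All the model structures are then instances of `isModel_ofFibWe`, in which fibrations are tested on
a family `G` and weak equivalences on a family `H`. Discs on `G` and spheres on `H` generate it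
through the small object argument, for which the free objects are sufficiently small: they are
`ℵ₁`-presentable. The remaining point is that left lifting against fibrations forces a homotopy
equivalence (`weOf_of_fibOf_llp`).

The Quillen statements follow formally. Since `Hom(A(n), R f)` is `Hom(U A(n), f)`, the functor `R`
preserves and reflects the equivalences tested on these families, and the unit of the adjunction is
an isomorphism because `U` is full and faithful (`weOf_homEquiv`). -/

theorem quasiIso_ab_iff {K L : ChainComplex AddCommGrpCat.{0} ℤ} (φ : K ⟶ L) :
    QuasiIso φ ↔ ∀ j, (∀ x : K.X j, K.d j (j - 1) x = 0 → ∀ y : L.X (j + 1),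
        φ.f j x = L.d (j + 1) j y → ∃ z, K.d (j + 1) j z = x) ∧
      (∀ y : L.X j, L.d j (j - 1) y = 0 →
        ∃ x, K.d j (j - 1) x = 0 ∧ ∃ w, y = φ.f j x + L.d (j + 1) j w) := by
  -- Witnesses chosen element by element need not be additive in `a`. On the free abelian group
  -- covering `A` they define a homomorphism, which is all that a refinement asks for.
  have free : ∀ (A B : AddCommGrpCat.{0}) (P : A → B → Prop), (∀ a, ∃ b, P a b) →
      ∃ (A' : AddCommGrpCat.{0}) (π : A' ⟶ A) (_ : Epi π) (s : A → A') (g : A' ⟶ B),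
        (∀ a, π (s a) = a) ∧ (∀ a, P a (g (s a))) ∧
        ∀ (D : AddCommGrpCat.{0}) (u v : A' ⟶ D), (∀ a, u (s a) = v (s a)) → u = v := by
    intro A B P h
    choose b hb using h
    refine ⟨.of (FreeAbelianGroup A), AddCommGrpCat.ofHom (FreeAbelianGroup.lift id), ?_,
      FreeAbelianGroup.of, AddCommGrpCat.ofHom (FreeAbelianGroup.lift b), ?_, ?_, ?_⟩
    · rw [AddCommGrpCat.epi_iff_surjective]
      exact fun a => ⟨.of a, by simp⟩
    · simp
    · simpa using hb
    · intro D u v h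
      ext x
      exact h x
  -- Conversely, elements are maps out of `ℤ`, any refinement of `ℤ` is surjective, and a preimage
  -- of `1` supplies the elementwise witness.
  have el : ∀ {B : AddCommGrpCat.{0}} (b : B), ∃ g : AddCommGrpCat.of ℤ ⟶ B, g (1 : ℤ) = b :=
    fun {B} b => ⟨AddCommGrpCat.ofHom (zmultiplesHom B b), by simp⟩
  have zext : ∀ {B : AddCommGrpCat.{0}} (u v : AddCommGrpCat.of ℤ ⟶ B),
      u (1 : ℤ) = v (1 : ℤ) → u = v := fun {B} u v h => by
    ext
    exact h
  rw [quasiIso_iff]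
  refine forall_congr' fun j => ?_
  rw [quasiIsoAt_iff_isIso_homologyMap]
  have hiso : ∀ {X Y : AddCommGrpCat.{0}} (f : X ⟶ Y), IsIso f ↔ Mono f ∧ Epi f := fun f =>
    ⟨fun _ => ⟨inferInstance, inferInstance⟩, fun ⟨_, _⟩ => isIso_of_mono_of_epi f⟩
  rw [hiso, HomologicalComplex.mono_homologyMap_iff_up_to_refinements φ (j + 1) j (j - 1)
    (by simp) (by simp), HomologicalComplex.epi_homologyMap_iff_up_to_refinements φ (j + 1) j
    (j - 1) (by simp) (by simp)]
  refine and_congr ⟨fun h x hx y hxy => ?_, fun h A x hx y hxy => ?_⟩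
    ⟨fun h y hy => ?_, fun h A y hy => ?_⟩
  · obtain ⟨x', rfl⟩ := el x
    obtain ⟨y', rfl⟩ := el y
    obtain ⟨A', π, hπ, z, hz⟩ := h x' (zext _ _ (by simpa using hx)) y'
      (zext _ _ (by simpa using hxy))
    obtain ⟨a, ha⟩ := (AddCommGrpCat.epi_iff_surjective π).1 hπ (1 : ℤ)
    exact ⟨z a, (ConcreteCategory.congr_hom hz a).symm.trans (congrArg x' ha)⟩
  · obtain ⟨A', π, hπ, s, g, hs, hg, hext⟩ := free A (K.X (j + 1))
      (fun a z => K.d (j + 1) j z = x a) fun a => h (x a)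
        (by simpa using ConcreteCategory.congr_hom hx a) (y a)
        (by simpa using ConcreteCategory.congr_hom hxy a)
    exact ⟨A', π, hπ, g, hext _ _ _ fun a => by simp [hs, hg]⟩
  · obtain ⟨y', rfl⟩ := el y
    obtain ⟨A', π, hπ, x, hx, w, hw⟩ := h y' (zext _ _ (by simpa using hy))
    obtain ⟨a, ha⟩ := (AddCommGrpCat.epi_iff_surjective π).1 hπ (1 : ℤ)
    refine ⟨x a, by simpa using ConcreteCategory.congr_hom hx a, w a, ?_⟩
    exact (congrArg y' ha).symm.trans (ConcreteCategory.congr_hom hw a)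
  · obtain ⟨A', π, hπ, s, g, hs, hg, hext⟩ := free A (.of (K.X j × L.X (j + 1)))
      (fun a z => K.d j (j - 1) z.1 = 0 ∧ y a = φ.f j z.1 + L.d (j + 1) j z.2) fun a => by
        obtain ⟨x, hx, w, hw⟩ := h (y a) (by simpa using ConcreteCategory.congr_hom hy a)
        exact ⟨(x, w), hx, hw⟩
    refine ⟨A', π, hπ, g ≫ AddCommGrpCat.ofHom (AddMonoidHom.fst _ _),
      hext _ _ _ fun a => by simpa using (hg a).1, g ≫ AddCommGrpCat.ofHom (AddMonoidHom.snd _ _),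
      hext _ _ _ fun a => ?_⟩
    simpa [hs] using (hg a).2

variable {C : Type*} [Category.{0} C] [Preadditive C]

theorem quasiIso_coyoneda_iff (X : C) {K L : ChainComplex C ℤ} (f : K ⟶ L) :
    QuasiIso (((preadditiveCoyoneda.obj (op X)).mapHomologicalComplex _).map f) ↔
      ∀ j, (∀ x : X ⟶ K.X j, x ≫ K.d j (j - 1) = 0 → ∀ y : X ⟶ L.X (j + 1),
        x ≫ f.f j = y ≫ L.d (j + 1) j → ∃ z, z ≫ K.d (j + 1) j = x) ∧
      (∀ y : X ⟶ L.X j, y ≫ L.d j (j - 1) = 0 →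
        ∃ x, x ≫ K.d j (j - 1) = 0 ∧ ∃ w, y = x ≫ f.f j + w ≫ L.d (j + 1) j) :=
  quasiIso_ab_iff _

/-- The forgetful functor to abelian groups preserves homology and reflects isomorphisms, so
quasi-isomorphisms can be detected there. -/
theorem quasiIso_rep_iff {k G : Type} [Ring k] [Monoid G] {K L : ChainComplex (Rep.{0} k G) ℤ}
    (φ : K ⟶ L) :
    QuasiIso φ ↔ ∀ j, (∀ x : (K.X j).V, (K.d j (j - 1)).hom x = 0 → ∀ y : (L.X (j + 1)).V,
        (φ.f j).hom x = (L.d (j + 1) j).hom y → ∃ z, (K.d (j + 1) j).hom z = x) ∧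
      (∀ y : (L.X j).V, (L.d j (j - 1)).hom y = 0 → ∃ x, (K.d j (j - 1)).hom x = 0 ∧
        ∃ w, y = (φ.f j).hom x + (L.d (j + 1) j).hom w) := by
  let T : Rep.{0} k G ⥤ AddCommGrpCat.{0} :=
    forget₂ (Rep.{0} k G) (ModuleCat.{0} k) ⋙ forget₂ (ModuleCat.{0} k) AddCommGrpCat.{0}
  have : T.Additive := { map_add := rfl }
  rw [← HomologicalComplex.quasiIso_map_iff_of_preservesHomology φ T]
  exact quasiIso_ab_iff _

/-! ### Discs and spheres in chain complexes -/

section Disc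

variable {C : Type*} [Category.{0} C] [Preadditive C] [HasZeroObject C]

/-- The complex with `M` in degrees `j + 1` and `j`, and identity differential. -/
def discOn (M : C) (j : ℤ) : ChainComplex C ℤ :=
  HomologicalComplex.double (𝟙 M) (c := ComplexShape.down ℤ) (i₀ := j + 1) (i₁ := j) rfl

/-- The complex with `M` in degree `j`. -/
def sphereOn (M : C) (j : ℤ) : ChainComplex C ℤ :=
  (HomologicalComplex.single C (ComplexShape.down ℤ) j).obj M

/-- The inclusion of the boundary sphere of a disc. -/
def sphereToDiscOn (M : C) (j : ℤ) : sphereOn M j ⟶ discOn M j :=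
  HomologicalComplex.mkHomFromSingle
    (HomologicalComplex.doubleXIso₁ (𝟙 M) (c := ComplexShape.down ℤ) (i₀ := j + 1) (i₁ := j) rfl
      (by omega)).inv
    fun k _ => (congrArg _ (HomologicalComplex.double_d_eq_zero₀ (𝟙 M) _ j k (by omega))).trans
      comp_zero

/-- The map from zero to a disc. -/
def zeroToDiscOn (M : C) (j : ℤ) : (0 : ChainComplex C ℤ) ⟶ discOn M j := 0

variable {M : C} {j : ℤ} {K L : ChainComplex C ℤ}

variable (M j) in
/-- The top degree of a disc. -/
def discIso₀ : (discOn M j).X (j + 1) ≅ M :=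
  HomologicalComplex.doubleXIso₀ (𝟙 M) (c := ComplexShape.down ℤ) (i₀ := j + 1) (i₁ := j) rfl

variable (M j) in
/-- The bottom degree of a disc. -/
def discIso₁ : (discOn M j).X j ≅ M :=
  HomologicalComplex.doubleXIso₁ (𝟙 M) (c := ComplexShape.down ℤ) (i₀ := j + 1) (i₁ := j) rfl
    (by omega)

variable (M j) in
/-- The nonzero degree of a sphere. -/
def sphereIso : (sphereOn M j).X j ≅ M :=
  HomologicalComplex.singleObjXSelf (ComplexShape.down ℤ) j M

theorem discOn_d : (discOn M j).d (j + 1) j = (discIso₀ M j).hom ≫ (discIso₁ M j).inv := by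
  have h : (discOn M j).d (j + 1) j = _ := HomologicalComplex.double_d (𝟙 M) rfl (by omega)
  rw [h, Category.id_comp]
  rfl

theorem sphereToDiscOn_f :
    (sphereToDiscOn M j).f j = (sphereIso M j).hom ≫ (discIso₁ M j).inv :=
  HomologicalComplex.mkHomFromSingle_f _ _

/-- The map out of a disc given by a map out of `M`. -/
def discHom (x : M ⟶ K.X (j + 1)) : discOn M j ⟶ K :=
  HomologicalComplex.mkHomFromDouble rfl (by omega) x (x ≫ K.d (j + 1) j) (by simp) (by simp)

theorem discHom_f (x : M ⟶ K.X (j + 1)) :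
    (discHom x : discOn M j ⟶ K).f (j + 1) = (discIso₀ M j).hom ≫ x :=
  HomologicalComplex.mkHomFromDouble_f₀ _ _ _ _ _ _

/-- The map out of `M` given by a map out of a disc. -/
def discEval (g : discOn M j ⟶ K) : M ⟶ K.X (j + 1) := (discIso₀ M j).inv ≫ g.f (j + 1)

@[simp] theorem discEval_discHom (x : M ⟶ K.X (j + 1)) :
    discEval (discHom x : discOn M j ⟶ K) = x := by
  rw [discEval, discHom_f, Iso.inv_hom_id_assoc]

theorem discEval_comp (g : discOn M j ⟶ K) (f : K ⟶ L) :
    discEval (g ≫ f) = discEval g ≫ f.f (j + 1) := by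
  rw [discEval, discEval, HomologicalComplex.comp_f, Category.assoc]

/-- The differential of a disc is an isomorphism, so the component in the top degree forces the one
in the bottom degree. -/
theorem disc_hom_ext {g g' : discOn M j ⟶ K} (h : discEval g = discEval g') : g = g' := by
  have h0 : g.f (j + 1) = g'.f (j + 1) := (Iso.cancel_iso_inv_left _ _ _).1 h
  refine HomologicalComplex.from_double_hom_ext h0 ?_
  have h1 := g.comm (j + 1) j
  have h2 := g'.comm (j + 1) j
  rw [h0, h2, discOn_d, Category.assoc, Category.assoc] at h1
  exact ((Iso.cancel_iso_inv_left _ _ _).1 ((Iso.cancel_iso_hom_left _ _ _).1 h1)).symm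

/-- The map out of a sphere given by a cycle. -/
def sphereHom (x : M ⟶ K.X j) (hx : x ≫ K.d j (j - 1) = 0) : sphereOn M j ⟶ K :=
  HomologicalComplex.mkHomFromSingle x fun k hk => by
    obtain rfl : k = j - 1 := by
      have : k + 1 = j := hk
      omega
    exact hx

/-- The cycle given by a map out of a sphere. -/
def sphereEval (g : sphereOn M j ⟶ K) : M ⟶ K.X j := (sphereIso M j).inv ≫ g.f j

@[simp] theorem sphereEval_sphereHom (x : M ⟶ K.X j) (hx : x ≫ K.d j (j - 1) = 0) :
    sphereEval (sphereHom x hx) = x := by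
  have h : (sphereHom x hx).f j = (sphereIso M j).hom ≫ x :=
    HomologicalComplex.mkHomFromSingle_f _ _
  rw [sphereEval, h, Iso.inv_hom_id_assoc]

theorem sphereEval_comp (g : sphereOn M j ⟶ K) (f : K ⟶ L) :
    sphereEval (g ≫ f) = sphereEval g ≫ f.f j := by
  rw [sphereEval, sphereEval, HomologicalComplex.comp_f, Category.assoc]

theorem sphereEval_d (g : sphereOn M j ⟶ K) (k : ℤ) : sphereEval g ≫ K.d j k = 0 := by
  have h : (sphereOn M j).d j k = 0 := HomologicalComplex.single_obj_d _ _ _ _ _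
  rw [sphereEval, Category.assoc, g.comm, h, zero_comp, comp_zero]

theorem sphere_hom_ext {g g' : sphereOn M j ⟶ K} (h : sphereEval g = sphereEval g') : g = g' :=
  HomologicalComplex.from_single_hom_ext ((Iso.cancel_iso_inv_left _ _ _).1 h)

theorem sphereEval_sphereToDisc_comp (g : discOn M j ⟶ K) :
    sphereEval (sphereToDiscOn M j ≫ g) = discEval g ≫ K.d (j + 1) j := by
  rw [discEval, Category.assoc, g.comm, discOn_d, sphereEval, HomologicalComplex.comp_f,
    sphereToDiscOn_f, Category.assoc, Category.assoc, Iso.inv_hom_id_assoc, Iso.inv_hom_id_assoc]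

/-- The square carries no information at the zero complex, and maps out of the disc are maps from
`M` in degree `j + 1`. -/
theorem hasLiftingProperty_zeroToDiscOn_iff (f : K ⟶ L) :
    HasLiftingProperty (zeroToDiscOn M j) f ↔
      ∀ y : M ⟶ L.X (j + 1), ∃ x, x ≫ f.f (j + 1) = y := by
  refine ⟨fun h y => ?_, fun h => ⟨fun {t b} _ => ?_⟩⟩
  · have sq : CommSq (0 : (0 : ChainComplex C ℤ) ⟶ K) (zeroToDiscOn M j) f (discHom y) :=
      ⟨(isZero_zero _).eq_of_src _ _⟩
    refine ⟨discEval sq.lift, ?_⟩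
    rw [← discEval_comp, sq.fac_right, discEval_discHom]
  · obtain ⟨x, hx⟩ := h (discEval b)
    exact ⟨⟨⟨discHom x, (isZero_zero _).eq_of_src _ _,
      disc_hom_ext (by rw [discEval_comp, discEval_discHom, hx])⟩⟩⟩

/-- Maps out of a sphere are cycles and maps out of a disc are arbitrary elements of its top degree.
A square is thus a cycle with a chosen bounding element of its image, and a lift is a bounding
element over the chosen one. -/
theorem hasLiftingProperty_sphereToDiscOn_iff (f : K ⟶ L) :
    HasLiftingProperty (sphereToDiscOn M j) f ↔
      ∀ (x : M ⟶ K.X j) (y : M ⟶ L.X (j + 1)), x ≫ K.d j (j - 1) = 0 →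
        x ≫ f.f j = y ≫ L.d (j + 1) j → ∃ z, z ≫ K.d (j + 1) j = x ∧ z ≫ f.f (j + 1) = y := by
  refine ⟨fun h x y hx hxy => ?_, fun h => ⟨fun {t b} w => ?_⟩⟩
  · have sq : CommSq (sphereHom x hx) (sphereToDiscOn M j) f (discHom y) :=
      ⟨sphere_hom_ext (by rw [sphereEval_comp, sphereEval_sphereToDisc_comp, sphereEval_sphereHom,
        discEval_discHom, hxy])⟩
    refine ⟨discEval sq.lift, ?_, ?_⟩
    · rw [← sphereEval_sphereToDisc_comp, sq.fac_left, sphereEval_sphereHom]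
    · rw [← discEval_comp, sq.fac_right, discEval_discHom]
  · obtain ⟨z, hz, hz'⟩ := h (sphereEval t) (discEval b) (sphereEval_d _ _) (by
      rw [← sphereEval_comp, w.w, sphereEval_sphereToDisc_comp])
    exact ⟨⟨⟨discHom z, sphere_hom_ext (by
        rw [sphereEval_sphereToDisc_comp, discEval_discHom, hz]),
      disc_hom_ext (by rw [discEval_comp, discEval_discHom, hz'])⟩⟩⟩

end Disc

/-! ### Relative model structures -/

section Relative

variable {C : Type*} [Category.{0} C] [Preadditive C] {ι κ : Type*}

/-- Maps of complexes that induce surjections on maps out of the given objects. -/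
def fibOf (G : ι → C) : MorphismProperty (ChainComplex C ℤ) :=
  fun _ _ f => ∀ a i, Function.Surjective fun x : G a ⟶ _ => x ≫ f.f i

/-- Maps of complexes that induce homology isomorphisms on maps out of the given objects. -/
def weOf (G : ι → C) : MorphismProperty (ChainComplex C ℤ) :=
  fun _ _ f => ∀ a, QuasiIso (((preadditiveCoyoneda.obj (op (G a))).mapHomologicalComplex _).map f)

variable (G : ι → C)

instance weOf_twoOutOfThree : (weOf G).HasTwoOutOfThreeProperty where
  comp_mem f g hf hg a := by
    have := hf a; have := hg a
    rw [Functor.map_comp]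
    infer_instance
  of_postcomp f g hg hfg a := by
    have := hg a
    have h := hfg a
    rw [Functor.map_comp] at h
    exact quasiIso_of_comp_right _
      (((preadditiveCoyoneda.obj (op (G a))).mapHomologicalComplex _).map g)
  of_precomp f g hf hfg a := by
    have := hf a
    have h := hfg a
    rw [Functor.map_comp] at h
    exact quasiIso_of_comp_left
      (((preadditiveCoyoneda.obj (op (G a))).mapHomologicalComplex _).map f) _

instance weOf_retracts : (weOf G).IsStableUnderRetracts where
  of_retract {X Y Z W f g} h hg a := by
    have := hg a
    exact quasiIso_of_retractArrow
      (RetractArrow.map h ((preadditiveCoyoneda.obj (op (G a))).mapHomologicalComplex _))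

variable [HasZeroObject C]

/-- The maps from zero to the discs on the given objects. -/
def discGen : MorphismProperty (ChainComplex C ℤ) :=
  .ofHoms fun x : ι × ℤ => zeroToDiscOn (G x.1) x.2

/-- The inclusions of spheres in discs on the given objects. -/
def sphereGen : MorphismProperty (ChainComplex C ℤ) :=
  .ofHoms fun x : ι × ℤ => sphereToDiscOn (G x.1) x.2

theorem discGen_rlp : (discGen G).rlp = fibOf G := by
  ext K L f
  constructor
  · intro h a i x
    have h1 := (hasLiftingProperty_zeroToDiscOn_iff (M := G a) (j := i - 1) f).1
      (h _ (MorphismProperty.ofHoms.mk (a, i - 1)))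
    rw [sub_add_cancel] at h1
    exact h1 x
  · rintro h _ _ _ ⟨a, i⟩
    exact (hasLiftingProperty_zeroToDiscOn_iff f).2 fun y => h a _ y

/-- This is the classical description of acyclic fibrations of complexes, carried out on elements of
`Hom(G a, -)`. It uses only the additive structure of `C`. -/
theorem sphereGen_rlp : (sphereGen G).rlp = fibOf G ⊓ weOf G := by
  ext K L f
  have h0 : (sphereGen G).rlp f ↔ ∀ a (j : ℤ) (x : G a ⟶ K.X j) (y : G a ⟶ L.X (j + 1)),
      x ≫ K.d j (j - 1) = 0 → x ≫ f.f j = y ≫ L.d (j + 1) j →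
        ∃ z, z ≫ K.d (j + 1) j = x ∧ z ≫ f.f (j + 1) = y := by
    constructor
    · intro h a j
      exact (hasLiftingProperty_sphereToDiscOn_iff f).1 (h _ (MorphismProperty.ofHoms.mk (a, j)))
    · rintro h _ _ _ ⟨a, j⟩
      exact (hasLiftingProperty_sphereToDiscOn_iff f).2 (h a j)
  rw [h0]
  constructor
  · intro h
    -- The lifting condition with zero cycle says that cycles of `L` lift to cycles of `K`. An
    -- arbitrary `y` is then lifted in two stages: first its boundary as a cycle, then `y` over that
    -- lift.
    have cyc : ∀ a (j : ℤ) (y : G a ⟶ L.X j), y ≫ L.d j (j - 1) = 0 →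
        ∃ x, x ≫ K.d j (j - 1) = 0 ∧ x ≫ f.f j = y := by
      intro a j
      have h1 := h a (j - 1) 0
      rw [sub_add_cancel] at h1
      intro y hy
      exact h1 y (by simp) (by simpa using hy.symm)
    refine ⟨fun a j y => ?_, fun a => (quasiIso_coyoneda_iff _ f).2 fun j =>
      ⟨fun x hx y hxy => ?_, fun y hy => ?_⟩⟩
    · obtain ⟨x, hx, hx'⟩ := cyc a (j - 1) (y ≫ L.d j (j - 1)) (by simp)
      have h1 := h a (j - 1)
      rw [sub_add_cancel] at h1
      obtain ⟨z, -, hz⟩ := h1 x y hx hx'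
      exact ⟨z, hz⟩
    · obtain ⟨z, hz, -⟩ := h a j x y hx hxy
      exact ⟨z, hz⟩
    · obtain ⟨x, hx, hx'⟩ := cyc a j y hy
      exact ⟨x, hx, 0, by simp [hx']⟩
  · rintro ⟨hs, hw⟩ a j x y hx hxy
    have hq := (quasiIso_coyoneda_iff _ f).1 (hw a)
    obtain ⟨z₀, hz₀⟩ := (hq j).1 x hx y hxy
    -- The element `z₀` bounds `x`, but its image differs from `y` by a cycle. That cycle is the
    -- image of a cycle `c` plus a boundary, and lifting `w` through the fibration lifts the
    -- boundary too. Neither correction changes the differential of `z₀`.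
    obtain ⟨c, hc, w, hw⟩ := (hq (j + 1)).2 (y - z₀ ≫ f.f (j + 1)) (by
      rw [add_sub_cancel_right, Preadditive.sub_comp, Category.assoc, f.comm, ← Category.assoc,
        hz₀, hxy, sub_self])
    rw [add_sub_cancel_right] at hc
    obtain ⟨w', rfl⟩ := hs a _ w
    refine ⟨z₀ + c + w' ≫ K.d _ _, by simp [hz₀, hc], ?_⟩
    have := eq_add_of_sub_eq hw
    rw [this]
    simp only [Preadditive.add_comp, Category.assoc, f.comm]
    abel

end Relative

section Relative

variable {C : Type*} [Category.{0} C] [Preadditive C]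

/-! ### Path complexes and left lifting against fibrations -/

section Path

variable [HasBinaryBiproducts C]

/-- The contractible complex with `L_n ⊞ L_{n + 1}` in degree `n`. -/
def pathComplex (L : ChainComplex C ℤ) : ChainComplex C ℤ :=
  ChainComplex.of (fun n => L.X n ⊞ L.X (n + 1)) (fun _ => biprod.fst ≫ biprod.inr) (by simp)

/-- The first projection in each degree of the path complex. -/
def pathFst (L : ChainComplex C ℤ) (n : ℤ) : (pathComplex L).X n ⟶ L.X n :=
  (biprod.fst : L.X n ⊞ L.X (n + 1) ⟶ _)

/-- The second projection in each degree of the path complex. -/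
def pathSnd (L : ChainComplex C ℤ) (n : ℤ) : (pathComplex L).X n ⟶ L.X (n + 1) :=
  (biprod.snd : L.X n ⊞ L.X (n + 1) ⟶ _)

/-- The first inclusion in each degree of the path complex. -/
def pathInl (L : ChainComplex C ℤ) (n : ℤ) : L.X n ⟶ (pathComplex L).X n :=
  (biprod.inl : _ ⟶ L.X n ⊞ L.X (n + 1))

/-- The second inclusion in each degree of the path complex. -/
def pathInr (L : ChainComplex C ℤ) (n : ℤ) : L.X (n + 1) ⟶ (pathComplex L).X n :=
  (biprod.inr : _ ⟶ L.X n ⊞ L.X (n + 1))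

variable (L : ChainComplex C ℤ) (n : ℤ)

@[simp] theorem pathInl_fst : pathInl L n ≫ pathFst L n = 𝟙 _ := biprod.inl_fst
@[simp] theorem pathInl_snd : pathInl L n ≫ pathSnd L n = 0 := biprod.inl_snd
@[simp] theorem pathInr_fst : pathInr L n ≫ pathFst L n = 0 := biprod.inr_fst
@[simp] theorem pathInr_snd : pathInr L n ≫ pathSnd L n = 𝟙 _ := biprod.inr_snd

theorem pathComplex_d : (pathComplex L).d (n + 1) n = pathFst L (n + 1) ≫ pathInr L n :=
  ChainComplex.of_d (fun n => L.X n ⊞ L.X (n + 1))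
    (fun n => (biprod.fst : L.X (n + 1) ⊞ L.X (n + 1 + 1) ⟶ L.X (n + 1)) ≫
      (biprod.inr : L.X (n + 1) ⟶ L.X n ⊞ L.X (n + 1))) n

/-- The projection of the path complex to `L`. -/
def pathComplexProj (L : ChainComplex C ℤ) : pathComplex L ⟶ L where
  f n := pathFst L n + pathSnd L n ≫ L.d (n + 1) n
  comm' i j h := by
    obtain rfl : j + 1 = i := h
    rw [pathComplex_d]
    simp only [Preadditive.add_comp, Preadditive.comp_add, Category.assoc,
      HomologicalComplex.d_comp_d, comp_zero, add_zero]
    rw [← Category.assoc (pathInr L j), pathInr_fst, pathInr_snd,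
      comp_zero, zero_add, Category.id_comp]

variable [HasZeroObject C]

/-- Maps with the left lifting property with respect to relative fibrations are relative weak
equivalences (with respect to arbitrary objects). -/
theorem weOf_of_fibOf_llp {ι ι' : Type*} (G : ι → C) (H : ι' → C) {K L : ChainComplex C ℤ}
    (i : K ⟶ L) (hi : (fibOf G).llp i) : weOf H i := by
  -- Both `K ⟶ 0` and the projection of the path complex are fibrations, the latter being split in
  -- each degree by `pathInl`. Lifting against the first gives a retraction `r` of `i`. As `𝟙 - r ≫
  -- i` vanishes on `K`, lifting it against the second is possible, and such a lift is a
  -- null-homotopy. This is why the conclusion holds for every family `H`.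
  have h0 : fibOf G (0 : K ⟶ (0 : ChainComplex C ℤ)) := by
    rw [← discGen_rlp]
    rintro _ _ _ ⟨a, j⟩
    exact (hasLiftingProperty_zeroToDiscOn_iff _).2 fun y =>
      ⟨0, ((HomologicalComplex.eval C _ (j + 1)).map_isZero (isZero_zero _)).eq_of_tgt _ _⟩
  have hπ : fibOf G (pathComplexProj L) := fun a j y =>
    ⟨y ≫ pathInl L j, by
      simp only [pathComplexProj, Preadditive.comp_add, Category.assoc, pathInl_fst,
        Category.comp_id]
      rw [← Category.assoc (pathInl L j), pathInl_snd, zero_comp, comp_zero, add_zero]⟩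
  have sq : CommSq (𝟙 K) i (0 : K ⟶ (0 : ChainComplex C ℤ)) 0 :=
    ⟨(isZero_zero _).eq_of_tgt _ _⟩
  have := hi _ h0
  obtain ⟨r, hr⟩ : ∃ r, i ≫ r = 𝟙 K := ⟨sq.lift, sq.fac_left⟩
  have := hi _ hπ
  have sq' : CommSq (0 : K ⟶ pathComplex L) i (pathComplexProj L) (𝟙 L - r ≫ i) :=
    ⟨by rw [Preadditive.comp_sub, ← Category.assoc, hr]; simp⟩
  obtain ⟨h, hh⟩ : ∃ h, h ≫ pathComplexProj L = 𝟙 L - r ≫ i := ⟨sq'.lift, sq'.fac_right⟩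
  have hrf : ∀ n, i.f n ≫ r.f n = 𝟙 _ := fun n => by
    rw [← HomologicalComplex.comp_f, hr, HomologicalComplex.id_f]
  have hab : ∀ n, h.f n ≫ pathFst L n + (h.f n ≫ pathSnd L n) ≫ L.d (n + 1) n =
      𝟙 _ - r.f n ≫ i.f n := fun n => by
    have h1 : h.f n ≫ (pathFst L n + pathSnd L n ≫ L.d (n + 1) n) = 𝟙 _ - r.f n ≫ i.f n :=
      congrArg (fun φ => HomologicalComplex.Hom.f φ n) hh
    rw [← h1, Preadditive.comp_add, Category.assoc]
  -- Since `h` is a chain map, its first component is the differential followed by its second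
  -- component, so it vanishes on cycles. On a cycle, `𝟙 - r ≫ i` is therefore the boundary of the
  -- second component.
  have ha : ∀ n m, m + 1 = n → ∀ (Z : C) (y : Z ⟶ L.X n), y ≫ L.d n m = 0 →
      y ≫ h.f n ≫ pathFst L n = 0 := by
    rintro n m rfl Z y hy
    have h1 := h.comm (m + 1) m
    rw [pathComplex_d] at h1
    have h2 : h.f (m + 1) ≫ pathFst L (m + 1) = L.d (m + 1) m ≫ h.f m ≫ pathSnd L m := by
      rw [← Category.assoc (L.d _ _), ← h1]
      simp only [Category.assoc, pathInr_snd, Category.comp_id]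
    rw [h2, ← Category.assoc, hy, zero_comp]
  refine fun c => (quasiIso_coyoneda_iff _ i).2 fun j => ⟨fun x hx y hxy => ⟨y ≫ r.f (j + 1), ?_⟩,
    fun y hy => ⟨y ≫ r.f j, ?_, y ≫ h.f j ≫ pathSnd L j, ?_⟩⟩
  · rw [Category.assoc, r.comm, ← Category.assoc, ← hxy, Category.assoc, hrf, Category.comp_id]
  · rw [Category.assoc, r.comm, ← Category.assoc, hy, zero_comp]
  · have h1 := ha j (j - 1) (by omega) _ y hy
    have h2 := congrArg (fun l => y ≫ l) (hab j)
    simp only [Preadditive.comp_add, Preadditive.comp_sub, h1, Category.comp_id, zero_add] at h2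
    simp only [Category.assoc] at h2 ⊢
    rw [h2]
    abel

end Path

/-! ### Smallness, and the model structures -/

/-- A filtered colimit of sets is recognised by two properties: every element comes from a stage,
and elements that become equal do so at a later stage. The hypothesis `h` states these for `Hom(X,
-)`. -/
theorem isCardinalPresentable_of_elements {D : Type*} [Category.{0} D] (X : D) (c : Cardinal.{0})
    [Fact c.IsRegular]
    (h : ∀ (J : Type) [SmallCategory J] [IsCardinalFiltered J c] (F : J ⥤ D) (t : Cocone F)
      (_ : IsColimit t), (∀ f : X ⟶ t.pt, ∃ j, ∃ g : X ⟶ F.obj j, g ≫ t.ι.app j = f) ∧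
      ∀ j (f g : X ⟶ F.obj j), f ≫ t.ι.app j = g ≫ t.ι.app j →
        ∃ k, ∃ u : j ⟶ k, f ≫ F.map u = g ≫ F.map u) :
    IsCardinalPresentable X c where
  preservesColimitOfShape J _ _ := ⟨fun {F} => ⟨fun {t} ht => by
    have := isFiltered_of_isCardinalFiltered J c
    refine ⟨Types.FilteredColimit.isColimitOf' _ _ (fun x => ?_) (fun i x y hxy => ?_)⟩
    · obtain ⟨j, g, hg⟩ := (h J F t ht).1 x
      exact ⟨j, g, hg.symm⟩
    · exact (h J F t ht).2 i x y hxy⟩⟩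

variable [HasZeroObject C]

theorem isCardinalPresentable_zero (c : Cardinal.{0}) [Fact c.IsRegular] :
    IsCardinalPresentable (0 : ChainComplex C ℤ) c :=
  isCardinalPresentable_of_elements _ c fun J _ _ F t ht => by
    have := isFiltered_of_isCardinalFiltered J c
    exact ⟨fun f => ⟨IsFiltered.nonempty.some, 0, (isZero_zero _).eq_of_src _ _⟩,
      fun j f g _ => ⟨j, 𝟙 j, (isZero_zero _).eq_of_src _ _⟩⟩

/-- Colimits of complexes are formed degreewise, and a map out of a sphere is a map out of `M`
killed by the differential. After factoring the map through a stage, its differential need not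
vanish there, but it vanishes in the colimit and hence at some later stage. -/
theorem isCardinalPresentable_sphereOn [HasColimits C] (M : C) (j : ℤ) (c : Cardinal.{0})
    [Fact c.IsRegular] [IsCardinalPresentable M c] :
    IsCardinalPresentable (sphereOn M j) c :=
  isCardinalPresentable_of_elements _ c fun J _ _ F t ht => by
    have := isFiltered_of_isCardinalFiltered J c
    have hk : ∀ k, Nonempty (IsColimit ((HomologicalComplex.eval C _ k).mapCocone t)) := fun k =>
      ⟨isColimitOfPreserves (HomologicalComplex.eval C _ k) ht⟩
    constructor
    · intro f
      obtain ⟨i, x, hx⟩ := IsCardinalPresentable.exists_hom_of_isColimit c (hk j).some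
        (sphereEval f)
      change M ⟶ (F.obj i).X j at x
      obtain ⟨i', u, hu⟩ := IsCardinalPresentable.exists_eq_of_isColimit' c (hk (j - 1)).some
        (x ≫ (F.obj i).d j (j - 1)) 0 (by
          have h1 := (t.ι.app i).comm j (j - 1)
          have h2 : x ≫ (t.ι.app i).f j = sphereEval f := hx
          have h3 : (x ≫ (F.obj i).d j (j - 1)) ≫ (t.ι.app i).f (j - 1) = 0 := by
            rw [Category.assoc, ← h1, ← Category.assoc, h2]
            exact sphereEval_d f _
          exact h3.trans zero_comp.symm)
      have hu' : (x ≫ (F.obj i).d j (j - 1)) ≫ (F.map u).f (j - 1) = 0 := hu.trans zero_comp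
      refine ⟨i', sphereHom (x ≫ (F.map u).f j) (by
        rw [Category.assoc, (F.map u).comm, ← Category.assoc, hu']), sphere_hom_ext ?_⟩
      have hx' : x ≫ (t.ι.app i).f j = sphereEval f := hx
      rw [sphereEval_comp, sphereEval_sphereHom, ← hx', Category.assoc, ← HomologicalComplex.comp_f,
        t.w]
    · intro i f g hfg
      obtain ⟨i', u, hu⟩ := IsCardinalPresentable.exists_eq_of_isColimit' c (hk j).some
        (sphereEval f) (sphereEval g) (by
          have := congrArg sphereEval hfg
          rwa [sphereEval_comp, sphereEval_comp] at this)
      exact ⟨i', u, sphere_hom_ext (by rw [sphereEval_comp, sphereEval_comp]; exact hu)⟩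

/-- The well-order of the regular cardinal `c` is `c`-filtered, so maps out of a `c`-presentable
domain commute with transfinite compositions of that length. -/
theorem hasSmallObjectArgument_of_presentable {D : Type*} [Category.{0} D] [HasColimits D]
    (I : MorphismProperty D) [MorphismProperty.IsSmall.{0} I] (c : Cardinal.{0}) [Fact c.IsRegular]
    (h : ∀ ⦃A B : D⦄ (i : A ⟶ B), I i → IsCardinalPresentable A c) :
    MorphismProperty.HasSmallObjectArgument.{0} I := by
  have hne : Nonempty c.ord.ToType := by
    have := isFiltered_of_isCardinalFiltered c.ord.ToType c
    exact IsFiltered.nonempty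
  let : OrderBot c.ord.ToType := WellFoundedLT.toOrderBot _
  exact ⟨c, inferInstance, inferInstance,
    { hasIterationOfShape := inferInstance
      preservesColimit := fun {A B X Y} i hi f hf => by
        have := h i hi
        have := preservesColimitsOfShape_of_isCardinalPresentable A c c.ord.ToType
        infer_instance }⟩

/-- The relative model structure on chain complexes, with surjectivity tested on the family `G` and
homology isomorphisms tested on the family `H`. -/
theorem isModel_ofFibWe [HasColimits C] [HasFiniteLimits C] {ι κ : Type} (G : ι → C) (H : κ → C)
    (c : Cardinal.{0}) [Fact c.IsRegular] (hH : ∀ b, IsCardinalPresentable (H b) c)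
    (hGH : fibOf G ≤ fibOf H) : (ModelData.ofFibWe (fibOf G) (weOf H)).IsModel := by
  have hG : (discGen G).rlp.llp = (fibOf G).llp := by rw [discGen_rlp]
  have : HasBinaryBiproducts C := HasBinaryBiproducts.of_hasBinaryProducts
  have : HasColimits (ChainComplex C ℤ) := ⟨fun J _ => inferInstance⟩
  -- Spheres on `H` alone would only give surjectivity tested on `H`. Adding the discs on `G`
  -- enforces the stronger fibration condition, and `hGH` makes the common right lifting class
  -- exactly the acyclic fibrations.
  let I := sphereGen H ⊔ discGen G
  have hI : I.rlp = fibOf G ⊓ weOf H := by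
    have : I.rlp = (sphereGen H).rlp ⊓ (discGen G).rlp := by
      ext X Y f
      exact ⟨fun h => ⟨fun _ _ i hi => h i (Or.inl hi), fun _ _ i hi => h i (Or.inr hi)⟩,
        fun h _ _ i hi => hi.elim (h.1 i) (h.2 i)⟩
    rw [this, sphereGen_rlp, discGen_rlp]
    ext X Y f
    exact ⟨fun h => ⟨h.2, h.1.2⟩, fun h => ⟨⟨hGH _ h.1, h.2⟩, h.1⟩⟩
  have hIs : MorphismProperty.IsSmall.{0} I := by
    refine (MorphismProperty.isSmall_iff_eq_ofHoms I).2 ⟨(κ × ℤ) ⊕ (ι × ℤ), _, _, fun x =>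
      Sum.rec (motive := fun x => (Sum.elim (fun x : κ × ℤ => sphereOn (H x.1) x.2)
        (fun _ => 0) x) ⟶
        Sum.elim (fun x : κ × ℤ => discOn (H x.1) x.2) (fun x : ι × ℤ => discOn (G x.1) x.2) x)
      (fun x => sphereToDiscOn (H x.1) x.2) (fun x => zeroToDiscOn (G x.1) x.2) x, ?_⟩
    ext X Y f
    constructor
    · intro hf
      rcases hf with hf | hf
      · obtain ⟨x⟩ := hf
        exact MorphismProperty.ofHoms.mk (Sum.inl x)
      · obtain ⟨x⟩ := hf
        exact MorphismProperty.ofHoms.mk (Sum.inr x)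
    · rintro ⟨x | x⟩
      · exact Or.inl ⟨x⟩
      · exact Or.inr ⟨x⟩
  have hJs : MorphismProperty.IsSmall.{0} (discGen G) := by unfold discGen; infer_instance
  have : MorphismProperty.HasSmallObjectArgument.{0} I := hasSmallObjectArgument_of_presentable _ c
    fun A B i hi => by
      rcases hi with ⟨⟨b, j⟩⟩ | ⟨⟨a, j⟩⟩
      · have := hH b
        exact isCardinalPresentable_sphereOn _ _ _
      · exact isCardinalPresentable_zero c
  have : MorphismProperty.HasSmallObjectArgument.{0} (discGen G) :=
    hasSmallObjectArgument_of_presentable _ c fun A B i hi => by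
      rcases hi with ⟨⟨a, j⟩⟩
      exact isCardinalPresentable_zero c
  have fr : (fibOf G).IsStableUnderRetracts := by rw [← discGen_rlp]; infer_instance
  have cr : (fibOf G ⊓ weOf H).llp.IsStableUnderRetracts := inferInstance
  -- The small object argument for the discs alone yields a first factor with left lifting against
  -- all fibrations. The path complex argument makes it a weak equivalence for `H`.
  have fac : ∀ {X Y : ChainComplex C ℤ} (f : X ⟶ Y), ∃ (Z : ChainComplex C ℤ) (i : X ⟶ Z)
      (q : Z ⟶ Y), (fibOf G).llp i ∧ weOf H i ∧ fibOf G q ∧ i ≫ q = f := fun f => by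
    have d := MorphismProperty.factorizationData (discGen G).rlp.llp (discGen G).rlp f
    have h1 : (fibOf G).llp d.i := hG ▸ d.hi
    exact ⟨_, d.i, d.p, h1, weOf_of_fibOf_llp G H _ h1, discGen_rlp G ▸ d.hp, d.fac⟩
  -- The retract argument: the second factor of `i` is an acyclic fibration by two-out-of-three, so
  -- `i` is a retract of the first factor, which lifts against every fibration.
  have lift : ∀ {A B X Y : ChainComplex C ℤ} (i : A ⟶ B) (q : X ⟶ Y),
      (fibOf G ⊓ weOf H).llp i → weOf H i → fibOf G q → HasLiftingProperty i q := by
    intro A B X Y i q hi hiw hq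
    obtain ⟨Z, j, r, hj, hjw, hr, hf⟩ := fac i
    have hrw : weOf H r := MorphismProperty.of_precomp (W := weOf H) j r hjw (by rwa [hf])
    have : HasLiftingProperty i r := hi r ⟨hr, hrw⟩
    have : HasLiftingProperty j q := hj q hq
    exact (RetractArrow.ofLeftLiftingProperty hf).leftLiftingProperty q
  exact ⟨{ categoryWithFibrations := ⟨fibOf G⟩
           categoryWithWeakEquivalences := ⟨weOf H⟩
           categoryWithCofibrations := ⟨(fibOf G ⊓ weOf H).llp⟩
           cm2 := weOf_twoOutOfThree H
           cm3a := weOf_retracts H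
           cm3b := fr
           cm3c := cr
           cm4a := fun i q hi hi' hq => lift i q hi.mem hi'.mem hq.mem
           cm4b := fun i q hi hq hq' => hi.mem q ⟨hq.mem, hq'.mem⟩
           cm5a := ⟨fun f => by
             obtain ⟨Z, i, q, hi, hiw, hq, hf⟩ := fac f
             exact ⟨⟨Z, i, q, hf, ⟨fun _ _ g hg => hi g hg.1, hiw⟩, hq⟩⟩⟩
           cm5b := ⟨fun f => by
             have d := MorphismProperty.factorizationData I.rlp.llp I.rlp f
             have h1 : (fibOf G ⊓ weOf H).llp d.i := hI ▸ d.hi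
             have h2 : (fibOf G ⊓ weOf H) d.p := hI ▸ d.hp
             exact ⟨⟨_, d.i, d.p, d.fac, h1, h2⟩⟩⟩ }, rfl, rfl, rfl⟩

end Relative

variable {p : ℕ} [Fact p.Prime]

/-! ### Fixed points, averaging and permutation modules -/

/-- The topological generator `p ^ n` of `p ^ n ℤ_p`. -/
def gen (p : ℕ) [Fact p.Prime] (n : ℕ) : Multiplicative ℤ_[p] :=
  Multiplicative.ofAdd ((p : ℤ_[p]) ^ n)

theorem mem_level {n : ℕ} {g : Multiplicative ℤ_[p]} :
    g ∈ level p n ↔ ∃ a : ℤ_[p], g = Multiplicative.ofAdd ((p : ℤ_[p]) ^ n * a) := by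
  change g.toAdd ∈ Ideal.span {(p : ℤ_[p]) ^ n} ↔ _
  rw [Ideal.mem_span_singleton]
  exact ⟨fun ⟨a, h⟩ => ⟨a, congrArg Multiplicative.ofAdd h⟩,
    fun ⟨a, h⟩ => ⟨a, congrArg Multiplicative.toAdd h⟩⟩

theorem gen_mem_level (n : ℕ) : gen p n ∈ level p n := mem_level.2 ⟨1, by rw [mul_one]; rfl⟩

theorem ρ_pow_apply_of_fixed {V : ZpRep p} {g : Multiplicative ℤ_[p]} {v : V.V}
    (h : V.ρ g v = v) (i : ℕ) : V.ρ (g ^ i) v = v := by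
  induction i with
  | zero => simp
  | succ i ih => rw [pow_succ, map_mul, Module.End.mul_apply, h, ih]

/-- Modulo `p ^ m`, every `p`-adic integer is a natural number, and multiples of `p ^ m` already fix
`v`. On a discrete module, being fixed by the whole of `p ^ n ℤ_p` is thus a single equation, which
is what allows it to be checked in colimits. -/
theorem mem_fixedPts_of_gen {V : ZpRep p} {v : V.V} {m n : ℕ} (hv : v ∈ fixedPts V m)
    (h : V.ρ (gen p n) v = v) : v ∈ fixedPts V n := by
  intro g hg
  obtain ⟨a, rfl⟩ := mem_level.1 hg
  obtain ⟨b, hb⟩ := Ideal.mem_span_singleton.1 (PadicInt.appr_spec m a)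
  have : Multiplicative.ofAdd ((p : ℤ_[p]) ^ n * a) =
      gen p n ^ (a.appr m) * Multiplicative.ofAdd ((p : ℤ_[p]) ^ m * (p ^ n * b)) := by
    rw [gen, ← ofAdd_nsmul, ← ofAdd_add, nsmul_eq_mul]
    congr 1
    linear_combination (p : ℤ_[p]) ^ n * hb
  rw [this, map_mul, Module.End.mul_apply, hv _ (mem_level.2 ⟨_, rfl⟩), ρ_pow_apply_of_fixed h]

/-- The average over the first `p ^ m` powers of the generator of `p ^ n ℤ_p`. -/
def avg (V : ZpRep p) (n m : ℕ) : V.V →ₗ[ℚ] V.V :=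
  ((p : ℚ) ^ m)⁻¹ • ∑ i ∈ Finset.range (p ^ m), V.ρ (gen p n ^ i)

theorem avg_apply (V : ZpRep p) (n m : ℕ) (v : V.V) :
    avg V n m v = ((p : ℚ) ^ m)⁻¹ • ∑ i ∈ Finset.range (p ^ m), V.ρ (gen p n ^ i) v := by
  rw [avg, LinearMap.smul_apply, LinearMap.sum_apply]

theorem map_avg {V W : ZpRep p} (f : V ⟶ W) (n m : ℕ) (v : V.V) :
    f.hom (avg V n m v) = avg W n m (f.hom v) := by
  rw [avg_apply, avg_apply, map_smul, map_sum]
  exact congrArg _ (Finset.sum_congr rfl fun i _ => Rep.hom_comm_apply f _ _)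

theorem avg_of_mem {V : ZpRep p} {n : ℕ} (m : ℕ) {v : V.V} (hv : v ∈ fixedPts V n) :
    avg V n m v = v := by
  have hp : (p : ℚ) ^ m ≠ 0 := pow_ne_zero _ (by exact_mod_cast (Fact.out : p.Prime).ne_zero)
  rw [avg_apply, Finset.sum_congr rfl fun i _ =>
    ρ_pow_apply_of_fixed (hv _ (gen_mem_level n)) i, Finset.sum_const, Finset.card_range,
    ← Nat.cast_smul_eq_nsmul ℚ, smul_smul, Nat.cast_pow, inv_mul_cancel₀ hp, one_smul]

/-- Acting by the generator shifts the sum by one place. The new last term equals the old first one,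
because the `p ^ m`-th power of the generator is `p ^ (n + m)`, which fixes `v`. -/
theorem avg_mem {V : ZpRep p} (n : ℕ) {m : ℕ} {v : V.V} (hv : v ∈ fixedPts V m) :
    avg V n m v ∈ fixedPts V n := by
  have hm : avg V n m v ∈ fixedPts V m := by
    rw [avg_apply]
    exact Submodule.smul_mem _ _ (Submodule.sum_mem _ fun i _ => fixedPts_invariant V m _ hv)
  refine mem_fixedPts_of_gen hm ?_
  rw [avg_apply, map_smul, map_sum]
  congr 1
  have h1 : ∀ i, V.ρ (gen p n) (V.ρ (gen p n ^ i) v) = V.ρ (gen p n ^ (i + 1)) v := fun i => by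
    rw [pow_succ', map_mul, Module.End.mul_apply]
  simp only [h1]
  have h2 := Finset.sum_range_succ' (fun i => V.ρ (gen p n ^ i) v) (p ^ m)
  rw [Finset.sum_range_succ] at h2
  have h3 : V.ρ (gen p n ^ p ^ m) v = v := by
    refine hv _ (mem_level.2 ⟨p ^ n, ?_⟩)
    rw [gen, ← ofAdd_nsmul, nsmul_eq_mul]
    push_cast
    rfl
  rw [h3, pow_zero, map_one, Module.End.one_apply] at h2
  exact (add_right_cancel h2).symm

/-- Lifts of fixed points can be taken to be fixed. -/
theorem exists_fixed_lift {V W : ZpRep p} (f : V ⟶ W) (hV : isDiscrete p V) {n : ℕ} {v : V.V}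
    (hw : f.hom v ∈ fixedPts W n) : ∃ v' ∈ fixedPts V n, f.hom v' = f.hom v := by
  obtain ⟨m, hm⟩ := hV v
  exact ⟨_, avg_mem n hm, by rw [map_avg, avg_of_mem m hw]⟩

/-- Presentations `y = f x + g w` of fixed points with `d x = 0` can be taken to be fixed. -/
theorem exists_fixed_add {V V' W W' : ZpRep p} (d : V ⟶ W') (f : V ⟶ W) (g : V' ⟶ W)
    (hV : isDiscrete p V) (hV' : isDiscrete p V') {n : ℕ} {y : W.V} (hy : y ∈ fixedPts W n)
    {x : V.V} {w : V'.V} (hx : d.hom x = 0) (hw : y = f.hom x + g.hom w) :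
    ∃ x ∈ fixedPts V n, d.hom x = 0 ∧ ∃ w ∈ fixedPts V' n, y = f.hom x + g.hom w := by
  obtain ⟨m₁, hm₁⟩ := hV x
  obtain ⟨m₂, hm₂⟩ := hV' w
  let m := max m₁ m₂
  refine ⟨_, avg_mem (m := m) n (fixedPts_mono _ (le_max_left _ _) hm₁), ?_, _,
    avg_mem (m := m) n (fixedPts_mono _ (le_max_right _ _) hm₂), ?_⟩
  · rw [map_avg, hx, map_zero]
  · rw [map_avg, map_avg, ← map_add, ← hw, avg_of_mem m hy]

/-- The generator of the permutation module. -/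
def permGen (p : ℕ) [Fact p.Prime] (n : ℕ) : (permRep p n).V :=
  MonoidAlgebra.single (1 : Multiplicative ℤ_[p] ⧸ level p n) (1 : ℚ)

theorem permRep_ρ_gen (n : ℕ) (g : Multiplicative ℤ_[p]) :
    (permRep p n).ρ g (permGen p n) =
      MonoidAlgebra.single (g : Multiplicative ℤ_[p] ⧸ level p n) (1 : ℚ) := by
  refine (Representation.ofMulAction_single g _ _).trans ?_
  exact congrArg (fun y : Multiplicative ℤ_[p] => MonoidAlgebra.single
    (y : Multiplicative ℤ_[p] ⧸ level p n) (1 : ℚ)) (mul_one g)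

theorem permRep_hom_ext {n : ℕ} {V : ZpRep p} {f f' : permRep p n ⟶ V}
    (h : f.hom (permGen p n) = f'.hom (permGen p n)) : f = f' := by
  refine Rep.hom_ext (Representation.IntertwiningMap.ext (MonoidAlgebra.lhom_ext' fun x =>
    LinearMap.ext_ring ?_))
  induction x using QuotientGroup.induction_on with
  | H g =>
    change f.hom (MonoidAlgebra.single (g : Multiplicative ℤ_[p] ⧸ level p n) (1 : ℚ)) =
      f'.hom (MonoidAlgebra.single (g : Multiplicative ℤ_[p] ⧸ level p n) (1 : ℚ))
    rw [← permRep_ρ_gen, Rep.hom_comm_apply, Rep.hom_comm_apply, h]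

/-- The map out of the permutation module given by a fixed vector. -/
def permHom {n : ℕ} {V : ZpRep p} (v : V.V) (hv : v ∈ fixedPts V n) : permRep p n ⟶ V :=
  homOf (Finsupp.linearCombination ℚ (Quotient.lift (fun g => V.ρ g v) fun a b hab => by
    have h : a⁻¹ * b ∈ level p n := QuotientGroup.leftRel_apply.1 hab
    have h1 := congrArg (V.ρ a) (hv _ h)
    rw [← Module.End.mul_apply, ← map_mul, mul_inv_cancel_left] at h1
    exact h1.symm : Multiplicative ℤ_[p] ⧸ level p n → V.V) ∘ₗ
      (MonoidAlgebra.coeffLinearEquiv ℚ).toLinearMap) (by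
      intro g x
      induction x using MonoidAlgebra.induction_linear with
      | zero => simp
      | add x y hx hy => rw [map_add, map_add, hx, hy, map_add, map_add]
      | single x c =>
        induction x using QuotientGroup.induction_on with
        | H a =>
          have h : (permRep p n).ρ g
              (MonoidAlgebra.single (a : Multiplicative ℤ_[p] ⧸ level p n) c) =
            MonoidAlgebra.single
              ((g * a : Multiplicative ℤ_[p]) : Multiplicative ℤ_[p] ⧸ level p n) c :=
              Representation.ofMulAction_single g _ _
          rw [h]
          change Finsupp.linearCombination ℚ _ (Finsupp.single _ _) =
            V.ρ g (Finsupp.linearCombination ℚ _ (Finsupp.single _ _))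
          rw [Finsupp.linearCombination_single, Finsupp.linearCombination_single, map_smul]
          change c • V.ρ (g * a) v = c • V.ρ g (V.ρ a v)
          rw [map_mul, Module.End.mul_apply])

theorem permHom_gen {n : ℕ} {V : ZpRep p} (v : V.V) (hv : v ∈ fixedPts V n) :
    (permHom v hv).hom (permGen p n) = v := by
  change Finsupp.linearCombination ℚ _ (Finsupp.single _ (1 : ℚ)) = _
  rw [Finsupp.linearCombination_single, one_smul]
  change V.ρ 1 v = v
  rw [map_one, Module.End.one_apply]

theorem rep_ext {V W : ZpRep p} {f g : V ⟶ W} (h : ∀ v, f.hom v = g.hom v) : f = g :=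
  Rep.hom_ext (Representation.IntertwiningMap.ext (LinearMap.ext h))

/-- Bijective morphisms of representations are isomorphisms. -/
theorem isIso_of_bijective {V W : ZpRep p} (f : V ⟶ W) (h : Function.Bijective f.hom) :
    IsIso f := by
  have : IsIso ((forget (ZpRep p)).map f) := (isIso_iff_bijective _).2 h
  exact isIso_of_reflects_iso f (forget (ZpRep p))

/-! ### Sheaves in terms of stalks -/

/-- Descriptions of sheaves by stalks: discrete modules `M_k` and `M_∞`, and a map from `M_∞` to
`colim_n ∏_{k ≥ n} M_k`. -/
structure ShModel (p : ℕ) [Fact p.Prime] where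
  fin : ℕ → ZpRep p
  fin_discrete : ∀ k, isDiscrete p (fin k)
  inf : ZpRep p
  inf_discrete : isDiscrete p inf
  str : inf ⟶ tails fin

namespace ShModel

/-- A morphism of descriptions. -/
@[ext]
structure Hom (M N : ShModel p) where
  fin : ∀ k, M.fin k ⟶ N.fin k
  inf : M.inf ⟶ N.inf
  comm : M.str ≫ tails.map fin = inf ≫ N.str

instance : Category (ShModel p) where
  Hom := Hom
  id M := ⟨fun _ => 𝟙 _, 𝟙 _, by rw [tails.map_id]; simp⟩
  comp f g := ⟨fun k => f.fin k ≫ g.fin k, f.inf ≫ g.inf, by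
    rw [tails.map_comp, ← Category.assoc, f.comm, Category.assoc, g.comm, Category.assoc]⟩
  id_comp f := Hom.ext (funext fun _ => Category.id_comp _) (Category.id_comp _)
  comp_id f := Hom.ext (funext fun _ => Category.comp_id _) (Category.comp_id _)
  assoc f g h := Hom.ext (funext fun _ => Category.assoc _ _ _) (Category.assoc _ _ _)

@[ext] theorem hom_ext {M N : ShModel p} {f g : M ⟶ N} (h : ∀ k, f.fin k = g.fin k)
    (h' : f.inf = g.inf) : f = g := Hom.ext (funext h) h'

/-- The value at `n`. -/
def evFin (p : ℕ) [Fact p.Prime] (k : ℕ) : ShModel p ⥤ ZpRep p where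
  obj M := M.fin k
  map f := f.fin k

/-- The value at infinity. -/
def evInf (p : ℕ) [Fact p.Prime] : ShModel p ⥤ ZpRep p where
  obj M := M.inf
  map f := f.inf

/-- A morphism that is bijective at all points is an isomorphism. -/
theorem isIso_of_isIso {M N : ShModel p} (f : M ⟶ N) [∀ k, IsIso (f.fin k)] [IsIso f.inf] :
    IsIso f := by
  refine ⟨⟨⟨fun k => inv (f.fin k), inv f.inf, ?_⟩, hom_ext (fun k => ?_) ?_,
    hom_ext (fun k => ?_) ?_⟩⟩
  · rw [IsIso.eq_inv_comp, ← Category.assoc, ← f.comm, Category.assoc, ← tails.map_comp]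
    simp only [IsIso.hom_inv_id, tails.map_id, Category.comp_id]
  · exact IsIso.hom_inv_id _
  · exact IsIso.hom_inv_id _
  · exact IsIso.inv_hom_id _
  · exact IsIso.inv_hom_id _

/-- The value at a point of `𝒮 ℤ_p`. -/
def fib (M : ShModel p) : Option ℕ → ZpRep p
  | none => M.inf
  | some k => M.fin k

theorem fib_discrete (M : ShModel p) : ∀ a, isDiscrete p (M.fib a)
  | none => M.inf_discrete
  | some k => M.fin_discrete k

/-- The map on values at a point. -/
def Hom.fib {M N : ShModel p} (f : Hom M N) : ∀ a, M.fib a ⟶ N.fib a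
  | none => f.inf
  | some k => f.fin k

/-- The sections over an open set `O`, as a subspace of the product of the values at the points
of `O`: compatible with the structure map and uniformly fixed. -/
def sections (M : ShModel p) (O : Opens (SubgroupSpace p)) :
    Submodule ℚ (piRep fun a : {a // pt p a ∈ O} => M.fib a).V where
  carrier := {s | (∀ (n : ℕ) (h : S p n ≤ O),
      M.str.hom (s ⟨none, h (mem_S_none n)⟩) =
        (tails.germ M.fin n).hom (fun k => s ⟨some k.1, h (mem_S_some.2 k.2)⟩)) ∧
      ∃ j, s ∈ fixedPts (piRep fun a : {a // pt p a ∈ O} => M.fib a) j}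
  add_mem' := by
    rintro s t ⟨hs, i, hi⟩ ⟨ht, j, hj⟩
    refine ⟨fun n h => ?_, max i j, Submodule.add_mem _ (fixedPts_mono _ (le_max_left _ _) hi)
      (fixedPts_mono _ (le_max_right _ _) hj)⟩
    exact (map_add M.str.hom _ _).trans ((congrArg₂ (· + ·) (hs n h) (ht n h)).trans
      (map_add (tails.germ M.fin n).hom _ _).symm)
  zero_mem' := ⟨fun n h => (map_zero M.str.hom).trans (map_zero (tails.germ M.fin n).hom).symm,
    0, Submodule.zero_mem _⟩
  smul_mem' := by
    rintro c s ⟨hs, i, hi⟩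
    refine ⟨fun n h => ?_, i, Submodule.smul_mem _ c hi⟩
    exact (map_smul M.str.hom c _).trans ((congrArg (c • ·) (hs n h)).trans
      (map_smul (tails.germ M.fin n).hom c _).symm)

theorem sections_invariant (M : ShModel p) (O : Opens (SubgroupSpace p)) (g)
    (s : (piRep fun a : {a // pt p a ∈ O} => M.fib a).V) (hs : s ∈ M.sections O) :
    (piRep fun a : {a // pt p a ∈ O} => M.fib a).ρ g s ∈ M.sections O := by
  obtain ⟨hs, i, hi⟩ := hs
  refine ⟨fun n h => ?_, i, fixedPts_invariant _ _ _ hi⟩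
  exact (Rep.hom_comm_apply M.str g _).trans ((congrArg ((tails M.fin).ρ g) (hs n h)).trans
    (Rep.hom_comm_apply (tails.germ M.fin n) g _).symm)

/-- The discrete `ℤ_p`-module of sections of `U M` over `O`. -/
def sectionsMod (M : ShModel p) (O : Opens (SubgroupSpace p)) : DiscMod p :=
  ⟨subRep _ (M.sections O) (M.sections_invariant O), fun v => by
    obtain ⟨j, hj⟩ := v.2.2
    exact ⟨j, fun g hg => Subtype.ext (hj g hg)⟩⟩

/-- The restriction of sections. -/
def sectionsRes (M : ShModel p) {O O' : Opens (SubgroupSpace p)} (h : O' ≤ O) :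
    M.sectionsMod O ⟶ M.sectionsMod O' :=
  ObjectProperty.homMk <| homOf
    { toFun := fun s => ⟨fun a => s.1 ⟨a.1, h a.2⟩, fun n hn => s.2.1 n (hn.trans h), by
        obtain ⟨j, hj⟩ := s.2.2
        exact ⟨j, fun g hg => funext fun a => congrFun (hj g hg) ⟨a.1, h a.2⟩⟩⟩
      map_add' := fun _ _ => rfl
      map_smul' := fun _ _ => rfl } fun _ _ => rfl

/-- The map on sections induced by a morphism. -/
def sectionsMap {M N : ShModel p} (f : M ⟶ N) (O : Opens (SubgroupSpace p)) :
    M.sectionsMod O ⟶ N.sectionsMod O :=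
  ObjectProperty.homMk <| homOf
    { toFun := fun s => ⟨fun a => (f.fib a.1).hom (s.1 a), fun n hn => by
          have h1 := congrArg (fun l => l.hom (s.1 ⟨none, hn (mem_S_none n)⟩)) f.comm
          have h2 := congrArg (tails.map f.fin).hom (s.2.1 n hn)
          exact h1.symm.trans (h2.trans (tails.map_germ f.fin n _)), by
        obtain ⟨j, hj⟩ := s.2.2
        refine ⟨j, fun g hg => funext fun a => ?_⟩
        exact (Rep.hom_comm_apply (f.fib a.1) g _).symm.trans
          (congrArg (f.fib a.1).hom (congrFun (hj g hg) a))⟩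
      map_add' := fun s t => Subtype.ext (funext fun a => map_add (f.fib a.1).hom _ _)
      map_smul' := fun c s => Subtype.ext (funext fun a => map_smul (f.fib a.1).hom c _) }
    fun g s => Subtype.ext (funext fun a => Rep.hom_comm_apply (f.fib a.1) g _)

/-- The presheaf underlying `U M`. -/
def presheaf (M : ShModel p) : TopCat.Presheaf (DiscMod p) (SubgroupSpace p) where
  obj O := M.sectionsMod O.unop
  map i := M.sectionsRes i.unop.le
  map_id _ := rfl
  map_comp _ _ := rfl

/-- Sections are families of values at points, so gluing is done pointwise, by choosing for each
point of `O` a member of the cover containing it. Compatibility at the trivial group and fixedness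
at a uniform level remain to be checked for the glued family. -/
theorem presheaf_isSheaf (M : ShModel p) : M.presheaf.IsSheaf := by
  intro E O R hR x hx
  have hcov : ∀ a : {a // pt p a ∈ O}, ∃ (W : Opens (SubgroupSpace p)) (f : W ⟶ O),
      R f ∧ pt p a ∈ W := fun a => by
    obtain ⟨W, f, hf, ha⟩ := hR (pt p a) a.2
    exact ⟨W, f, hf, ha⟩
  choose W f hf ha using hcov
  -- two members of the family agree at common points
  have key : ∀ (W₁ W₂ : Opens (SubgroupSpace p)) (f₁ : W₁ ⟶ O) (f₂ : W₂ ⟶ O) (h₁ : R f₁)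
      (h₂ : R f₂) (a : Option ℕ) (ha₁ : pt p a ∈ W₁) (ha₂ : pt p a ∈ W₂) (e : E.obj.V),
      ((x f₁ h₁).hom.hom e).1 ⟨a, ha₁⟩ = ((x f₂ h₂).hom.hom e).1 ⟨a, ha₂⟩ := by
    intro W₁ W₂ f₁ f₂ h₁ h₂ a ha₁ ha₂ e
    have := hx (Y₁ := W₁) (Y₂ := W₂) (Z := W₁ ⊓ W₂) (homOfLE inf_le_left) (homOfLE inf_le_right)
      h₁ h₂ (Subsingleton.elim _ _)
    exact congrArg (fun l : E ⟶ M.sectionsMod (W₁ ⊓ W₂) => (l.hom.hom e).1 ⟨a, ha₁, ha₂⟩) this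
  let t : E ⟶ M.sectionsMod O := ObjectProperty.homMk <| homOf
    { toFun := fun e => ⟨fun a => ((x (f a) (hf a)).hom.hom e).1 ⟨a.1, ha a⟩, by
        refine ⟨fun n h => ?_, ?_⟩
        · let a₀ : {a // pt p a ∈ O} := ⟨none, h (mem_S_none n)⟩
          -- The member of the cover containing the trivial group contains some `S_m`. The tail
          -- condition concerns only small neighbourhoods, so it can be compared over `S_(max m n)`.
          obtain ⟨m, hm⟩ := exists_S_le (ha a₀)
          have h1 := ((x (f a₀) (hf a₀)).hom.hom e).2.1 (max m n)
            ((S_anti (le_max_left m n)).trans hm)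
          refine h1.trans (Eq.trans ?_ (tails.germ_trunc (le_max_right m n) _))
          refine congrArg (tails.germ M.fin (max m n)).hom (funext fun k => ?_)
          exact key _ _ _ _ _ _ _ _ _ e
        -- A uniform level is not a local condition on an infinite cover. It is inherited here from
        -- the test object `E`: if `p ^ j ℤ_p` fixes `e`, equivariance makes it fix every value of
        -- the glued section.
        · obtain ⟨j, hj⟩ := E.property e
          refine ⟨j, fun g hg => funext fun a => ?_⟩
          have h1 := Rep.hom_comm_apply (x (f a) (hf a)).hom g e
          rw [hj g hg] at h1
          exact (congrArg (fun s => s.1 ⟨a.1, ha a⟩) h1).symm⟩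
      map_add' := fun e e' => Subtype.ext (funext fun a =>
        congrArg (fun s => s.1 ⟨a.1, ha a⟩) (map_add (x (f a) (hf a)).hom.hom e e'))
      map_smul' := fun c e => Subtype.ext (funext fun a =>
        congrArg (fun s => s.1 ⟨a.1, ha a⟩) (map_smul (x (f a) (hf a)).hom.hom c e)) }
    fun g e => Subtype.ext (funext fun a =>
      congrArg (fun s => s.1 ⟨a.1, ha a⟩) (Rep.hom_comm_apply (x (f a) (hf a)).hom g e))
  refine ⟨t, fun W' f' hf' => ?_, fun t' ht' => ?_⟩
  · refine ObjectProperty.hom_ext _ (Rep.hom_ext (Representation.IntertwiningMap.ext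
      (LinearMap.ext fun e => Subtype.ext (funext fun a => ?_))))
    exact key _ _ _ _ _ _ _ _ _ e
  · refine ObjectProperty.hom_ext _ (Rep.hom_ext (Representation.IntertwiningMap.ext
      (LinearMap.ext fun e => Subtype.ext (funext fun a => ?_))))
    exact congrArg (fun l : E ⟶ M.sectionsMod (W a) => (l.hom.hom e).1 ⟨a.1, ha a⟩)
      (ht' (f a) (hf a))

/-- The sheaf of sections. -/
def sheafFunctor (p : ℕ) [Fact p.Prime] : ShModel p ⥤ SheafModel p where
  obj M := ⟨M.presheaf, M.presheaf_isSheaf⟩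
  map f := ⟨{ app := fun O => sectionsMap f O.unop
              naturality := fun _ _ _ => rfl }⟩
  map_id M := by
    apply CategoryTheory.Sheaf.hom_ext
    ext O : 2
    refine ObjectProperty.hom_ext _ (Rep.hom_ext (Representation.IntertwiningMap.ext
      (LinearMap.ext fun s => Subtype.ext (funext fun ⟨a, _⟩ => ?_))))
    cases a <;> rfl
  map_comp f g := by
    apply CategoryTheory.Sheaf.hom_ext
    ext O : 2
    refine ObjectProperty.hom_ext _ (Rep.hom_ext (Representation.IntertwiningMap.ext
      (LinearMap.ext fun s => Subtype.ext (funext fun ⟨a, _⟩ => ?_))))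
    cases a <;> rfl


end ShModel

open ShModel

/-- Objects of the algebraic model as descriptions of sheaves. -/
def algToSh (p : ℕ) [Fact p.Prime] : AlgModel p ⥤ ShModel p where
  obj M := ⟨M.fin, fun k v => ⟨k, M.fin_fixed k v⟩, M.inf, M.inf_discrete, M.str⟩
  map f := ⟨f.fin, f.inf, f.comm⟩

instance : (algToSh p).Full := ⟨fun f => ⟨⟨f.fin, f.inf, f.comm⟩, rfl⟩⟩

instance : (algToSh p).Faithful := ⟨fun h => AlgModel.hom_ext
  (fun k => congrArg (fun l => ShModel.Hom.fin l k) h) (congrArg ShModel.Hom.inf h)⟩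

/-- `U` is the composite of the inclusion with the sheaf of sections. -/
def uIso (p : ℕ) [Fact p.Prime] : algToSh p ⋙ sheafFunctor p ≅ U p :=
  Iso.refl _

/-- The stalks of a sheaf. -/
def stalksFunctor (p : ℕ) [Fact p.Prime] : SheafModel p ⥤ ShModel p where
  obj N := ⟨N.fin, fun k => (N.obj.obj (op (single p k))).property, N.stalk, N.stalk_discrete,
    N.toTails⟩
  map f := ⟨fun k => SheafModel.app f (single p k), SheafModel.stalkMap f,
    (SheafModel.stalkMap_toTails f).symm⟩
  map_id N := ShModel.hom_ext (fun _ => rfl) (SheafModel.stalkMap_id N)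
  map_comp f g := ShModel.hom_ext (fun _ => rfl) (SheafModel.stalkMap_comp f g)

/-! ### Sequential colimits in terms of elements -/

/-- The map out of a sequential colimit given by compatible maps. -/
def seqColim.desc {F : ℕ → ZpRep p} {t : ∀ i j, i ≤ j → (F i ⟶ F j)} {V : ZpRep p}
    (f : ∀ i, F i ⟶ V) (hf : ∀ i j h, t i j h ≫ f j = f i) : seqColim F t ⟶ V :=
  have hι : ∀ i (y : (F i).V), Module.DirectLimit.lift ℚ ℕ (fun i => (F i).V)
      (fun i j h => (t i j h).hom.toLinearMap) (fun i => (f i).hom.toLinearMap)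
      (fun i j h x => congrArg (fun l => l.hom x) (hf i j h)) ((seqColim.ι F t i).hom y) =
        (f i).hom y := fun i y => Module.DirectLimit.lift_of _ _ _
  homOf (Module.DirectLimit.lift ℚ ℕ (fun i => (F i).V)
      (fun i j h => (t i j h).hom.toLinearMap) (fun i => (f i).hom.toLinearMap)
      (fun i j h x => congrArg (fun l => l.hom x) (hf i j h))) fun g x => by
    obtain ⟨i, y, rfl⟩ := seqColim.exists_ι x
    rw [← Rep.hom_comm_apply, hι, hι, Rep.hom_comm_apply]

theorem seqColim.desc_ι {F : ℕ → ZpRep p} {t : ∀ i j, i ≤ j → (F i ⟶ F j)} {V : ZpRep p}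
    (f : ∀ i, F i ⟶ V) (hf : ∀ i j h, t i j h ≫ f j = f i) (i : ℕ) (x : (F i).V) :
    (seqColim.desc f hf).hom ((seqColim.ι F t i).hom x) = (f i).hom x :=
  Module.DirectLimit.lift_of _ (fun i j h x => congrArg (fun l => l.hom x) (hf i j h)) _

theorem seqColim.exists_of_ι_eq_zero {F : ℕ → ZpRep p} {t : ∀ i j, i ≤ j → (F i ⟶ F j)}
    (hid : ∀ i, t i i le_rfl = 𝟙 _)
    (hcomp : ∀ i j k (h : i ≤ j) (h' : j ≤ k), t i j h ≫ t j k h' = t i k (h.trans h'))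
    {i : ℕ} {x : (F i).V} (hx : (seqColim.ι F t i).hom x = 0) :
    ∃ j, ∃ h : i ≤ j, (t i j h).hom x = 0 := by
  have : DirectedSystem (fun i => (F i).V) (fun i j h => (t i j h).hom.toLinearMap) :=
    ⟨fun i x => congrArg (fun l => l.hom x) (hid i),
      fun k j i h h' x => congrArg (fun l => l.hom x) (hcomp _ _ _ h h')⟩
  exact Module.DirectLimit.of.zero_exact (f := fun i j h => (t i j h).hom.toLinearMap) hx

theorem tails.exists_of_germ_eq_zero {M : ℕ → ZpRep p} {n : ℕ} {s : ∀ k : {k // n ≤ k}, (M k).V}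
    (h : (tails.germ M n).hom s = 0) :
    ∃ m, ∃ hm : n ≤ m, ∀ k (hk : m ≤ k), s ⟨k, hm.trans hk⟩ = 0 := by
  obtain ⟨m, hm, h0⟩ := seqColim.exists_of_ι_eq_zero (F := seqFrom M) (t := seqFrom.trunc M)
    (fun _ => rfl) (fun _ _ _ _ _ => rfl) h
  exact ⟨m, hm, fun k hk => congrFun h0 ⟨k, hk⟩⟩

theorem tails.exists_of_germ_eq {M : ℕ → ZpRep p} {n n' : ℕ} {s : ∀ k : {k // n ≤ k}, (M k).V}
    {s' : ∀ k : {k // n' ≤ k}, (M k).V} (h : (tails.germ M n).hom s = (tails.germ M n').hom s') :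
    ∃ m, ∃ (hm : n ≤ m) (hm' : n' ≤ m), ∀ k (hk : m ≤ k),
      s ⟨k, hm.trans hk⟩ = s' ⟨k, hm'.trans hk⟩ := by
  let q := max n n'
  have h1 : n ≤ q := le_max_left _ _
  have h2 : n' ≤ q := le_max_right _ _
  have h0 : (tails.germ M q).hom
      ((fun k : {k // q ≤ k} => s ⟨k.1, h1.trans k.2⟩) -
        (fun k : {k // q ≤ k} => s' ⟨k.1, h2.trans k.2⟩)) = 0 :=
    (map_sub (tails.germ M q).hom _ _).trans (sub_eq_zero.2
      ((tails.germ_trunc h1 s).trans (h.trans (tails.germ_trunc h2 s').symm)))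
  obtain ⟨m, hm, hs⟩ := tails.exists_of_germ_eq_zero h0
  exact ⟨m, h1.trans hm, h2.trans hm, fun k hk => sub_eq_zero.1 (hs k hk)⟩

/-- If the class of a sequence is fixed by `p ^ j ℤ_p`, so are almost all of its entries. -/
theorem tails.exists_fixed {M : ℕ → ZpRep p} (hM : ∀ k, isDiscrete p (M k)) {n j : ℕ}
    {s : ∀ k : {k // n ≤ k}, (M k).V} (h : (tails.germ M n).hom s ∈ fixedPts (tails M) j) :
    ∃ m, ∃ hm : n ≤ m, ∀ k (hk : m ≤ k), s ⟨k, hm.trans hk⟩ ∈ fixedPts (M k) j := by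
  -- One equation, for the generator, holds in the colimit from some index on. Treating each element
  -- of `p ^ j ℤ_p` separately would give infinitely many indices without a bound.
  have h1 := h _ (gen_mem_level j)
  rw [← Rep.hom_comm_apply] at h1
  obtain ⟨m, hm, hm', hs⟩ := tails.exists_of_germ_eq (s := fun k => (M k).ρ (gen p j) (s k)) h1
  refine ⟨m, hm, fun k hk => ?_⟩
  obtain ⟨i, hi⟩ := hM k (s ⟨k, hm.trans hk⟩)
  exact mem_fixedPts_of_gen hi (hs k hk)

namespace SheafModel

variable (N : SheafModel p)

theorem germ_res {m n : ℕ} (h : m ≤ n) (x : (N.val (S p m)).V) :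
    (N.germ n).hom ((N.res (S_anti h)).hom x) = (N.germ m).hom x :=
  seqColim.ι_trans (F := fun n => N.val (S p n)) (t := fun _ _ h => N.res (S_anti h)) h x

theorem exists_germ (x : N.stalk.V) : ∃ n y, (N.germ n).hom y = x := seqColim.exists_ι x

theorem res_res {O O' O'' : Opens (SubgroupSpace p)} (h : O' ≤ O) (h' : O'' ≤ O')
    (x : (N.val O).V) : (N.res h').hom ((N.res h).hom x) = (N.res (h'.trans h)).hom x :=
  congrArg (fun l => l.hom x) (N.res_comp h h')

theorem res_self {O : Opens (SubgroupSpace p)} (x : (N.val O).V) : (N.res le_rfl).hom x = x :=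
  congrArg (fun l => l.hom.hom x) (N.obj.map_id (op O))

theorem exists_of_germ_eq_zero {n : ℕ} {x : (N.val (S p n)).V} (h : (N.germ n).hom x = 0) :
    ∃ m, ∃ hm : n ≤ m, (N.res (S_anti hm)).hom x = 0 :=
  seqColim.exists_of_ι_eq_zero (F := fun n => N.val (S p n)) (t := fun _ _ h => N.res (S_anti h))
    (fun _ => rep_ext fun x => N.res_self x) (fun _ _ _ _ _ => N.res_comp _ _) h

theorem toTails_germ (n : ℕ) (x : (N.val (S p n)).V) :
    N.toTails.hom ((N.germ n).hom x) =
      (tails.germ N.fin n).hom (fun k => (N.res (single_le_S k.2)).hom x) :=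
  congrArg (fun l => l.hom x) (N.germ_toTails n)

theorem stalkMap_germ {M N : SheafModel p} (f : M ⟶ N) (n : ℕ) (x : (M.val (S p n)).V) :
    (stalkMap f).hom ((M.germ n).hom x) = (N.germ n).hom ((app f (S p n)).hom x) :=
  congrArg (fun l => l.hom x) (germ_stalkMap f n)

theorem res_app_apply {M N : SheafModel p} (f : M ⟶ N) {O O' : Opens (SubgroupSpace p)}
    (h : O' ≤ O) (x : (M.val O).V) :
    (app f O').hom ((M.res h).hom x) = (N.res h).hom ((app f O).hom x) :=
  congrArg (fun l => l.hom x) (res_app f h)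

/-! ### Gluing of fixed sections -/

/-- Families of sections fixed by `p ^ j ℤ_p` glue uniquely. -/
theorem existsUnique_gluing {ι : Type} {O : Opens (SubgroupSpace p)}
    (W : ι → Opens (SubgroupSpace p))
    (hW : ∀ i, W i ≤ O) (hO : O ≤ iSup W) (j : ℕ) (x : ∀ i, (N.val (W i)).V)
    (hx : ∀ i, x i ∈ fixedPts (N.val (W i)) j)
    (hxx : ∀ i i', (N.res (inf_le_left : W i ⊓ W i' ≤ W i)).hom (x i) =
      (N.res (inf_le_right : W i ⊓ W i' ≤ W i')).hom (x i')) :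
    ∃! y : (N.val O).V, y ∈ fixedPts (N.val O) j ∧ ∀ i, (N.res (hW i)).hom y = x i := by
  -- The sheaf condition is tested against discrete modules. The permutation module `ℚ[ℤ_p / p ^ j]`
  -- corepresents vectors fixed by `p ^ j ℤ_p`, so these form a sheaf of sets, to which ordinary
  -- gluing applies.
  let E : DiscMod p := ⟨permRep p j, fun v => ⟨j, permRep_fixed j v⟩⟩
  let P : TopCat.Sheaf (Type) (SubgroupSpace p) := ⟨N.obj ⋙ coyoneda.obj (op E),
    (isSheaf_iff_isSheaf_of_type _ _).2 (N.property E)⟩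
  have ext : ∀ (O : Opens (SubgroupSpace p)) (f g : E ⟶ N.obj.obj (op O)),
      f.hom.hom (permGen p j) = g.hom.hom (permGen p j) → f = g :=
    fun _ _ _ h => ObjectProperty.hom_ext _ (permRep_hom_ext h)
  let hom : ∀ (O : Opens (SubgroupSpace p)) (y : (N.val O).V) (hy : y ∈ fixedPts (N.val O) j),
      E ⟶ N.obj.obj (op O) := fun O y hy => ObjectProperty.homMk (permHom y hy)
  have hhom : ∀ O y hy, (hom O y hy).hom.hom (permGen p j) = y := fun O y hy => permHom_gen y hy
  obtain ⟨y, hy, hu⟩ := P.existsUnique_gluing' W O (fun i => homOfLE (hW i)) hO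
    (fun i => hom (W i) (x i) (hx i)) (by
      intro i i'
      refine ext _ _ _ ?_
      have h1 := hxx i i'
      have h2 := congrArg (N.res (inf_le_left : W i ⊓ W i' ≤ W i)).hom (hhom _ (x i) (hx i))
      have h3 := congrArg (N.res (inf_le_right : W i ⊓ W i' ≤ W i')).hom (hhom _ (x i') (hx i'))
      exact h2.trans (h1.trans h3.symm))
  refine ⟨InducedCategory.Hom.hom (show E ⟶ N.obj.obj (op O) from y) |>.hom (permGen p j),
    ⟨map_mem_fixedPts _ (permRep_fixed j _), fun i => ?_⟩, ?_⟩
  · have h2 := congrArg (fun l : E ⟶ N.obj.obj (op (W i)) => l.hom.hom (permGen p j)) (hy i)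
    exact h2.trans (hhom _ _ _)
  · rintro z ⟨hz, hzx⟩
    have h1 := hu (hom O z hz) (by
      intro i
      refine ext _ _ _ ?_
      have h2 := congrArg (N.res (hW i)).hom (hhom O z hz)
      exact h2.trans ((hzx i).trans (hhom _ _ _).symm))
    have h2 := congrArg (fun l : E ⟶ N.obj.obj (op O) => l.hom.hom (permGen p j)) h1
    exact (hhom O z hz).symm.trans h2

end SheafModel

/-! ### Sheaves on `𝒮 ℤ_p` are determined by their stalks -/

theorem pt_injective : Function.Injective (pt p) := by
  have hp : (0 : ℝ) < p := by exact_mod_cast (Fact.out : p.Prime).pos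
  have h0 : ∀ n, ((p : ℝ) ^ n)⁻¹ ≠ 0 := fun n => by positivity
  intro a b h
  have h1 := congrArg Subtype.val h
  rcases a with - | a <;> rcases b with - | b
  · rfl
  · exact absurd h1.symm (h0 b)
  · exact absurd h1 (h0 a)
  · have h2 : ((p : ℝ) ^ a)⁻¹ = ((p : ℝ) ^ b)⁻¹ := h1
    exact congrArg some (le_antisymm (inv_pow_le_iff.1 h2.ge) (inv_pow_le_iff.1 h2.le))

omit [Fact p.Prime] in
theorem pt_surjective (x : SubgroupSpace p) : ∃ a, pt p a = x := by
  obtain ⟨x, rfl | ⟨n, rfl⟩⟩ := x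
  · exact ⟨none, rfl⟩
  · exact ⟨some n, rfl⟩

theorem mem_single_self (k : ℕ) : pt p (some k) ∈ single p k := rfl

theorem eq_of_mem_single {a : Option ℕ} {k : ℕ} (h : pt p a ∈ single p k) : a = some k :=
  pt_injective h

theorem not_S_le_single (n k : ℕ) : ¬ S p n ≤ single p k :=
  fun h => nomatch eq_of_mem_single (h (mem_S_none n))

theorem single_le {O : Opens (SubgroupSpace p)} {k : ℕ} (h : pt p (some k) ∈ O) :
    single p k ≤ O := by
  rintro x rfl
  exact h

/-! ### Stalks of the sheaf of sections -/

namespace ShModel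

theorem sections_fixed_iff {M : ShModel p} {O : Opens (SubgroupSpace p)} {j : ℕ}
    {s : (M.sectionsMod O).obj.V} :
    s ∈ fixedPts (M.sectionsMod O).obj j ↔ ∀ a, s.1 a ∈ fixedPts (M.fib a.1) j :=
  ⟨fun h a g hg => congrFun (congrArg Subtype.val (h g hg)) a,
    fun h g hg => Subtype.ext (funext fun a => h a g hg)⟩

/-- The value of a section at a point. -/
def sectionsEval (M : ShModel p) {O : Opens (SubgroupSpace p)} (a : Option ℕ) (ha : pt p a ∈ O) :
    (M.sectionsMod O).obj ⟶ M.fib a :=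
  homOf (LinearMap.proj (φ := fun a : {a // pt p a ∈ O} => (M.fib a).V) ⟨a, ha⟩ ∘ₗ
    (M.sections O).subtype) fun _ _ => rfl

/-- The section over a point given by a vector. -/
def singleSection (M : ShModel p) {k : ℕ} (v : (M.fin k).V) :
    (M.sectionsMod (single p k)).obj.V :=
  ⟨fun a => cast (congrArg (fun b => (M.fib b).V) (eq_of_mem_single a.2).symm) v,
    fun n h => absurd h (not_S_le_single n k), by
    obtain ⟨j, hj⟩ := M.fin_discrete k v
    refine ⟨j, fun g hg => funext fun ⟨a, ha⟩ => ?_⟩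
    obtain rfl := eq_of_mem_single ha
    exact hj g hg⟩

/-- The section over `S_n` given by a vector at infinity and a representing sequence of its image
under the structure map. -/
def nbhdSection (M : ShModel p) {m j : ℕ} (v : M.inf.V) (s : ∀ k : {k // m ≤ k}, (M.fin k.1).V)
    (h : M.str.hom v = (tails.germ M.fin m).hom s) (hv : v ∈ fixedPts M.inf j)
    (hs : ∀ k : {k // m ≤ k}, s k ∈ fixedPts (M.fin k.1) j) : (M.sectionsMod (S p m)).obj.V :=
  ⟨fun a => match a with
    | ⟨none, _⟩ => v
    | ⟨some k, hk⟩ => s ⟨k, mem_S_some.1 hk⟩,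
    fun _ hn => h.trans (tails.germ_trunc (mem_S_some.1 (hn (mem_S_some.2 le_rfl))) s).symm, by
    refine ⟨j, fun g hg => funext fun ⟨a, ha⟩ => ?_⟩
    cases a with
    | none => exact hv g hg
    | some k => exact hs ⟨k, mem_S_some.1 ha⟩ g hg⟩

/-- The stalks of the sheaf of sections. -/
def stalksSheafHom (M : ShModel p) : (stalksFunctor p).obj ((sheafFunctor p).obj M) ⟶ M where
  fin k := M.sectionsEval (some k) (mem_single_self k)
  inf := seqColim.desc (fun n => M.sectionsEval none (mem_S_none n)) fun _ _ _ => rfl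
  comm := by
    refine SheafModel.stalk_hom_ext fun n => rep_ext fun s => ?_
    have h1 := ((sheafFunctor p).obj M).toTails_germ n s
    have h2 := congrArg (tails.map fun k => M.sectionsEval (some k) (mem_single_self k)).hom h1
    refine h2.trans ((tails.map_germ _ n _).trans ?_)
    have h3 := s.2.1 n le_rfl
    refine h3.symm.trans (congrArg M.str.hom (?_ : _ = (seqColim.desc _ _).hom _))
    exact (seqColim.desc_ι (F := fun n => ((sheafFunctor p).obj M).val (S p n))
      (t := fun _ _ h => ((sheafFunctor p).obj M).res (S_anti h))
      (fun n => M.sectionsEval none (mem_S_none n)) (fun _ _ _ => rfl) n s).symm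

theorem stalksSheafHom_germ (M : ShModel p) (n : ℕ) (s : (M.sectionsMod (S p n)).obj.V) :
    (stalksSheafHom M).inf.hom ((((sheafFunctor p).obj M).germ n).hom s) =
      s.1 ⟨none, mem_S_none n⟩ :=
  seqColim.desc_ι (F := fun n => ((sheafFunctor p).obj M).val (S p n))
      (t := fun _ _ h => ((sheafFunctor p).obj M).res (S_anti h))
      (fun n => M.sectionsEval none (mem_S_none n)) (fun _ _ _ => rfl) n s

/-- A section over a single point is its value there. At the trivial group, a section with value
zero has a tail of class zero, hence vanishes on a smaller `S_m`. Conversely, a sequence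
representing the image of `v` is eventually fixed at the level of `v`, so together with `v` it is a
section near the trivial group. -/
instance (M : ShModel p) : IsIso (stalksSheafHom M) := by
  have h1 : ∀ k, IsIso ((stalksSheafHom M).fin k) := fun k => by
    refine isIso_of_bijective _ ⟨fun s s' h => ?_, fun v => ⟨M.singleSection v,
      cast_eq rfl v⟩⟩
    refine Subtype.ext (funext fun ⟨a, ha⟩ => ?_)
    obtain rfl := eq_of_mem_single ha
    exact h
  have h2 : IsIso (stalksSheafHom M).inf := by
    refine isIso_of_bijective _ ⟨(injective_iff_map_eq_zero _).2 fun x hx => ?_, fun v => ?_⟩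
    · obtain ⟨n, s, rfl⟩ := SheafModel.exists_germ _ x
      have hx := (stalksSheafHom_germ M n s).symm.trans hx
      have h3 : (0 : (tails M.fin).V) = (tails.germ M.fin n).hom
          (fun k => s.1 ⟨some k.1, mem_S_some.2 k.2⟩) := by
        rw [← s.2.1 n le_rfl, hx]
        exact (map_zero M.str.hom).symm
      obtain ⟨m, hm, h0⟩ := tails.exists_of_germ_eq_zero h3.symm
      have h4 : (((sheafFunctor p).obj M).res (S_anti hm)).hom s = 0 := by
        refine Subtype.ext (funext fun ⟨a, ha⟩ => ?_)
        cases a with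
        | none => exact hx
        | some k => exact h0 k (mem_S_some.1 ha)
      refine (((sheafFunctor p).obj M).germ_res hm s).symm.trans ?_
      exact (congrArg (((sheafFunctor p).obj M).germ m).hom h4).trans (map_zero _)
    · obtain ⟨j, hj⟩ := M.inf_discrete v
      obtain ⟨n, s, hs⟩ := tails.exists_germ (M.str.hom v)
      obtain ⟨m, hm, hsm⟩ := tails.exists_fixed M.fin_discrete (s := s) (j := j)
        (by rw [hs]; exact map_mem_fixedPts _ hj)
      refine ⟨(((sheafFunctor p).obj M).germ m).hom (M.nbhdSection v
        (fun k => s ⟨k.1, hm.trans k.2⟩) (hs.symm.trans (tails.germ_trunc hm s).symm) hj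
        fun k => hsm k.1 k.2), ?_⟩
      exact stalksSheafHom_germ M m _
  exact isIso_of_isIso _

/-- The stalks of the sheaf of sections. -/
def stalksSheafIso (p : ℕ) [Fact p.Prime] : sheafFunctor p ⋙ stalksFunctor p ≅ 𝟭 (ShModel p) :=
  NatIso.ofComponents (fun M => (asIso (stalksSheafHom M) :)) fun {M N} f => by
    refine hom_ext (fun k => rfl) (SheafModel.stalk_hom_ext fun n => rep_ext fun s => ?_)
    have h1 := SheafModel.stalkMap_germ ((sheafFunctor p).map f) n s
    have h2 := congrArg (stalksSheafHom N).inf.hom h1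
    refine h2.trans ((stalksSheafHom_germ N n _).trans ?_)
    exact (congrArg f.inf.hom (stalksSheafHom_germ M n s)).symm

end ShModel

open ShModel

/-! ### Recovering a sheaf from its stalks -/

namespace SheafModel

variable (N : SheafModel p)

/-- The value of a section at a point. -/
def toFib (O : Opens (SubgroupSpace p)) :
    ∀ a, pt p a ∈ O → (N.val O ⟶ ((stalksFunctor p).obj N).fib a)
  | none, h => N.res (exists_S_le h).choose_spec ≫ N.germ (exists_S_le h).choose
  | some _, h => N.res (single_le h)

/-- The definition of `toFib` chooses one neighbourhood `S_n` inside `O`. Passing to the smaller of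
two such neighbourhoods shows that the germ is independent of the choice. -/
theorem toFib_none {O : Opens (SubgroupSpace p)} (h : pt p none ∈ O) {n : ℕ} (hn : S p n ≤ O)
    (x : (N.val O).V) : (N.toFib O none h).hom x = (N.germ n).hom ((N.res hn).hom x) := by
  have key : ∀ {m n : ℕ} (hmn : m ≤ n) (hm : S p m ≤ O),
      (N.germ m).hom ((N.res hm).hom x) =
        (N.germ n).hom ((N.res ((S_anti hmn).trans hm)).hom x) := fun hmn hm => by
    rw [← N.germ_res hmn, N.res_res]
  change (N.germ (exists_S_le h).choose).hom ((N.res (exists_S_le h).choose_spec).hom x) = _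
  exact (key (le_max_left _ n) _).trans (key (le_max_right _ n) hn).symm

theorem toFib_res {O O' : Opens (SubgroupSpace p)} (h : O' ≤ O) (a : Option ℕ) (ha : pt p a ∈ O')
    (x : (N.val O).V) : (N.toFib O' a ha).hom ((N.res h).hom x) = (N.toFib O a (h ha)).hom x := by
  cases a with
  | none =>
    obtain ⟨n, hn⟩ := exists_S_le ha
    rw [N.toFib_none ha hn, N.toFib_none (h ha) (hn.trans h), N.res_res]
  | some k => exact N.res_res h _ x

theorem toFib_app {M N : SheafModel p} (f : M ⟶ N) (O : Opens (SubgroupSpace p)) (a : Option ℕ)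
    (ha : pt p a ∈ O) (x : (M.val O).V) : (N.toFib O a ha).hom ((app f O).hom x) =
      (((stalksFunctor p).map f).fib a).hom ((M.toFib O a ha).hom x) := by
  cases a with
  | none =>
    obtain ⟨n, hn⟩ := exists_S_le ha
    rw [N.toFib_none ha hn, M.toFib_none ha hn, ← res_app_apply]
    exact (stalkMap_germ f n _).symm
  | some k => exact (res_app_apply f (single_le ha) x).symm

/-- The open sets on which `x` vanishes cover `O`, since a germ that is zero is zero on a
neighbourhood. Uniqueness of gluing is available among sections of a fixed level, so the level of
`x` itself is used. -/
theorem eq_zero_of_toFib {O : Opens (SubgroupSpace p)} {x : (N.val O).V}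
    (h : ∀ a ha, (N.toFib O a ha).hom x = 0) : x = 0 := by
  let W : {W : Opens (SubgroupSpace p) // ∃ h : W ≤ O, (N.res h).hom x = 0} →
    Opens (SubgroupSpace p) := Subtype.val
  have hcov : O ≤ iSup W := by
    intro y hy
    obtain ⟨a, rfl⟩ := pt_surjective y
    cases a with
    | none =>
      obtain ⟨n, hn⟩ := exists_S_le hy
      have h1 := h none hy
      rw [N.toFib_none hy hn] at h1
      obtain ⟨m, hm, h2⟩ := N.exists_of_germ_eq_zero h1
      rw [N.res_res] at h2
      exact Opens.mem_iSup.2 ⟨⟨S p m, _, h2⟩, mem_S_none m⟩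
    | some k => exact Opens.mem_iSup.2 ⟨⟨single p k, single_le hy, h (some k) hy⟩, rfl⟩
  obtain ⟨j, hj⟩ := (N.obj.obj (op O)).property x
  refine (N.existsUnique_gluing W (fun i => i.2.1) hcov j (fun _ => 0)
    (fun _ => Submodule.zero_mem _) fun i i' => ?_).unique ⟨hj, fun i => i.2.2⟩
    ⟨Submodule.zero_mem _, fun i => map_zero (N.res i.2.1).hom⟩
  exact (map_zero (N.res _).hom).trans (map_zero (N.res _).hom).symm

theorem eq_of_toFib {O : Opens (SubgroupSpace p)} {x y : (N.val O).V}
    (h : ∀ a ha, (N.toFib O a ha).hom x = (N.toFib O a ha).hom y) : x = y :=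
  sub_eq_zero.1 (N.eq_zero_of_toFib fun a ha => by
    rw [← sub_eq_zero.2 (h a ha)]
    exact map_sub (N.toFib O a ha).hom x y)

/-- The section of the sheaf associated to the stalks given by a section. -/
def toSections (O : Opens (SubgroupSpace p)) :
    N.obj.obj (op O) ⟶ ((stalksFunctor p).obj N).sectionsMod O :=
  ObjectProperty.homMk <| homOf
    { toFun := fun x => ⟨fun a => (N.toFib O a.1 a.2).hom x, fun n hn => by
          have h1 := congrArg N.toTails.hom (N.toFib_none (hn (mem_S_none n)) hn x)
          refine h1.trans ((N.toTails_germ n _).trans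
            (congrArg (tails.germ N.fin n).hom (funext fun k => ?_)))
          exact N.res_res hn _ x, by
        obtain ⟨j, hj⟩ := (N.obj.obj (op O)).property x
        exact ⟨j, fun g hg => funext fun a => map_mem_fixedPts (N.toFib O a.1 a.2) hj g hg⟩⟩
      map_add' := fun x y => Subtype.ext (funext fun a => map_add (N.toFib O a.1 a.2).hom x y)
      map_smul' := fun c x => Subtype.ext (funext fun a => map_smul (N.toFib O a.1 a.2).hom c x) }
    fun g x => Subtype.ext (funext fun a => Rep.hom_comm_apply (N.toFib O a.1 a.2) g x)

/-- This is the local half of surjectivity of `toSections`. The common level `j` for all points is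
essential, because only sections of one fixed level can be glued. -/
theorem exists_local_section {O : Opens (SubgroupSpace p)} {j : ℕ}
    {s : (((stalksFunctor p).obj N).sectionsMod O).obj.V}
    (hs : ∀ a, s.1 a ∈ fixedPts (((stalksFunctor p).obj N).fib a.1) j) (a : {a // pt p a ∈ O}) :
    ∃ (W : Opens (SubgroupSpace p)) (hW : W ≤ O) (_ : pt p a.1 ∈ W) (x : (N.val W).V),
      x ∈ fixedPts (N.val W) j ∧ ∀ b hb, (N.toFib W b hb).hom x = s.1 ⟨b, hW hb⟩ := by
  obtain ⟨a, ha⟩ := a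
  cases a with
  | some k =>
    refine ⟨single p k, single_le ha, rfl, s.1 ⟨some k, ha⟩, hs ⟨some k, ha⟩, fun b hb => ?_⟩
    obtain rfl := eq_of_mem_single hb
    exact N.res_self _
  | none =>
    obtain ⟨n, hn⟩ := exists_S_le ha
    obtain ⟨n', x', hx'⟩ := N.exists_germ (s.1 ⟨none, ha⟩)
    let q := max n n'
    have hq : S p q ≤ O := (S_anti (le_max_left _ _)).trans hn
    let x₀ := (N.res (S_anti (le_max_right n n'))).hom x'
    have hx₀ : (N.germ q).hom x₀ = s.1 ⟨none, ha⟩ := (N.germ_res (le_max_right n n') x').trans hx'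
    -- A section with the prescribed germ is fixed only at some uncontrolled level. Averaging lowers
    -- this to `j` without changing the germ, which is itself fixed at level `j`. Both `x` and `s`
    -- then represent the same tail, so they agree near the trivial group.
    obtain ⟨x, hx, hxx⟩ := exists_fixed_lift (N.germ q) (N.obj.obj (op (S p q))).property
      (v := x₀) (n := j) (by rw [hx₀]; exact hs ⟨none, ha⟩)
    rw [hx₀] at hxx
    have h1 := (s.2.1 q hq).symm.trans ((congrArg N.toTails.hom hxx.symm).trans
      (N.toTails_germ q x))
    obtain ⟨m, hm, hm', h2⟩ := tails.exists_of_germ_eq h1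
    refine ⟨S p m, (S_anti hm).trans hq, mem_S_none m, (N.res (S_anti hm)).hom x,
      map_mem_fixedPts _ hx, fun b hb => ?_⟩
    rw [N.toFib_res]
    cases b with
    | none =>
      rw [N.toFib_none _ le_rfl, N.res_self]
      exact hxx
    | some k => exact (h2 k (mem_S_some.1 hb)).symm

/-- Sections are separated by stalks, which gives injectivity and also shows that local sections
with the same values agree on overlaps. Since they share a level, they glue, which gives
surjectivity. -/
theorem toSections_bijective (O : Opens (SubgroupSpace p)) :
    Function.Bijective (N.toSections O).hom.hom := by
  constructor
  · intro x y h
    exact N.eq_of_toFib fun a ha => congrFun (congrArg Subtype.val h) ⟨a, ha⟩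
  · intro s
    obtain ⟨j, hj⟩ := (((stalksFunctor p).obj N).sectionsMod O).property s
    choose W hW ha x hx hxs using N.exists_local_section (sections_fixed_iff.1 hj)
    obtain ⟨y, ⟨-, hy⟩, -⟩ := N.existsUnique_gluing W hW (fun z hz => by
      obtain ⟨a, rfl⟩ := pt_surjective z
      exact Opens.mem_iSup.2 ⟨⟨a, hz⟩, ha ⟨a, hz⟩⟩) j x hx fun i i' =>
        N.eq_of_toFib fun b hb => by
          rw [N.toFib_res, N.toFib_res, hxs, hxs]
    refine ⟨y, Subtype.ext (funext fun a => ?_)⟩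
    have h1 := N.toFib_res (hW a) a.1 (ha a) y
    rw [hy, hxs] at h1
    exact h1.symm

/-- The comparison of a sheaf with the sheaf associated to its stalks. -/
def toSheafStalks : N ⟶ (sheafFunctor p).obj ((stalksFunctor p).obj N) :=
  ⟨{ app := fun O => N.toSections O.unop
     naturality := fun O O' i => by
      refine ObjectProperty.hom_ext _ (rep_ext fun x => Subtype.ext (funext fun a => ?_))
      exact N.toFib_res i.unop.le a.1 a.2 x }⟩

instance : IsIso N.toSheafStalks := by
  have h1 : ∀ O, IsIso (N.toSections O) := fun O => by
    have : IsIso ((isDiscrete p).ι.map (N.toSections O)) :=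
      isIso_of_bijective (N.toSections O).hom (N.toSections_bijective O)
    exact isIso_of_reflects_iso _ (isDiscrete p).ι
  have h2 : IsIso N.toSheafStalks.hom := by
    have : ∀ O, IsIso (N.toSheafStalks.hom.app O) := fun O => h1 O.unop
    exact NatIso.isIso_of_isIso_app _
  exact ⟨⟨⟨inv N.toSheafStalks.hom⟩, CategoryTheory.Sheaf.hom_ext (IsIso.hom_inv_id _),
    CategoryTheory.Sheaf.hom_ext (IsIso.inv_hom_id _)⟩⟩

end SheafModel

/-- A sheaf is determined by its stalks. -/
def sheafStalksIso (p : ℕ) [Fact p.Prime] : 𝟭 (SheafModel p) ≅ stalksFunctor p ⋙ sheafFunctor p :=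
  NatIso.ofComponents (fun N => (asIso N.toSheafStalks :)) fun {M N} f => by
    apply CategoryTheory.Sheaf.hom_ext
    ext O : 2
    refine ObjectProperty.hom_ext _ (rep_ext fun x => Subtype.ext (funext fun a => ?_))
    exact SheafModel.toFib_app f O.unop a.1 a.2 x

/-- Sheaves on `𝒮 ℤ_p` are equivalent to their descriptions by stalks. -/
def sheafEquivalence (p : ℕ) [Fact p.Prime] : ShModel p ≌ SheafModel p :=
  CategoryTheory.Equivalence.mk (sheafFunctor p) (stalksFunctor p) (stalksSheafIso p).symm
    (sheafStalksIso p).symm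

instance : (sheafFunctor p).IsEquivalence := (sheafEquivalence p).isEquivalence_functor

instance : (stalksFunctor p).IsEquivalence := (sheafEquivalence p).isEquivalence_inverse

/-! ### Colimits of descriptions of sheaves -/

/-- The underlying set of a representation, as a functor. -/
abbrev elems (p : ℕ) [Fact p.Prime] : ZpRep p ⥤ Type :=
  forget₂ (ZpRep p) (ModuleCat ℚ) ⋙ forget (ModuleCat ℚ)

/-- The vectors that are fixed by some `p ^ n ℤ_p`. -/
def discPart (V : ZpRep p) : Submodule ℚ V.V where
  carrier := {v | ∃ n, v ∈ fixedPts V n}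
  add_mem' := fun ⟨m, hm⟩ ⟨n, hn⟩ => ⟨max m n, Submodule.add_mem _
    (fixedPts_mono V (le_max_left m n) hm) (fixedPts_mono V (le_max_right m n) hn)⟩
  zero_mem' := ⟨0, Submodule.zero_mem _⟩
  smul_mem' := fun c _ ⟨m, hm⟩ => ⟨m, Submodule.smul_mem _ c hm⟩

/-- The representation on the vectors that are fixed by some `p ^ n ℤ_p`. -/
abbrev discRep (V : ZpRep p) : ZpRep p :=
  subRep V (discPart V) fun g _ ⟨n, hn⟩ => ⟨n, fixedPts_invariant V n g hn⟩

/-- Maps out of discrete modules land in the discrete part of the colimit, so the colimit maps to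
its discrete part. Composed with the inclusion this is the identity, and every vector is discrete.
-/
theorem isDiscrete_colimit {J : Type} [SmallCategory J] {F : J ⥤ ZpRep p}
    (hF : ∀ j, isDiscrete p (F.obj j)) {c : Cocone F} (hc : IsColimit c) : isDiscrete p c.pt := by
  let i : discRep c.pt ⟶ c.pt := homOf (discPart c.pt).subtype fun _ _ => rfl
  let s : Cocone F := ⟨discRep c.pt, { 
    app := fun j => homOf ((c.ι.app j).hom.toLinearMap.codRestrict (discPart c.pt) fun v => by
      obtain ⟨n, hn⟩ := hF j v
      exact ⟨n, map_mem_fixedPts _ hn⟩) fun g v => Subtype.ext (Rep.hom_comm_apply (c.ι.app j) g v)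
    naturality := fun j j' u => rep_ext fun v => Subtype.ext
      (congrArg (fun l => l.hom v) (c.w u)) }⟩
  have h : hc.desc s ≫ i = 𝟙 _ := hc.hom_ext fun j => by
    rw [← Category.assoc, hc.fac, Category.comp_id]
    rfl
  intro v
  have h1 : i.hom ((hc.desc s).hom v) = v := congrArg (fun l => l.hom v) h
  rw [← h1]
  exact ((hc.desc s).hom v).2

namespace ShModel

/-- The value at a point, as a functor. -/
def evFib (p : ℕ) [Fact p.Prime] (a : Option ℕ) : ShModel p ⥤ ZpRep p where
  obj M := M.fib a
  map f := f.fib a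
  map_id M := by cases a <;> rfl
  map_comp f g := by cases a <;> rfl

section Colimits

variable {J : Type} [SmallCategory J] (F : J ⥤ ShModel p)

/-- The structure map of the levelwise colimit. -/
def colimitStr : colimit (F ⋙ evInf p) ⟶ tails fun k => colimit (F ⋙ evFin p k) :=
  -- Only the canonical comparison from the colimit of tails to the tails of the colimit is used;
  -- `tails` need not commute with colimits.
  colimit.desc (F ⋙ evInf p) ⟨_,
    { app := fun j => (F.obj j).str ≫ tails.map fun k => colimit.ι (F ⋙ evFin p k) j
      naturality := fun j j' u => by
        have h1 : ∀ k, (F.map u).fin k ≫ colimit.ι (F ⋙ evFin p k) j' =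
          colimit.ι (F ⋙ evFin p k) j := fun k => colimit.w (F ⋙ evFin p k) u
        have h3 : tails.map (F.map u).fin ≫
            tails.map (fun k => (colimit.ι (F ⋙ evFin p k) j' : (F.obj j').fin k ⟶ _)) =
              tails.map (fun k => (colimit.ι (F ⋙ evFin p k) j : (F.obj j).fin k ⟶ _)) :=
          (tails.map_comp _ _).symm.trans (congrArg (fun l => tails.map l) (funext h1))
        refine Eq.trans ?_ (Category.comp_id _).symm
        refine (Category.assoc _ _ _).symm.trans ?_
        refine (congrArg (· ≫ _) (F.map u).comm.symm).trans ?_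
        exact (Category.assoc _ _ _).trans (congrArg _ h3) }⟩

theorem ι_colimitStr (j : J) : colimit.ι (F ⋙ evInf p) j ≫ colimitStr F =
    (F.obj j).str ≫ tails.map fun k => (colimit.ι (F ⋙ evFin p k) j : (F.obj j).fin k ⟶ _) :=
  colimit.ι_desc (F := F ⋙ evInf p) _ j

/-- The levelwise colimit. -/
def colimitCocone : Cocone F where
  pt :=
    { fin := fun k => colimit (F ⋙ evFin p k)
      fin_discrete := fun k => isDiscrete_colimit (fun j => (F.obj j).fin_discrete k)
        (colimit.isColimit (F ⋙ evFin p k))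
      inf := colimit (F ⋙ evInf p)
      inf_discrete := isDiscrete_colimit (fun j => (F.obj j).inf_discrete)
        (colimit.isColimit (F ⋙ evInf p))
      str := colimitStr F }
  ι :=
    { app := fun j => ⟨fun k => colimit.ι (F ⋙ evFin p k) j, colimit.ι (F ⋙ evInf p) j,
        (ι_colimitStr F j).symm⟩
      naturality := fun j j' u => by
        rw [Functor.const_obj_map]
        refine Eq.trans ?_ (Category.comp_id _).symm
        exact hom_ext (fun k => colimit.w (F ⋙ evFin p k) u) (colimit.w (F ⋙ evInf p) u) }

/-- The levelwise colimit is a colimit. -/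
def isColimitColimitCocone : IsColimit (colimitCocone F) where
  desc s :=
    { fin := fun k => colimit.desc (F ⋙ evFin p k) ((evFin p k).mapCocone s)
      inf := colimit.desc (F ⋙ evInf p) ((evInf p).mapCocone s)
      comm := colimit.hom_ext fun j => by
        have h1 : colimit.ι (F ⋙ evInf p) j ≫ (colimitCocone F).pt.str =
          (F.obj j).str ≫ tails.map fun k => colimit.ι (F ⋙ evFin p k) j :=
            ι_colimitStr F j
        have h2 : colimit.ι (F ⋙ evInf p) j ≫
            colimit.desc (F ⋙ evInf p) ((evInf p).mapCocone s) = (s.ι.app j).inf :=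
          colimit.ι_desc (F := F ⋙ evInf p) _ j
        have h3 : ∀ k, colimit.ι (F ⋙ evFin p k) j ≫
            colimit.desc (F ⋙ evFin p k) ((evFin p k).mapCocone s) = (s.ι.app j).fin k :=
          fun k => colimit.ι_desc (F := F ⋙ evFin p k) _ j
        refine (Category.assoc _ _ _).symm.trans ((congrArg (· ≫ _) h1).trans ?_)
        have h4 : tails.map (fun k => (colimit.ι (F ⋙ evFin p k) j : (F.obj j).fin k ⟶ _)) ≫
            tails.map (fun k => (colimit.desc (F ⋙ evFin p k) ((evFin p k).mapCocone s) :
              _ ⟶ s.pt.fin k)) = tails.map (s.ι.app j).fin :=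
          (tails.map_comp _ _).symm.trans (congrArg (fun l => tails.map l) (funext h3))
        refine (Category.assoc _ _ _).trans ((congrArg (_ ≫ ·) h4).trans ?_)
        refine (s.ι.app j).comm.trans ?_
        exact (congrArg (· ≫ s.pt.str) h2.symm).trans (Category.assoc _ _ _) }
  fac s j := hom_ext (fun k => colimit.ι_desc (F := F ⋙ evFin p k) _ j)
    (colimit.ι_desc (F := F ⋙ evInf p) _ j)
  uniq s m hm := hom_ext
    (fun k => colimit.hom_ext fun j => (congrArg (fun l : F.obj j ⟶ s.pt => l.fin k) (hm j)).trans
      (colimit.ι_desc (F := F ⋙ evFin p k) ((evFin p k).mapCocone s) j).symm)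
    (colimit.hom_ext fun j => (congrArg (fun l : F.obj j ⟶ s.pt => l.inf) (hm j)).trans
      (colimit.ι_desc (F := F ⋙ evInf p) ((evInf p).mapCocone s) j).symm)

instance (a : Option ℕ) : PreservesColimit F (evFib p a) := by
  refine preservesColimit_of_preserves_colimit_cocone (isColimitColimitCocone F) ?_
  cases a with
  | none => exact colimit.isColimit (F ⋙ evInf p)
  | some k => exact colimit.isColimit (F ⋙ evFin p k)

end Colimits

instance : HasColimits (ShModel p) :=
  ⟨fun _ _ => ⟨fun F => ⟨⟨_, isColimitColimitCocone F⟩⟩⟩⟩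

end ShModel

instance : HasColimits (SheafModel p) := Adjunction.has_colimits_of_equivalence (stalksFunctor p)

/-! ### Finite limits of sheaves -/

/-- A vector of a finite limit is determined by finitely many projections, and the largest of their
levels fixes it. For infinite diagrams the levels may be unbounded. -/
instance {J : Type} [SmallCategory J] [FinCategory J] :
    (isDiscrete p).IsClosedUnderLimitsOfShape J where
  limitsOfShape_le := by
    rintro X ⟨hX⟩
    intro v
    have hl : ∀ j, ∃ n, (hX.π.app j).hom v ∈ fixedPts (hX.diag.obj j) n :=
      fun j => hX.prop_diag_obj j _
    choose n hn using hl
    refine ⟨Finset.univ.sup n, fun g hg => ?_⟩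
    have hlim := isLimitOfPreserves (elems p) hX.isLimit
    refine (Types.isLimitEquivSections hlim).injective (Subtype.ext (funext fun j => ?_))
    refine (Rep.hom_comm_apply (hX.π.app j) g v).trans ?_
    exact hn j g (level_anti (Finset.le_sup (Finset.mem_univ j)) hg)

instance : HasFiniteLimits (SheafModel p) := ⟨fun _ _ _ => inferInstance⟩

/-! ### Free objects -/

/-- A representation is free on a vector fixed by `p ^ j ℤ_p`. -/
structure IsFreeOn (V : ZpRep p) (j : ℕ) (u : V.V) : Prop where
  mem : u ∈ fixedPts V j
  exists_hom : ∀ {W : ZpRep p} {w : W.V}, w ∈ fixedPts W j → ∃ f : V ⟶ W, f.hom u = w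
  hom_ext : ∀ {W : ZpRep p} {f g : V ⟶ W}, f.hom u = g.hom u → f = g

theorem isFreeOn_permRep (j : ℕ) : IsFreeOn (permRep p j) j (permGen p j) where
  mem := permRep_fixed j _
  exists_hom := fun hw => ⟨permHom _ hw, permHom_gen _ hw⟩
  hom_ext := permRep_hom_ext

theorem isFreeOn_piRep {P : Prop} (h : P) {V : ZpRep p} {j : ℕ} {u : V.V} (hu : IsFreeOn V j u) :
    IsFreeOn (piRep fun _ : PLift P => V) j (fun _ => u) where
  mem := fun g hg => funext fun _ => hu.mem g hg
  exists_hom := fun hw => by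
    obtain ⟨f, hf⟩ := hu.exists_hom hw
    exact ⟨(homOf (LinearMap.proj ⟨h⟩) fun _ _ => rfl) ≫ f, hf⟩
  hom_ext := fun {W f g} hfg => by
    let d : V ⟶ piRep fun _ : PLift P => V :=
      homOf (LinearMap.pi fun _ => LinearMap.id) fun _ _ => rfl
    have h1 : d ≫ f = d ≫ g := hu.hom_ext hfg
    exact rep_ext fun x => congrArg (fun l => l.hom (x ⟨h⟩)) h1

namespace ShModel

theorem comp_fib {M N P : ShModel p} (f : M ⟶ N) (g : N ⟶ P) (a : Option ℕ) :
    (f ≫ g).fib a = f.fib a ≫ g.fib a := (evFib p a).map_comp f g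

theorem comp_fib_apply {M N P : ShModel p} (f : M ⟶ N) (g : N ⟶ P) (a : Option ℕ)
    (x : (M.fib a).V) : ((f ≫ g).fib a).hom x = (g.fib a).hom ((f.fib a).hom x) :=
  congrArg (fun l => l.hom x) (comp_fib f g a)

theorem hom_ext_fib {M N : ShModel p} {f g : M ⟶ N} (h : ∀ a, f.fib a = g.fib a) : f = g :=
  hom_ext (fun k => h (some k)) (h none)

/-- An object is free on a section `u` over `O` fixed by `p ^ j ℤ_p`. -/
structure IsFree (B : ShModel p) (O : Opens (SubgroupSpace p)) (j : ℕ)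
    (u : (B.sectionsMod O).obj.V) : Prop where
  isFreeOn : ∀ a : {a // pt p a ∈ O}, IsFreeOn (B.fib a) j (u.1 a)
  eq_zero : ∀ a, pt p a ∉ O → ∀ v : (B.fib a).V, v = 0

namespace IsFree

variable {B : ShModel p} {O : Opens (SubgroupSpace p)} {j : ℕ} {u : (B.sectionsMod O).obj.V}
  (hu : IsFree B O j u)

include hu

theorem mem : u ∈ fixedPts (B.sectionsMod O).obj j :=
  sections_fixed_iff.2 fun a => (hu.isFreeOn a).mem

theorem hom_ext {N : ShModel p} {f g : B ⟶ N}
    (h : ∀ a : {a // pt p a ∈ O}, (f.fib a).hom (u.1 a) = (g.fib a).hom (u.1 a)) : f = g := by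
  refine hom_ext_fib fun a => ?_
  by_cases ha : pt p a ∈ O
  · exact (hu.isFreeOn ⟨a, ha⟩).hom_ext (h ⟨a, ha⟩)
  · refine rep_ext fun v => ?_
    rw [hu.eq_zero a ha v]
    exact (map_zero (f.fib a).hom).trans (map_zero (g.fib a).hom).symm

/-- The map is chosen point by point from freeness of each value, and is zero outside `O`.
Compatibility with the structure maps can be checked on the generator, where it is the tail
condition for `u` and for `s`. -/
theorem exists_hom {N : ShModel p} {s : (N.sectionsMod O).obj.V}
    (hs : ∀ a : {a // pt p a ∈ O}, s.1 a ∈ fixedPts (N.fib a) j) :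
    ∃ f : B ⟶ N, ∀ a : {a // pt p a ∈ O}, (f.fib a).hom (u.1 a) = s.1 a := by
  have h1 : ∀ a, ∃ f : B.fib a ⟶ N.fib a, ∀ ha : pt p a ∈ O, f.hom (u.1 ⟨a, ha⟩) = s.1 ⟨a, ha⟩ := by
    intro a
    by_cases ha : pt p a ∈ O
    · obtain ⟨f, hf⟩ := (hu.isFreeOn ⟨a, ha⟩).exists_hom (hs ⟨a, ha⟩)
      exact ⟨f, fun _ => hf⟩
    · exact ⟨0, fun h => absurd h ha⟩
  choose f hf using h1
  let fin : ∀ k, B.fin k ⟶ N.fin k := fun k => f (some k)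
  let inf : B.inf ⟶ N.inf := f none
  refine ⟨⟨fin, inf, ?_⟩, fun ⟨a, ha⟩ => ?_⟩
  · by_cases ha : pt p none ∈ O
    · refine (hu.isFreeOn ⟨none, ha⟩).hom_ext ?_
      obtain ⟨n, hn⟩ := exists_S_le ha
      have h2 := congrArg (tails.map fin).hom (u.2.1 n hn)
      refine h2.trans ((tails.map_germ fin n _).trans ?_)
      refine Eq.trans ?_ ((s.2.1 n hn).symm.trans (congrArg N.str.hom (hf none ha).symm))
      exact congrArg (tails.germ N.fin n).hom (funext fun k => hf (some k.1) _)
    · refine rep_ext fun v => ?_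
      have h2 : v = 0 := hu.eq_zero none ha v
      rw [h2]
      exact (map_zero (B.str ≫ tails.map fin).hom).trans (map_zero (inf ≫ N.str).hom).symm
  · cases a with
    | none => exact hf none ha
    | some k => exact hf (some k) ha

end IsFree

/-! ### Presentability of free objects -/

theorem _root_.PadicModel.fact_isRegular_aleph_one : Fact (Cardinal.aleph.{0} 1).IsRegular :=
  ⟨Cardinal.isRegular_aleph_one⟩

attribute [instance] fact_isRegular_aleph_one

section Filtered

variable {J : Type} [SmallCategory J] [IsCardinalFiltered J (Cardinal.aleph.{0} 1)]
  {F : J ⥤ ShModel p} {t : Cocone F} (ht : IsColimit t)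
  {ι : Type} [Countable ι] {a : ι → Option ℕ}

theorem _root_.PadicModel.hasCardinalLT_aleph_one (ι : Type) [Countable ι] :
    HasCardinalLT ι (Cardinal.aleph.{0} 1) :=
  (hasCardinalLT_iff_cardinal_mk_lt _ _).2
    (Cardinal.mk_le_aleph0.trans_lt Cardinal.aleph0_lt_aleph_one)

include ht

/-- The value of a filtered colimit at a point, on underlying sets. -/
theorem nonempty_isColimit_elems (b : Option ℕ) :
    Nonempty (IsColimit ((evFib p b ⋙ elems p).mapCocone t)) := by
  have := isFiltered_of_isCardinalFiltered J (Cardinal.aleph.{0} 1)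
  exact ⟨isColimitOfPreserves _ ht⟩

/-- An open set may contain infinitely many, but always countably many, points. Lifting all values
at one stage is what requires `ℵ₁`-filtered rather than filtered colimits. -/
theorem exists_lift_of_isColimit (z : ∀ i, (t.pt.fib (a i)).V) :
    ∃ j, ∃ x : ∀ i, ((F.obj j).fib (a i)).V, ∀ i, ((t.ι.app j).fib (a i)).hom (x i) = z i := by
  have h1 : ∀ i, ∃ j, ∃ x : ((F.obj j).fib (a i)).V, ((t.ι.app j).fib (a i)).hom x = z i :=
    fun i => Types.jointly_surjective _ (nonempty_isColimit_elems ht (a i)).some (z i)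
  choose j x hx using h1
  have hι := hasCardinalLT_aleph_one ι
  let q := IsCardinalFiltered.max j hι
  refine ⟨q, fun i => ((F.map (IsCardinalFiltered.toMax j hι i)).fib (a i)).hom (x i),
    fun i => ?_⟩
  rw [← comp_fib_apply, t.w, hx]

/-- Each point gives its own arrow out of `j` after which the values agree. A common target makes
these arrows parallel, and coequalising the countable family gives one arrow that serves all points.
-/
theorem exists_eq_of_isColimit {j : J} (x y : ∀ i, ((F.obj j).fib (a i)).V)
    (h : ∀ i, ((t.ι.app j).fib (a i)).hom (x i) = ((t.ι.app j).fib (a i)).hom (y i)) :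
    ∃ j', ∃ v : j ⟶ j', ∀ i, ((F.map v).fib (a i)).hom (x i) = ((F.map v).fib (a i)).hom (y i) := by
  have := isFiltered_of_isCardinalFiltered J (Cardinal.aleph.{0} 1)
  have h1 : ∀ i, ∃ j', ∃ v : j ⟶ j',
      ((F.map v).fib (a i)).hom (x i) = ((F.map v).fib (a i)).hom (y i) := fun i =>
    (Types.FilteredColimit.isColimit_eq_iff' (nonempty_isColimit_elems ht (a i)).some
      (x i) (y i)).1 (h i)
  choose j' v hv using h1
  have hι := hasCardinalLT_aleph_one ι
  have hι' := hasCardinalLT_aleph_one (Option ι)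
  let J' : Option ι → J := fun o => o.elim j j'
  let q := IsCardinalFiltered.max J' hι'
  let r : ∀ o, j ⟶ q := fun o => match o with
    | none => IsCardinalFiltered.toMax J' hι' none
    | some i => v i ≫ IsCardinalFiltered.toMax J' hι' (some i)
  have hr : ∀ o, r o ≫ IsCardinalFiltered.coeqHom r hι' = IsCardinalFiltered.toCoeq r hι' :=
    IsCardinalFiltered.coeq_condition r hι'
  refine ⟨_, IsCardinalFiltered.toCoeq r hι', fun i => ?_⟩
  have hi : IsCardinalFiltered.toCoeq r hι' = v i ≫ IsCardinalFiltered.toMax J' hι' (some i) ≫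
      IsCardinalFiltered.coeqHom r hι' := (hr (some i)).symm.trans (Category.assoc _ _ _)
  rw [hi, F.map_comp]
  simp only [comp_fib_apply, hv]

end Filtered

/-- Free objects are `ℵ₁`-presentable. -/
theorem IsFree.isCardinalPresentable {B : ShModel p} {O : Opens (SubgroupSpace p)} {j : ℕ}
    {u : (B.sectionsMod O).obj.V} (hu : IsFree B O j u) :
    IsCardinalPresentable B (Cardinal.aleph.{0} 1) := by
  refine isCardinalPresentable_of_elements _ _ fun J _ _ F t ht =>
    ⟨fun f => ?_, fun i f g hfg => ?_⟩
  · let z : ∀ a : {a // pt p a ∈ O}, (t.pt.fib a).V := fun a => (f.fib a).hom (u.1 a)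
    have hz : ∀ a : {a // pt p a ∈ O}, z a ∈ fixedPts (t.pt.fib a) j :=
      fun a => map_mem_fixedPts _ (hu.isFreeOn a).mem
    obtain ⟨j₀, x₀, hx₀⟩ := exists_lift_of_isColimit ht z
    -- The lifted values need not be fixed by `p ^ j ℤ_p`. This is one equation per point, for the
    -- generator, and so becomes true at a common later stage.
    obtain ⟨j₁, v₁, hv₁⟩ := exists_eq_of_isColimit ht
      (fun a : {a // pt p a ∈ O} => ((F.obj j₀).fib a).ρ (gen p j) (x₀ a)) x₀ fun a => by
        rw [Rep.hom_comm_apply, hx₀]; exact hz a _ (gen_mem_level j)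
    obtain ⟨x₁, hx₁, hf₁⟩ : ∃ x₁ : ∀ a : {a // pt p a ∈ O}, ((F.obj j₁).fib a).V,
        (∀ a : {a // pt p a ∈ O}, ((t.ι.app j₁).fib a).hom (x₁ a) = z a) ∧
          ∀ a : {a // pt p a ∈ O}, x₁ a ∈ fixedPts ((F.obj j₁).fib a) j := by
      refine ⟨fun a => ((F.map v₁).fib a).hom (x₀ a), fun a => ?_, fun a => ?_⟩
      · rw [← comp_fib_apply, t.w, hx₀]
      · obtain ⟨m, hm⟩ := (F.obj j₁).fib_discrete a (((F.map v₁).fib a).hom (x₀ a))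
        refine mem_fixedPts_of_gen hm ?_
        rw [← Rep.hom_comm_apply]
        exact hv₁ a
    -- The lifted values need not satisfy the tail condition. A sequence `s` representing the image
    -- of the value at infinity agrees with them, in the colimit, from some index on; these are
    -- countably many equations and hold at a stage `j₂`.
    have h2 : ∃ j₂, ∃ v₂ : j₁ ⟶ j₂, ∀ (n : ℕ) (h : S p n ≤ O),
        (F.obj j₂).str.hom (((F.map v₂).fib none).hom (x₁ ⟨none, h (mem_S_none n)⟩)) =
          (tails.germ (F.obj j₂).fin n).hom
            (fun k => ((F.map v₂).fib (some k.1)).hom (x₁ ⟨some k.1, h (mem_S_some.2 k.2)⟩)) := by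
      by_cases ha : pt p none ∈ O
      · obtain ⟨n₀, hn₀⟩ := exists_S_le ha
        obtain ⟨n, s, hs⟩ := tails.exists_germ ((F.obj j₁).str.hom (x₁ ⟨none, ha⟩))
        have hstr : ∀ {M N : ShModel p} (g : M ⟶ N) (y : M.inf.V),
            (tails.map g.fin).hom (M.str.hom y) = N.str.hom ((g.fib none).hom y) :=
          fun g y => congrArg (fun l => l.hom y) g.comm
        have h3 := (congrArg (tails.map (t.ι.app j₁).fin).hom hs).trans
          ((hstr (t.ι.app j₁) (x₁ ⟨none, ha⟩)).trans (congrArg t.pt.str.hom (hx₁ ⟨none, ha⟩)))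
        have h4 : t.pt.str.hom (z ⟨none, ha⟩) = (tails.germ t.pt.fin n₀).hom
            fun k => z ⟨some k.1, hn₀ (mem_S_some.2 k.2)⟩ :=
          (sectionsMap f O |>.hom.hom u).2.1 n₀ hn₀
        have h5 := (tails.map_germ (t.ι.app j₁).fin n s).symm.trans (h3.trans h4)
        obtain ⟨m, hm, hm₀, h6⟩ := tails.exists_of_germ_eq h5
        obtain ⟨j₂, v₂, hv₂⟩ := exists_eq_of_isColimit ht (j := j₁)
          (a := fun k : {k // m ≤ k} => some k.1) (fun k => s ⟨k.1, hm.trans k.2⟩)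
          (fun k => x₁ ⟨some k.1, hn₀ (mem_S_some.2 (hm₀.trans k.2))⟩) fun k =>
            (h6 k.1 k.2).trans (hx₁ _).symm
        refine ⟨j₂, v₂, fun n' hn' => ?_⟩
        have h7 := (hstr (F.map v₂) (x₁ ⟨none, ha⟩)).symm.trans
          ((congrArg (tails.map (F.map v₂).fin).hom hs.symm).trans (tails.map_germ _ n s))
        refine h7.trans ((tails.germ_trunc (hm.trans (le_max_left m n')) _).symm.trans
          (Eq.trans ?_ (tails.germ_trunc (le_max_right m n') _)))
        exact congrArg (tails.germ (F.obj j₂).fin (max m n')).hom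
          (funext fun k => hv₂ ⟨k.1, (le_max_left m n').trans k.2⟩)
      · exact ⟨j₁, 𝟙 _, fun n h => absurd (h (mem_S_none n)) ha⟩
    obtain ⟨j₂, v₂, hv₂⟩ := h2
    have hf₂ := fun a : {a // pt p a ∈ O} => map_mem_fixedPts ((F.map v₂).fib a.1) (hf₁ a)
    obtain ⟨g, hg⟩ := hu.exists_hom (N := F.obj j₂)
      (s := ⟨fun a => ((F.map v₂).fib a).hom (x₁ a), hv₂,
        j, fun g hg => funext fun a => hf₂ a g hg⟩) hf₂
    refine ⟨j₂, g, hu.hom_ext fun a => ?_⟩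
    rw [comp_fib_apply, hg, ← comp_fib_apply, t.w, hx₁]
  · obtain ⟨k, v, hv⟩ := exists_eq_of_isColimit ht (a := fun a : {a // pt p a ∈ O} => a.1)
      (fun a => (f.fib a).hom (u.1 a)) (fun a => (g.fib a).hom (u.1 a)) fun a => by
        rw [← comp_fib_apply, hfg, comp_fib_apply]
    refine ⟨k, v, hu.hom_ext fun a => ?_⟩
    rw [comp_fib_apply, comp_fib_apply]
    exact hv a

end ShModel

/-! ### The free objects -/

namespace ShModel

/-- The inclusion of constant sequences in `∏_{k ≥ n} ∏_{P k} V`. -/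
def constSeq (V : ZpRep p) (P : ℕ → Prop) (n : ℕ) :
    V ⟶ seqFrom (fun k => piRep fun _ : PLift (P k) => V) n :=
  homOf (LinearMap.pi fun _ => LinearMap.pi fun _ => LinearMap.id) fun _ _ => rfl

theorem germ_constSeq (V : ZpRep p) (P : ℕ → Prop) (m n : ℕ) (v : V.V) :
    (tails.germ (fun k => piRep fun _ : PLift (P k) => V) m).hom ((constSeq V P m).hom v) =
      (tails.germ (fun k => piRep fun _ : PLift (P k) => V) n).hom ((constSeq V P n).hom v) :=
  (tails.germ_trunc (le_max_left m n) ((constSeq V P m).hom v)).symm.trans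
    (tails.germ_trunc (le_max_right m n) ((constSeq V P n).hom v))

open Classical in
/-- The object that is free on a section over `O` fixed by `p ^ j ℤ_p`. -/
def free (O : Opens (SubgroupSpace p)) (j : ℕ) : ShModel p where
  fin k := piRep fun _ : PLift (pt p (some k) ∈ O) => permRep p j
  fin_discrete _ v := ⟨j, fun g hg => funext fun h => permRep_fixed j (v h) g hg⟩
  inf := piRep fun _ : PLift (pt p none ∈ O) => permRep p j
  inf_discrete v := ⟨j, fun g hg => funext fun h => permRep_fixed j (v h) g hg⟩
  str := if h : pt p none ∈ O then (homOf (LinearMap.proj ⟨h⟩) fun _ _ => rfl) ≫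
    constSeq (permRep p j) (fun k => pt p (some k) ∈ O) 0 ≫ tails.germ _ 0 else 0

/-- The generator of the free object at a point. -/
def freeGen (O : Opens (SubgroupSpace p)) (j : ℕ) : ∀ a, ((free O j).fib a).V
  | none => fun _ => permGen p j
  | some _ => fun _ => permGen p j

theorem isFreeOn_freeGen {O : Opens (SubgroupSpace p)} (j : ℕ) :
    ∀ a, pt p a ∈ O → IsFreeOn ((free O j).fib a) j (freeGen O j a)
  | none, h => isFreeOn_piRep h (isFreeOn_permRep j)
  | some _, h => isFreeOn_piRep h (isFreeOn_permRep j)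

/-- The universal section of the free object. -/
def freeSection (O : Opens (SubgroupSpace p)) (j : ℕ) : ((free O j).sectionsMod O).obj.V :=
  ⟨fun a => freeGen O j a, fun n h => by
    have h1 : (free O j).str = (homOf (LinearMap.proj ⟨h (mem_S_none n)⟩) fun _ _ => rfl) ≫
        constSeq (permRep p j) (fun k => pt p (some k) ∈ O) 0 ≫ tails.germ _ 0 :=
      dif_pos (h (mem_S_none n))
    rw [h1]
    exact germ_constSeq (permRep p j) (fun k => pt p (some k) ∈ O) 0 n (permGen p j),
    j, fun g hg => funext fun a => (isFreeOn_freeGen j a.1 a.2).mem g hg⟩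

theorem isFree_free (O : Opens (SubgroupSpace p)) (j : ℕ) :
    IsFree (free O j) O j (freeSection O j) where
  isFreeOn a := isFreeOn_freeGen j a.1 a.2
  eq_zero a ha v := by
    cases a with
    | none => exact funext fun h => absurd h.down ha
    | some k => exact funext fun h => absurd h.down ha

/-- The generator of `A(n)` at a point. -/
def aGen (p : ℕ) [Fact p.Prime] (n : ℕ) : ∀ a, (((algToSh p).obj (AlgModel.A p n)).fib a).V
  | none => permGen p n
  | some _ => fun _ => permGen p n

theorem isFreeOn_aGen (n : ℕ) : ∀ a, pt p a ∈ S p n →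
    IsFreeOn (((algToSh p).obj (AlgModel.A p n)).fib a) n (aGen p n a)
  | none, _ => isFreeOn_permRep n
  | some _, h => isFreeOn_piRep (mem_S_some.1 h) (isFreeOn_permRep n)

/-- The universal section of `A(n)`. -/
def aSection (p : ℕ) [Fact p.Prime] (n : ℕ) :
    (((algToSh p).obj (AlgModel.A p n)).sectionsMod (S p n)).obj.V :=
  ⟨fun a => aGen p n a, fun m _ =>
      germ_constSeq (permRep p n) (fun k => n ≤ k) n m (permGen p n),
    n, fun g hg => funext fun a => (isFreeOn_aGen n a.1 a.2).mem g hg⟩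

/-- The level of fixedness and the index of the open set are both `n`. Maps from `U A(n)` to a sheaf
`N` are therefore the vectors of `N(S_n)` fixed by `p ^ n ℤ_p`. -/
theorem isFree_A (n : ℕ) :
    IsFree ((algToSh p).obj (AlgModel.A p n)) (S p n) n (aSection p n) where
  isFreeOn a := isFreeOn_aGen n a.1 a.2
  eq_zero a ha v := by
    cases a with
    | none => exact absurd (mem_S_none n) ha
    | some k => exact funext fun h => absurd (mem_S_some.2 h.down) ha

end ShModel

open ShModel

namespace SheafModel

/-- A sheaf is free on a section `u` over `O` fixed by `p ^ j ℤ_p`. -/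
structure IsFree (X : SheafModel p) (O : Opens (SubgroupSpace p)) (j : ℕ) (u : (X.val O).V) :
    Prop where
  mem : u ∈ fixedPts (X.val O) j
  exists_hom : ∀ {N : SheafModel p} {v : (N.val O).V}, v ∈ fixedPts (N.val O) j →
    ∃ f : X ⟶ N, (app f O).hom u = v
  hom_ext : ∀ {N : SheafModel p} {f g : X ⟶ N}, (app f O).hom u = (app g O).hom u → f = g

/-- The target sheaf is isomorphic to the sheaf of sections of its stalks, and `sheafFunctor` is
full and faithful, so freeness passes from stalk data to sheaves. -/
theorem _root_.PadicModel.ShModel.IsFree.isFree {B : ShModel p} {O : Opens (SubgroupSpace p)}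
    {j : ℕ} {u : (B.sectionsMod O).obj.V} (hu : ShModel.IsFree B O j u) :
    IsFree ((sheafFunctor p).obj B) O j u where
  mem := hu.mem
  exists_hom := fun {N v} hv => by
    have h1 := map_mem_fixedPts (N.toSections O).hom hv
    obtain ⟨f, hf⟩ := hu.exists_hom (sections_fixed_iff.1 h1)
    have h2 : (sheafFunctor p).map f ≫ inv N.toSheafStalks ≫ N.toSheafStalks =
        (sheafFunctor p).map f := by rw [IsIso.inv_hom_id, Category.comp_id]
    refine ⟨(sheafFunctor p).map f ≫ inv N.toSheafStalks, (N.toSections_bijective O).1 ?_⟩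
    refine (congrArg (fun l => (app l O).hom u) ((Category.assoc _ _ _).trans h2)).trans ?_
    exact Subtype.ext (funext hf)
  hom_ext := fun {N f g} h => by
    obtain ⟨f', hf'⟩ := (sheafFunctor p).map_surjective (f ≫ N.toSheafStalks)
    obtain ⟨g', hg'⟩ := (sheafFunctor p).map_surjective (g ≫ N.toSheafStalks)
    rw [← cancel_mono N.toSheafStalks, ← hf', ← hg']
    refine congrArg _ (hu.hom_ext fun a => ?_)
    have h1 := congrArg (N.toSections O).hom.hom h
    have h2 := congrArg (fun l => (app l O).hom u) hf'
    have h3 := congrArg (fun l => (app l O).hom u) hg'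
    exact congrFun (congrArg Subtype.val (h2.trans (h1.trans h3.symm))) a

/-- The sheaf that is free on a section over `O` fixed by `p ^ j ℤ_p`. -/
def free (p : ℕ) [Fact p.Prime] (x : Opens (SubgroupSpace p) × ℕ) : SheafModel p :=
  (sheafFunctor p).obj (ShModel.free x.1 x.2)

theorem isFree_free (x : Opens (SubgroupSpace p) × ℕ) :
    IsFree (free p x) x.1 x.2 (freeSection x.1 x.2) := (ShModel.isFree_free x.1 x.2).isFree

instance (x : Opens (SubgroupSpace p) × ℕ) :
    IsCardinalPresentable (free p x) (Cardinal.aleph.{0} 1) :=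
  have := (ShModel.isFree_free x.1 x.2).isCardinalPresentable
  isCardinalPresentable_of_isEquivalence _ _ (sheafFunctor p)

theorem isFree_UA (n : ℕ) : IsFree ((U p).obj (AlgModel.A p n)) (S p n) n (aSection p n) :=
  (ShModel.isFree_A n).isFree

instance (n : ℕ) : IsCardinalPresentable ((U p).obj (AlgModel.A p n)) (Cardinal.aleph.{0} 1) :=
  have := (ShModel.isFree_A (p := p) n).isCardinalPresentable
  isCardinalPresentable_of_isEquivalence ((algToSh p).obj (AlgModel.A p n)) _ (sheafFunctor p)

/-! ### The levelwise model structure -/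

section Level

variable {K L : DgSheaf p} (f : K ⟶ L)

/-- Surjectivity on fixed sections. -/
theorem surjective_comp_iff {X : SheafModel p} {O : Opens (SubgroupSpace p)} {j : ℕ}
    {u : (X.val O).V} (hu : IsFree X O j u) {M N : SheafModel p} (g : M ⟶ N) :
    (Function.Surjective fun x : X ⟶ M => x ≫ g) ↔
      ∀ y ∈ fixedPts (N.val O) j, ∃ x ∈ fixedPts (M.val O) j, (app g O).hom x = y := by
  constructor
  · intro h y hy
    obtain ⟨y', rfl⟩ := hu.exists_hom hy
    obtain ⟨x, rfl⟩ := h y'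
    exact ⟨_, map_mem_fixedPts (app x O) hu.mem, rfl⟩
  · intro h y
    obtain ⟨x, hx, hxy⟩ := h _ (map_mem_fixedPts (app y O) hu.mem)
    obtain ⟨x', rfl⟩ := hu.exists_hom hx
    exact ⟨x', hu.hom_ext hxy⟩

/-- Homology isomorphisms on fixed sections. -/
theorem quasiIso_iff {X : SheafModel p} {O : Opens (SubgroupSpace p)} {j : ℕ}
    {u : (X.val O).V} (hu : IsFree X O j u) :
    QuasiIso (((preadditiveCoyoneda.obj (op X)).mapHomologicalComplex _).map f) ↔ ∀ i,
      (∀ x ∈ fixedPts ((K.X i).val O) j, (app (K.d i (i - 1)) O).hom x = 0 →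
        ∀ y ∈ fixedPts ((L.X (i + 1)).val O) j,
          (app (f.f i) O).hom x = (app (L.d (i + 1) i) O).hom y →
            ∃ z ∈ fixedPts ((K.X (i + 1)).val O) j, (app (K.d (i + 1) i) O).hom z = x) ∧
      (∀ y ∈ fixedPts ((L.X i).val O) j, (app (L.d i (i - 1)) O).hom y = 0 →
        ∃ x ∈ fixedPts ((K.X i).val O) j, (app (K.d i (i - 1)) O).hom x = 0 ∧
          ∃ w ∈ fixedPts ((L.X (i + 1)).val O) j,
            y = (app (f.f i) O).hom x + (app (L.d (i + 1) i) O).hom w) := by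
  rw [quasiIso_coyoneda_iff]
  refine forall_congr' fun i => and_congr ⟨fun h x hx hdx y hy hxy => ?_, fun h x hdx y hxy => ?_⟩
    ⟨fun h y hy hdy => ?_, fun h y hdy => ?_⟩
  · obtain ⟨x, rfl⟩ := hu.exists_hom hx
    obtain ⟨y, rfl⟩ := hu.exists_hom hy
    obtain ⟨z, rfl⟩ := h x (hu.hom_ext hdx) y (hu.hom_ext hxy)
    exact ⟨_, map_mem_fixedPts (app z O) hu.mem, rfl⟩
  · obtain ⟨z, hz, hzx⟩ := h _ (map_mem_fixedPts (app x O) hu.mem)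
      (congrArg (fun l => (app l O).hom u) hdx) _ (map_mem_fixedPts (app y O) hu.mem)
      (congrArg (fun l => (app l O).hom u) hxy)
    obtain ⟨z, rfl⟩ := hu.exists_hom hz
    exact ⟨z, hu.hom_ext hzx⟩
  · obtain ⟨y, rfl⟩ := hu.exists_hom hy
    obtain ⟨x, hx, w, rfl⟩ := h y (hu.hom_ext hdy)
    exact ⟨_, map_mem_fixedPts (app x O) hu.mem, congrArg (fun l => (app l O).hom u) hx,
      _, map_mem_fixedPts (app w O) hu.mem, rfl⟩
  · obtain ⟨x, hx, hdx, w, hw, hy⟩ := h _ (map_mem_fixedPts (app y O) hu.mem)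
      (congrArg (fun l => (app l O).hom u) hdy)
    obtain ⟨x, rfl⟩ := hu.exists_hom hx
    obtain ⟨w, rfl⟩ := hu.exists_hom hw
    exact ⟨x, hu.hom_ext hdx, w, hu.hom_ext hy⟩

theorem val_discrete (N : SheafModel p) (O : Opens (SubgroupSpace p)) : isDiscrete p (N.val O) :=
  (N.obj.obj (op O)).property

end Level

end SheafModel

/-! ### Levelwise fibrations and equivalences tested by free sheaves -/

open SheafModel

/-- Every section is fixed at some level, so the free sheaves see all sections. In the other
direction, averaging turns a lift of a fixed section into a fixed lift. -/
theorem levelFib_eq : levelFib p = fibOf (SheafModel.free p) := by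
  ext K L f
  constructor
  · intro h x i
    refine (surjective_comp_iff (SheafModel.isFree_free x) _).2 fun y hy => ?_
    obtain ⟨z, rfl⟩ := h x.1 i y
    exact exists_fixed_lift _ (val_discrete _ _) hy
  · intro h O i y
    obtain ⟨j, hj⟩ := val_discrete _ _ y
    obtain ⟨x, -, hx⟩ := (surjective_comp_iff (SheafModel.isFree_free (O, j)) _).1 (h (O, j) i) y hj
    exact ⟨x, hx⟩

theorem levelWe_iff {K L : DgSheaf p} (f : K ⟶ L) : levelWe p f ↔ ∀ O i,
    (∀ x : ((K.X i).val O).V, (app (K.d i (i - 1)) O).hom x = 0 → ∀ y : ((L.X (i + 1)).val O).V,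
        (app (f.f i) O).hom x = (app (L.d (i + 1) i) O).hom y →
          ∃ z : ((K.X (i + 1)).val O).V, (app (K.d (i + 1) i) O).hom z = x) ∧
    (∀ y : ((L.X i).val O).V, (app (L.d i (i - 1)) O).hom y = 0 →
      ∃ x : ((K.X i).val O).V, (app (K.d i (i - 1)) O).hom x = 0 ∧
        ∃ w : ((L.X (i + 1)).val O).V,
          y = (app (f.f i) O).hom x + (app (L.d (i + 1) i) O).hom w) :=
  forall_congr' fun O => quasiIso_rep_iff (((sectionsFunctor p O).mapHomologicalComplex _).map f)

/-- Averaging makes passage to fixed sections exact. Conversely, any instance of the homology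
condition involves finitely many sections, and these are fixed at a common level. -/
theorem levelWe_eq : levelWe p = weOf (SheafModel.free p) := by
  ext K L f
  rw [levelWe_iff]
  constructor
  · rintro h ⟨O, j⟩
    refine (quasiIso_iff f (SheafModel.isFree_free (O, j))).2 fun i =>
      ⟨fun x hx hdx y hy hxy => ?_, fun y hy hdy => ?_⟩
    · obtain ⟨z, hz⟩ := (h O i).1 x hdx y hxy
      obtain ⟨z', hz', h'⟩ := exists_fixed_lift (app (K.d (i + 1) i) O) (val_discrete _ _)
        (v := z) (n := j) (hz ▸ hx)
      exact ⟨z', hz', h'.trans hz⟩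
    · obtain ⟨x, hx, w, hw⟩ := (h O i).2 y hdy
      exact exists_fixed_add _ _ _ (val_discrete _ _) (val_discrete _ _) hy hx hw
  · intro h O i
    refine ⟨fun x hdx y hxy => ?_, fun y hdy => ?_⟩
    · obtain ⟨m₁, hm₁⟩ := val_discrete (K.X i) O x
      obtain ⟨m₂, hm₂⟩ := val_discrete (L.X (i + 1)) O y
      obtain ⟨z, -, hz⟩ := ((quasiIso_iff f (SheafModel.isFree_free (O, max m₁ m₂))).1 (h _) i).1 x
        (fixedPts_mono _ (le_max_left _ _) hm₁) hdx y (fixedPts_mono _ (le_max_right _ _) hm₂) hxy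
      exact ⟨z, hz⟩
    · obtain ⟨m, hm⟩ := val_discrete (L.X i) O y
      obtain ⟨x, -, hx, w, -, hw⟩ :=
        ((quasiIso_iff f (SheafModel.isFree_free (O, m))).1 (h _) i).2 y hm hdy
      exact ⟨x, hx, w, hw⟩

/-- The objects `U A(n)`. -/
abbrev UA (p : ℕ) [Fact p.Prime] (n : ℕ) : SheafModel p := (U p).obj (AlgModel.A p n)

/-- `UA p n` and the free sheaf at `(S p n, n)` are free on the same kind of section, so they impose
the same condition. -/
theorem fibOf_free_le : fibOf (SheafModel.free p) ≤ fibOf (UA p) := by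
  intro K L f h n i
  exact (surjective_comp_iff (isFree_UA n) _).2
    ((surjective_comp_iff (SheafModel.isFree_free (S p n, n)) _).1 (h (S p n, n) i))

theorem cellWe_eq : cellWe p = weOf (UA p) := rfl

theorem levelWe_le_cellWe : levelWe p ≤ cellWe p := by
  intro K L f h n
  rw [levelWe_eq] at h
  exact (quasiIso_iff f (isFree_UA n)).2
    ((quasiIso_iff f (SheafModel.isFree_free (S p n, n))).1 (h (S p n, n)))

instance : HasZeroObject (SheafModel p) := hasZeroObject_of_hasTerminal_object

theorem isModel_levelData : (levelData p).IsModel := by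
  rw [levelData, levelFib_eq, levelWe_eq]
  exact isModel_ofFibWe _ _ (Cardinal.aleph.{0} 1) (fun _ => inferInstance) le_rfl

/-- Here the two test families differ: all free sheaves for the fibrations, and only the `UA p n`
for the weak equivalences. -/
theorem isModel_cellularisation : (cellularisation p).IsModel := by
  rw [cellularisation, levelFib_eq, cellWe_eq]
  exact isModel_ofFibWe _ _ (Cardinal.aleph.{0} 1) (fun _ => inferInstance) fibOf_free_le

theorem isModel_ofFibWe_UA : (ModelData.ofFibWe (fibOf (UA p)) (weOf (UA p))).IsModel :=
  isModel_ofFibWe _ _ (Cardinal.aleph.{0} 1) (fun _ => inferInstance) le_rfl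

/-! ### The adjunction -/

open ShModel SheafModel

/-- The projection from `(R N)_∞` to the stalk. -/
def rInfFst (N : SheafModel p) : N.rInf ⟶ N.stalk :=
  homOf (LinearMap.fst ℚ _ _ ∘ₗ N.rInfSpace.subtype) fun _ _ => rfl

/-- The inclusion of `R N` in the stalks of `N`. -/
def rIncl (N : SheafModel p) : (algToSh p).obj ((R p).obj N) ⟶ (stalksFunctor p).obj N where
  fin k := fixedRep.incl (N.fin k) k
  inf := rInfFst N
  comm := rep_ext fun x => (mem_rInfSpace.1 x.2).symm

theorem rIncl_naturality {M N : SheafModel p} (f : M ⟶ N) :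
    (algToSh p).map ((R p).map f) ≫ rIncl N = rIncl M ≫ (stalksFunctor p).map f :=
  ShModel.hom_ext (fun _ => rfl) rfl

/-- Lifts along the inclusion of `R N` in the stalks of `N`. -/
def rLift {M : AlgModel p} {N : SheafModel p}
    (g : (algToSh p).obj M ⟶ (stalksFunctor p).obj N) : M ⟶ (R p).obj N :=
  let fin : ∀ k, M.fin k ⟶ N.rFin k := fun k =>
    homOf ((g.fin k).hom.toLinearMap.codRestrict (fixedPts (N.fin k) k) fun v =>
      map_mem_fixedPts (g.fin k) (M.fin_fixed k v))
      fun a v => Subtype.ext (Rep.hom_comm_apply (g.fin k) a v)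
  have h : tails.map fin ≫ N.rTails = tails.map g.fin := (tails.map_comp _ _).symm
  { fin := fin
    inf := homOf ((g.inf.hom.toLinearMap.prod (M.str ≫ tails.map fin).hom.toLinearMap).codRestrict
        N.rInfSpace fun v => by
          have h1 := congrArg (fun l => l.hom v) g.comm
          have h2 := congrArg (fun l => l.hom (M.str.hom v)) h
          exact h1.symm.trans h2.symm)
      fun a v => Subtype.ext (Prod.ext (Rep.hom_comm_apply g.inf a v)
        (Rep.hom_comm_apply (M.str ≫ tails.map fin) a v))
    comm := rfl }

theorem rLift_comp {M : AlgModel p} {N : SheafModel p}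
    (g : (algToSh p).obj M ⟶ (stalksFunctor p).obj N) :
    (algToSh p).map (rLift g) ≫ rIncl N = g :=
  ShModel.hom_ext (fun _ => rfl) rfl

/-- In the pullback defining `(R N)_∞`, the coordinate in the tails of fixed points is determined by
the stalk coordinate, since `rTails` is injective. -/
theorem rIncl_hom_ext {M : AlgModel p} {N : SheafModel p} {f g : M ⟶ (R p).obj N}
    (h : (algToSh p).map f ≫ rIncl N = (algToSh p).map g ≫ rIncl N) : f = g := by
  refine AlgModel.hom_ext (fun k => rep_ext fun v => ?_) (rep_ext fun v => ?_)
  · exact Subtype.ext (congrArg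
      (fun l : (algToSh p).obj M ⟶ (stalksFunctor p).obj N => (l.fin k).hom v) h)
  · have h1 : (f.inf.hom v).1.1 = (g.inf.hom v).1.1 :=
      congrArg (fun l : (algToSh p).obj M ⟶ (stalksFunctor p).obj N => l.inf.hom v) h
    refine Subtype.ext (Prod.ext h1 (N.rTails_injective ?_))
    exact (mem_rInfSpace.1 (f.inf.hom v).2).symm.trans
      ((congrArg N.toTails.hom h1).trans (mem_rInfSpace.1 (g.inf.hom v).2))

/-- Morphisms from an object of the algebraic model to the stalks of a sheaf. -/
def rEquiv (M : AlgModel p) (N : SheafModel p) :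
    (M ⟶ (R p).obj N) ≃ ((algToSh p).obj M ⟶ (stalksFunctor p).obj N) where
  toFun f := (algToSh p).map f ≫ rIncl N
  invFun g := rLift g
  left_inv _ := rIncl_hom_ext (rLift_comp _)
  right_inv g := rLift_comp g

/-- The adjunction between `U` and `R`. -/
def adjUR (p : ℕ) [Fact p.Prime] : U p ⊣ R p :=
  -- The adjunction is assembled from the equivalence with stalk data and the universal property of
  -- `rIncl`: maps from an object of the algebraic model to the stalks of `N` factor uniquely
  -- through `R N`.
  let e : sheafFunctor p ⊣ stalksFunctor p := (sheafEquivalence p).toAdjunction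
  Adjunction.mkOfHomEquiv
    { homEquiv := fun M N => (e.homEquiv ((algToSh p).obj M) N).trans (rEquiv M N).symm
      homEquiv_naturality_left_symm := fun {M' M N} f g => by
        have h1 : rEquiv M' N (f ≫ g) = (algToSh p).map f ≫ rEquiv M N g := by
          change (algToSh p).map (f ≫ g) ≫ rIncl N = _ ≫ _ ≫ _
          rw [Functor.map_comp, Category.assoc]
        exact (congrArg (e.homEquiv _ N).symm h1).trans (e.homEquiv_naturality_left_symm _ _)
      homEquiv_naturality_right := fun {M N N'} f g => by
        have h1 : ∀ h : M ⟶ (R p).obj N,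
            rEquiv M N' (h ≫ (R p).map g) = rEquiv M N h ≫ (stalksFunctor p).map g := fun h => by
          change (algToSh p).map (h ≫ (R p).map g) ≫ rIncl N' = (_ ≫ rIncl N) ≫ _
          rw [Functor.map_comp, Category.assoc, Category.assoc, rIncl_naturality]
        have h2 := fun f' : (sheafFunctor p).obj ((algToSh p).obj M) ⟶ N =>
          e.homEquiv_naturality_right f' g
        refine (rEquiv M N').symm_apply_eq.2 ((h2 f).trans ((h1 _).trans ?_).symm)
        exact congrArg (· ≫ (stalksFunctor p).map g) ((rEquiv M N).apply_symm_apply _) }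

/-! ### The algebraic model as a coreflective subcategory of sheaves -/

instance : (U p).Full := Functor.Full.of_iso (uIso p)

instance : (U p).Faithful := Functor.Faithful.of_iso (uIso p)

instance : Coreflective (U p) where
  R := R p
  adj := adjUR p

instance : HasColimits (AlgModel p) := hasColimits_of_coreflective (U p)

instance : HasFiniteLimits (AlgModel p) := ⟨fun _ _ _ => hasLimitsOfShape_of_coreflective (U p)⟩

instance : (U p).Additive where
  map_add {M N f g} := by
    apply CategoryTheory.Sheaf.hom_ext
    ext O : 2
    refine ObjectProperty.hom_ext _ (rep_ext fun s => Subtype.ext (funext fun ⟨a, _⟩ => ?_))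
    cases a <;> rfl

instance : (R p).Additive := (adjUR p).right_adjoint_additive

/-- As a full and faithful left adjoint, `U` preserves the colimit, and both factorisations and
equalities of maps can be pulled back along it. -/
instance (n : ℕ) : IsCardinalPresentable (AlgModel.A p n) (Cardinal.aleph.{0} 1) := by
  refine isCardinalPresentable_of_elements _ _ fun J _ _ F t ht => ?_
  have hF : PreservesColimitsOfSize.{0, 0} (U p) := (adjUR p).leftAdjoint_preservesColimits
  have hU := isColimitOfPreserves (U p) ht
  have hc : IsCardinalPresentable ((U p).obj (AlgModel.A p n)) (Cardinal.aleph.{0} 1) :=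
    inferInstance
  refine ⟨fun f => ?_, fun j f g hfg => ?_⟩
  · obtain ⟨j, g, hg⟩ := IsCardinalPresentable.exists_hom_of_isColimit
      (Cardinal.aleph.{0} 1) hU ((U p).map f)
    obtain ⟨g, rfl⟩ := (U p).map_surjective g
    exact ⟨j, g, (U p).map_injective (((U p).map_comp _ _).trans hg)⟩
  · obtain ⟨k, v, hv⟩ := IsCardinalPresentable.exists_eq_of_isColimit'
      (Cardinal.aleph.{0} 1) hU ((U p).map f) ((U p).map g) (by
        have h1 := congrArg (U p).map hfg
        rw [Functor.map_comp, Functor.map_comp] at h1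
        exact h1)
    refine ⟨k, v, (U p).map_injective ?_⟩
    rw [Functor.map_comp, Functor.map_comp]
    exact hv

/-! ### Adjunctions on complexes -/

section Dg

variable {C D : Type*} [Category* C] [Category* D] [Preadditive C] [Preadditive D]
  {F : C ⥤ D} {G : D ⥤ C} [F.PreservesZeroMorphisms] [G.PreservesZeroMorphisms]
  {ι : Type*} (c : ComplexShape ι)

/-- The degreewise adjunction on complexes. -/
def _root_.CategoryTheory.Adjunction.mapComplex (adj : F ⊣ G) :
    F.mapHomologicalComplex c ⊣ G.mapHomologicalComplex c where
  unit :=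
    { app := fun X =>
        { f := fun i => adj.unit.app (X.X i)
          comm' := fun i j _ => (adj.unit.naturality (X.d i j)).symm }
      naturality := fun _ _ f => HomologicalComplex.hom_ext _ _ fun i =>
        adj.unit.naturality (f.f i) }
  counit :=
    { app := fun X =>
        { f := fun i => adj.counit.app (X.X i)
          comm' := fun i j _ => (adj.counit.naturality (X.d i j)).symm }
      naturality := fun _ _ f => HomologicalComplex.hom_ext _ _ fun i =>
        adj.counit.naturality (f.f i) }
  left_triangle_components X := HomologicalComplex.hom_ext _ _ fun i =>
    adj.left_triangle_components (X.X i)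
  right_triangle_components X := HomologicalComplex.hom_ext _ _ fun i =>
    adj.right_triangle_components (X.X i)

end Dg

/-- The adjunction between `U` and `R` on differential graded objects. -/
def dgAdjUR (p : ℕ) [Fact p.Prime] : dgU p ⊣ dgR p := (adjUR p).mapComplex _

theorem dgAdjUR_unit (X : DgAlg p) (i : ℤ) :
    ((dgAdjUR p).unit.app X).f i = (adjUR p).unit.app (X.X i) := rfl

/-! ### Sections near the trivial group -/

namespace ShModel

theorem nbhdSection_mem (M : ShModel p) {m j : ℕ} (v : M.inf.V)
    (s : ∀ k : {k // m ≤ k}, (M.fin k.1).V) (h : M.str.hom v = (tails.germ M.fin m).hom s)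
    (hv : v ∈ fixedPts M.inf j) (hs : ∀ k : {k // m ≤ k}, s k ∈ fixedPts (M.fin k.1) j) :
    M.nbhdSection v s h hv hs ∈ fixedPts (M.sectionsMod (S p m)).obj j :=
  sections_fixed_iff.2 fun ⟨a, ha⟩ => by
    cases a with
    | none => exact hv
    | some k => exact hs ⟨k, mem_S_some.1 ha⟩

/-- Sections over `S_n` with prescribed values at infinity and prescribed properties at the other
points can be constructed if the property holds eventually, and can be satisfied everywhere. -/
theorem exists_sections {M M' : ShModel p} {n : ℕ} {v : M.inf.V} {v' : M'.inf.V}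
    (hv : v ∈ fixedPts M.inf n) (hv' : v' ∈ fixedPts M'.inf n)
    (P : ∀ k, (M.fin k).V → (M'.fin k).V → Prop)
    (h₁ : ∀ k, n ≤ k → ∃ z ∈ fixedPts (M.fin k) n, ∃ z' ∈ fixedPts (M'.fin k) n, P k z z')
    (h₂ : ∀ m (s : ∀ k : {k // m ≤ k}, (M.fin k.1).V) (s' : ∀ k : {k // m ≤ k}, (M'.fin k.1).V),
      M.str.hom v = (tails.germ M.fin m).hom s → M'.str.hom v' = (tails.germ M'.fin m).hom s' →
        ∃ m', ∃ h : m ≤ m', ∀ k (hk : m' ≤ k), P k (s ⟨k, h.trans hk⟩) (s' ⟨k, h.trans hk⟩)) :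
    ∃ x ∈ fixedPts (M.sectionsMod (S p n)).obj n, ∃ x' ∈ fixedPts (M'.sectionsMod (S p n)).obj n,
      x.1 ⟨none, mem_S_none n⟩ = v ∧ x'.1 ⟨none, mem_S_none n⟩ = v' ∧
        ∀ k (hk : n ≤ k), P k (x.1 ⟨some k, mem_S_some.2 hk⟩) (x'.1 ⟨some k, mem_S_some.2 hk⟩) := by
  classical
  obtain ⟨q₁, s₁, hs₁⟩ := tails.exists_germ (M.str.hom v)
  obtain ⟨q₂, s₂, hs₂⟩ := tails.exists_germ (M'.str.hom v')
  obtain ⟨m₁, hm₁, hf₁⟩ := tails.exists_fixed M.fin_discrete (s := s₁) (j := n)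
    (by rw [hs₁]; exact map_mem_fixedPts _ hv)
  obtain ⟨m₂, hm₂, hf₂⟩ := tails.exists_fixed M'.fin_discrete (s := s₂) (j := n)
    (by rw [hs₂]; exact map_mem_fixedPts _ hv')
  let m := max m₁ m₂
  have hq₁ : m₁ ≤ m := le_max_left _ _
  have hq₂ : m₂ ≤ m := le_max_right _ _
  have ht₁ := tails.germ_trunc (M := M.fin) (hm₁.trans hq₁) s₁
  have ht₂ := tails.germ_trunc (M := M'.fin) (hm₂.trans hq₂) s₂
  obtain ⟨m', hm', hP⟩ := h₂ m (fun k => s₁ ⟨k.1, (hm₁.trans hq₁).trans k.2⟩)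
    (fun k => s₂ ⟨k.1, (hm₂.trans hq₂).trans k.2⟩) (hs₁.symm.trans ht₁.symm)
    (hs₂.symm.trans ht₂.symm)
  choose z hz z' hz' hzz using h₁
  -- From `m'` on the representing sequences are kept, since there they are fixed and satisfy `P`.
  -- The finitely many earlier entries do not affect the class in the tails and are replaced by the
  -- pointwise choices.
  let σ : ∀ k : {k // n ≤ k}, (M.fin k.1).V := fun k =>
    if h : m' ≤ k.1 then s₁ ⟨k.1, (hm₁.trans hq₁).trans (hm'.trans h)⟩ else z k.1 k.2
  let σ' : ∀ k : {k // n ≤ k}, (M'.fin k.1).V := fun k =>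
    if h : m' ≤ k.1 then s₂ ⟨k.1, (hm₂.trans hq₂).trans (hm'.trans h)⟩ else z' k.1 k.2
  have e : ∀ (k : {k // n ≤ k}) (h : m' ≤ k.1),
      σ k = s₁ ⟨k.1, (hm₁.trans hq₁).trans (hm'.trans h)⟩ := fun k h => dif_pos h
  have e' : ∀ (k : {k // n ≤ k}) (h : m' ≤ k.1),
      σ' k = s₂ ⟨k.1, (hm₂.trans hq₂).trans (hm'.trans h)⟩ := fun k h => dif_pos h
  have hσ : M.str.hom v = (tails.germ M.fin n).hom σ := by
    refine hs₁.symm.trans ((tails.germ_trunc (((hm₁.trans hq₁).trans hm').trans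
      (le_max_right n m')) s₁).symm.trans
        (Eq.trans ?_ (tails.germ_trunc (le_max_left n m') σ)))
    refine congrArg (tails.germ M.fin (max n m')).hom (funext fun k => ?_)
    exact (e ⟨k.1, (le_max_left n m').trans k.2⟩ ((le_max_right n m').trans k.2)).symm
  have hσ' : M'.str.hom v' = (tails.germ M'.fin n).hom σ' := by
    refine hs₂.symm.trans ((tails.germ_trunc (((hm₂.trans hq₂).trans hm').trans
      (le_max_right n m')) s₂).symm.trans
        (Eq.trans ?_ (tails.germ_trunc (le_max_left n m') σ')))
    refine congrArg (tails.germ M'.fin (max n m')).hom (funext fun k => ?_)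
    exact (e' ⟨k.1, (le_max_left n m').trans k.2⟩ ((le_max_right n m').trans k.2)).symm
  have hfix : ∀ k : {k // n ≤ k}, σ k ∈ fixedPts (M.fin k.1) n ∧
      σ' k ∈ fixedPts (M'.fin k.1) n ∧ P k.1 (σ k) (σ' k) := fun k => by
    by_cases h : m' ≤ k.1
    · rw [e k h, e' k h]
      exact ⟨hf₁ _ (hq₁.trans (hm'.trans h)), hf₂ _ (hq₂.trans (hm'.trans h)), hP _ h⟩
    · have e : σ k = _ := dif_neg h
      have e' : σ' k = _ := dif_neg h
      rw [e, e']
      exact ⟨hz _ _, hz' _ _, hzz _ _⟩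
  exact ⟨M.nbhdSection v σ hσ hv fun k => (hfix k).1, nbhdSection_mem _ _ _ _ _ _,
    M'.nbhdSection v' σ' hσ' hv' fun k => (hfix k).2.1, nbhdSection_mem _ _ _ _ _ _,
    rfl, rfl, fun k hk => (hfix ⟨k, hk⟩).2.2⟩

/-- The extension by zero of a vector over `p ^ k ℤ_p` to a sequence. -/
def extSeq (M : ShModel p) {k : ℕ} (v : (M.fin k).V) : ∀ i : {i // k ≤ i}, (M.fin i.1).V :=
  Function.update 0 ⟨k, le_rfl⟩ v

theorem extSeq_self (M : ShModel p) {k : ℕ} (v : (M.fin k).V) : M.extSeq v ⟨k, le_rfl⟩ = v :=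
  Function.update_self _ _ _

theorem extSeq_of_ne (M : ShModel p) {k : ℕ} (v : (M.fin k).V) {i : {i // k ≤ i}} (h : i.1 ≠ k) :
    M.extSeq v i = 0 :=
  Function.update_of_ne (fun h' => h (congrArg Subtype.val h')) _ _

/-- The extension by zero of a vector over `p ^ k ℤ_p` to a section over `S_k`. -/
def extSection (M : ShModel p) {k : ℕ} {v : (M.fin k).V} (hv : v ∈ fixedPts (M.fin k) k) :
    (M.sectionsMod (S p k)).obj.V :=
  M.nbhdSection (m := k) (j := k) 0
    (M.extSeq v) (by
      rw [← tails.germ_trunc (Nat.le_succ k)]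
      refine (map_zero M.str.hom).trans (Eq.trans (map_zero (tails.germ M.fin (k + 1)).hom).symm
        (congrArg (tails.germ M.fin (k + 1)).hom (funext fun i => ?_)))
      have h1 : i.1 ≠ k := by
        have := i.2
        omega
      exact (M.extSeq_of_ne v (i := ⟨i.1, _⟩) h1).symm) (Submodule.zero_mem _) fun i => by
    obtain ⟨i, hi⟩ := i
    by_cases h : i = k
    · subst h
      rw [extSeq_self]
      exact hv
    · rw [M.extSeq_of_ne v h]
      exact Submodule.zero_mem _

theorem extSection_self (M : ShModel p) {k : ℕ} {v : (M.fin k).V} (hv : v ∈ fixedPts (M.fin k) k) :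
    (M.extSection hv).1 ⟨some k, mem_S_some.2 le_rfl⟩ = v := M.extSeq_self v

theorem extSection_of_ne (M : ShModel p) {k : ℕ} {v : (M.fin k).V} (hv : v ∈ fixedPts (M.fin k) k)
    {i : ℕ} (hi : pt p (some i) ∈ S p k) (h : i ≠ k) : (M.extSection hv).1 ⟨some i, hi⟩ = 0 :=
  M.extSeq_of_ne v (i := ⟨i, mem_S_some.1 hi⟩) h

theorem extSection_mem (M : ShModel p) {k : ℕ} {v : (M.fin k).V} (hv : v ∈ fixedPts (M.fin k) k) :
    M.extSection hv ∈ fixedPts (M.sectionsMod (S p k)).obj k := nbhdSection_mem _ _ _ _ _ _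

/-- Sections over `S_k` that are extended by zero agree if they agree at `p ^ k ℤ_p`. -/
theorem eq_of_ext {M : ShModel p} {k : ℕ} {x y : (M.sectionsMod (S p k)).obj.V}
    (h : x.1 ⟨some k, mem_S_some.2 le_rfl⟩ = y.1 ⟨some k, mem_S_some.2 le_rfl⟩)
    (h₀ : x.1 ⟨none, mem_S_none k⟩ = y.1 ⟨none, mem_S_none k⟩)
    (h₁ : ∀ i (hi : pt p (some i) ∈ S p k), i ≠ k → x.1 ⟨some i, hi⟩ = y.1 ⟨some i, hi⟩) :
    x = y := by
  refine Subtype.ext (funext fun ⟨a, ha⟩ => ?_)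
  cases a with
  | none => exact h₀
  | some i =>
    by_cases hi : i = k
    · subst hi
      exact h
    · exact h₁ i ha hi

/-- Restriction from `S_m` to `S_n`. -/
abbrev resS (M : ShModel p) {m n : ℕ} (h : m ≤ n) (x : (M.sectionsMod (S p m)).obj.V) :
    (M.sectionsMod (S p n)).obj.V := (M.sectionsRes (S_anti h)).hom.hom x

/-- The neighbourhood can be shrunk until its index is at least the level `j` of the section, so
that a single `q` serves both purposes and the section is seen by `A(q)`. -/
theorem exists_section_of_inf (M : ShModel p) (v : M.inf.V) :
    ∃ q, ∃ x ∈ fixedPts (M.sectionsMod (S p q)).obj q, x.1 ⟨none, mem_S_none q⟩ = v := by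
  obtain ⟨j, hj⟩ := M.inf_discrete v
  obtain ⟨n, s, hs⟩ := tails.exists_germ (M.str.hom v)
  obtain ⟨m, hm, hsm⟩ := tails.exists_fixed M.fin_discrete (s := s) (j := j)
    (by rw [hs]; exact map_mem_fixedPts _ hj)
  let x := M.nbhdSection v (fun k => s ⟨k.1, hm.trans k.2⟩)
    (hs.symm.trans (tails.germ_trunc hm s).symm) hj fun k => hsm k.1 k.2
  have hx : x ∈ fixedPts (M.sectionsMod (S p m)).obj j := nbhdSection_mem _ _ _ _ _ _
  exact ⟨max m j, M.resS (le_max_left m j) x,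
    fixedPts_mono _ (le_max_right m j) (map_mem_fixedPts _ hx), rfl⟩

theorem exists_resS_eq_zero {M : ShModel p} {q : ℕ} {x : (M.sectionsMod (S p q)).obj.V}
    (hx : x.1 ⟨none, mem_S_none q⟩ = 0) : ∃ q₀, ∃ h : q ≤ q₀, M.resS h x = 0 := by
  have h1 := (x.2.1 q le_rfl).symm.trans ((congrArg M.str.hom hx).trans (map_zero M.str.hom))
  obtain ⟨m, hm, h0⟩ := tails.exists_of_germ_eq_zero h1
  refine ⟨m, hm, Subtype.ext (funext fun ⟨a, ha⟩ => ?_)⟩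
  cases a with
  | none => exact hx
  | some k => exact h0 k (mem_S_some.1 ha)

end ShModel

/-! ### The model structure on the algebraic model -/

open ShModel SheafModel

namespace AlgModel

/-- The sections over `S_n`. -/
abbrev secs (M : AlgModel p) (n : ℕ) : ZpRep p := (((algToSh p).obj M).sectionsMod (S p n)).obj

/-- The map on sections over `S_n`. -/
abbrev secsMap {M N : AlgModel p} (g : M ⟶ N) (n : ℕ) : M.secs n ⟶ N.secs n :=
  (ShModel.sectionsMap ((algToSh p).map g) (S p n)).hom

theorem secs_ext {M : AlgModel p} {n : ℕ} {x y : (M.secs n).V}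
    (h : x.1 ⟨none, mem_S_none n⟩ = y.1 ⟨none, mem_S_none n⟩)
    (h' : ∀ k (hk : n ≤ k), x.1 ⟨some k, mem_S_some.2 hk⟩ = y.1 ⟨some k, mem_S_some.2 hk⟩) :
    x = y := by
  refine Subtype.ext (funext fun ⟨a, ha⟩ => ?_)
  cases a with
  | none => exact h
  | some k => exact h' k (mem_S_some.1 ha)

theorem secs_str {M : AlgModel p} {n : ℕ} (x : (M.secs n).V) :
    M.str.hom (x.1 ⟨none, mem_S_none n⟩) =
      (tails.germ M.fin n).hom (fun k => x.1 ⟨some k.1, mem_S_some.2 k.2⟩) := x.2.1 n le_rfl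

theorem secs_none_mem {M : AlgModel p} {n j : ℕ} {x : (M.secs n).V}
    (hx : x ∈ fixedPts (M.secs n) j) :
    x.1 ⟨none, mem_S_none n⟩ ∈ fixedPts M.inf j :=
  sections_fixed_iff.1 hx ⟨none, mem_S_none n⟩

theorem secs_some_mem {M : AlgModel p} {n j : ℕ} {x : (M.secs n).V} (hx : x ∈ fixedPts (M.secs n) j)
    {k : ℕ} (hk : n ≤ k) : x.1 ⟨some k, mem_S_some.2 hk⟩ ∈ fixedPts (M.fin k) j :=
  sections_fixed_iff.1 hx ⟨some k, mem_S_some.2 hk⟩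

theorem str_apply {M N : AlgModel p} (g : M ⟶ N) (y : M.inf.V) :
    (tails.map g.fin).hom (M.str.hom y) = N.str.hom (g.inf.hom y) :=
  congrArg (fun l => l.hom y) g.comm

theorem fin_discrete (M : AlgModel p) (k : ℕ) : isDiscrete p (M.fin k) :=
  fun v => ⟨k, M.fin_fixed k v⟩

/-- The germ at infinity of the image of a sequence. -/
theorem germ_map {M N : AlgModel p} (g : M ⟶ N) {v : M.inf.V} {m : ℕ}
    {s : ∀ k : {k // m ≤ k}, (M.fin k.1).V} (h : M.str.hom v = (tails.germ M.fin m).hom s) :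
    (tails.germ N.fin m).hom (fun k => (g.fin k).hom (s k)) = N.str.hom (g.inf.hom v) := by
  rw [← str_apply, h, tails.map_germ]

end AlgModel

open AlgModel

/-- `U` is full and faithful, so maps out of `A(n)` can be computed in sheaves, where `UA p n` is
free. -/
theorem fibOf_A_iff {K L : DgAlg p} (f : K ⟶ L) : fibOf (AlgModel.A p) f ↔ ∀ n i,
    ∀ y ∈ fixedPts ((L.X i).secs n) n, ∃ x ∈ fixedPts ((K.X i).secs n) n,
      (secsMap (f.f i) n).hom x = y := by
  refine forall_congr' fun n => forall_congr' fun i => ?_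
  have h0 : (Function.Surjective fun x : AlgModel.A p n ⟶ K.X i => x ≫ f.f i) ↔
      Function.Surjective fun x : UA p n ⟶ (U p).obj (K.X i) => x ≫ (U p).map (f.f i) := by
    constructor
    · intro h y
      obtain ⟨y, rfl⟩ := (U p).map_surjective y
      obtain ⟨x, rfl⟩ := h y
      exact ⟨(U p).map x, ((U p).map_comp _ _).symm⟩
    · intro h y
      obtain ⟨x, hx⟩ := h ((U p).map y)
      obtain ⟨x, rfl⟩ := (U p).map_surjective x
      exact ⟨x, (U p).map_injective (((U p).map_comp _ _).trans hx)⟩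
  exact h0.trans (surjective_comp_iff (isFree_UA n) ((U p).map (f.f i)))

/-! ### Relative equivalences under full and faithful functors -/

section FullyFaithful

variable {C D : Type*} [Category.{0} C] [Category.{0} D] [Preadditive C] [Preadditive D]

/-- Fully faithful additive functors preserve groups of morphisms. -/
def coyonedaCompIso (F : C ⥤ D) [F.Full] [F.Faithful] [F.Additive] (X : C) :
    preadditiveCoyoneda.obj (op X) ≅ F ⋙ preadditiveCoyoneda.obj (op (F.obj X)) :=
  NatIso.ofComponents
    (fun M => AddEquiv.toAddCommGrpIso
      { toFun := fun x : X ⟶ M => F.map x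
        invFun := fun x => F.preimage x
        left_inv := fun x => F.preimage_map x
        right_inv := fun x => F.map_preimage x
        map_add' := fun _ _ => F.map_add })
    fun {M N} g => by
      ext x
      exact F.map_comp x g

theorem weOf_iff_map {ι : Type*} (G : ι → C) (F : C ⥤ D) [F.Full] [F.Faithful] [F.Additive]
    {K L : ChainComplex C ℤ} (f : K ⟶ L) :
    weOf G f ↔ weOf (fun a => F.obj (G a)) ((F.mapHomologicalComplex _).map f) :=
  forall_congr' fun a => quasiIso_iff_of_arrow_mk_iso _ _
    (Arrow.isoOfNatIso (NatIso.mapHomologicalComplex (coyonedaCompIso F (G a)) _) (Arrow.mk f))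

end FullyFaithful

theorem weOf_A_iff {K L : DgAlg p} (f : K ⟶ L) : weOf (AlgModel.A p) f ↔ ∀ n i,
    (∀ x ∈ fixedPts ((K.X i).secs n) n, (secsMap (K.d i (i - 1)) n).hom x = 0 →
      ∀ y ∈ fixedPts ((L.X (i + 1)).secs n) n,
        (secsMap (f.f i) n).hom x = (secsMap (L.d (i + 1) i) n).hom y →
          ∃ z ∈ fixedPts ((K.X (i + 1)).secs n) n, (secsMap (K.d (i + 1) i) n).hom z = x) ∧
    (∀ y ∈ fixedPts ((L.X i).secs n) n, (secsMap (L.d i (i - 1)) n).hom y = 0 →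
      ∃ x ∈ fixedPts ((K.X i).secs n) n, (secsMap (K.d i (i - 1)) n).hom x = 0 ∧
        ∃ w ∈ fixedPts ((L.X (i + 1)).secs n) n,
          y = (secsMap (f.f i) n).hom x + (secsMap (L.d (i + 1) i) n).hom w) :=
  (weOf_iff_map _ (U p) f).trans (forall_congr' fun n =>
    quasiIso_iff ((dgU p).map f) (isFree_UA n))

open ShModel SheafModel AlgModel

/-! ### Surjectivity and exactness on sections near the trivial group -/

section Exactness

variable {A' A A'' B' B B'' : AlgModel p} (d' : A' ⟶ A) (d : A ⟶ A'') (f : A ⟶ B)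
  (e' : B' ⟶ B) (e : B ⟶ B'')

/-- A preimage at infinity comes with a representing sequence, which maps to the entries of `x` from
some index on by naturality of the structure map. The finitely many remaining entries are lifted one
at a time. Averaging brings every lift to level `n`, which the action of `p ^ k ℤ_p` being trivial
at `k ≥ n` does not give by itself. -/
theorem exists_secs_lift {n : ℕ} {x : (A.secs n).V} (hx : x ∈ fixedPts (A.secs n) n)
    (hk : ∀ k (hk : n ≤ k), ∃ z, (d'.fin k).hom z = x.1 ⟨some k, mem_S_some.2 hk⟩)
    (hinf : ∃ z, d'.inf.hom z = x.1 ⟨none, mem_S_none n⟩) :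
    ∃ z ∈ fixedPts (A'.secs n) n, (secsMap d' n).hom z = x := by
  obtain ⟨z₀, hz₀⟩ := hinf
  obtain ⟨z, hz, hzx⟩ := exists_fixed_lift d'.inf A'.inf_discrete (v := z₀) (n := n)
    (by rw [hz₀]; exact secs_none_mem hx)
  rw [hz₀] at hzx
  obtain ⟨w, hw, -, -, hwz, -, hP⟩ := exists_sections (M := (algToSh p).obj A')
    (M' := (algToSh p).obj A') (v := z) (v' := 0) hz (Submodule.zero_mem _)
    (fun k w _ => ∀ hk : n ≤ k, (d'.fin k).hom w = x.1 ⟨some k, mem_S_some.2 hk⟩)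
    (fun k h => by
      obtain ⟨z₁, hz₁⟩ := hk k h
      obtain ⟨z', hz', h'⟩ := exists_fixed_lift (d'.fin k) (A'.fin_discrete k) (v := z₁) (n := n)
        (by rw [hz₁]; exact secs_some_mem hx h)
      exact ⟨z', hz', 0, Submodule.zero_mem _, fun _ => h'.trans hz₁⟩)
    (fun m s _ hs _ => by
      have h1 := (germ_map d' hs).trans ((congrArg A.str.hom hzx).trans (secs_str x))
      obtain ⟨m', hm', _h', h⟩ := tails.exists_of_germ_eq h1
      exact ⟨m', hm', fun k hk _ => h k hk⟩)
  exact ⟨w, hw, secs_ext ((congrArg d'.inf.hom hwz).trans hzx) fun k hk => hP k hk hk⟩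

/-- The same construction is made for a pair `(x, w)` at once. Both `d x = 0` and `y = f x + e' w`
hold at infinity, hence eventually along representing sequences, and the earlier entries are chosen
separately. -/
theorem exists_secs_add {n : ℕ} {y : (B.secs n).V} (hy : y ∈ fixedPts (B.secs n) n)
    (hk : ∀ k (hk : n ≤ k), ∃ x, (d.fin k).hom x = 0 ∧ ∃ w,
      y.1 ⟨some k, mem_S_some.2 hk⟩ = (f.fin k).hom x + (e'.fin k).hom w)
    (hinf : ∃ x, d.inf.hom x = 0 ∧ ∃ w,
      y.1 ⟨none, mem_S_none n⟩ = f.inf.hom x + e'.inf.hom w) :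
    ∃ x ∈ fixedPts (A.secs n) n, (secsMap d n).hom x = 0 ∧ ∃ w ∈ fixedPts (B'.secs n) n,
      y = (secsMap f n).hom x + (secsMap e' n).hom w := by
  obtain ⟨x₀, hx₀, w₀, hw₀⟩ := hinf
  obtain ⟨x, hx, hdx, w, hw, hxw⟩ := exists_fixed_add d.inf f.inf e'.inf A.inf_discrete
    B'.inf_discrete (secs_none_mem hy) hx₀ hw₀
  obtain ⟨x', hx', w', hw', hxx, hww, hP⟩ := exists_sections (M := (algToSh p).obj A)
    (M' := (algToSh p).obj B') (v := x) (v' := w) hx hw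
    (fun k x w => (d.fin k).hom x = 0 ∧ ∀ hk : n ≤ k,
      y.1 ⟨some k, mem_S_some.2 hk⟩ = (f.fin k).hom x + (e'.fin k).hom w)
    (fun k h => by
      obtain ⟨x₁, hx₁, w₁, hw₁⟩ := hk k h
      obtain ⟨x, hx, hdx, w, hw, hxw⟩ := exists_fixed_add (d.fin k) (f.fin k) (e'.fin k)
        (A.fin_discrete k) (B'.fin_discrete k) (secs_some_mem hy h) hx₁ hw₁
      exact ⟨x, hx, w, hw, hdx, fun _ => hxw⟩)
    (fun m s s' hs hs' => by
      have h1 := (germ_map d hs).trans ((congrArg A''.str.hom hdx).trans (map_zero A''.str.hom))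
      obtain ⟨m₁, hm₁, h₁⟩ := tails.exists_of_germ_eq_zero h1
      have h2 : (tails.germ B.fin n).hom (fun k => y.1 ⟨some k.1, mem_S_some.2 k.2⟩) =
          (tails.germ B.fin m).hom (fun k => (f.fin k).hom (s k) + (e'.fin k).hom (s' k)) := by
        refine (secs_str y).symm.trans ((congrArg B.str.hom hxw).trans ?_)
        refine (map_add B.str.hom _ _).trans ?_
        refine (congrArg₂ (· + ·) (germ_map f hs).symm (germ_map e' hs').symm).trans ?_
        exact (map_add (tails.germ B.fin m).hom _ _).symm
      obtain ⟨m₂, _h', hm₂, h₂⟩ := tails.exists_of_germ_eq h2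
      exact ⟨max m₁ m₂, hm₁.trans (le_max_left _ _), fun k hk =>
        ⟨h₁ k ((le_max_left _ _).trans hk), fun _ => h₂ k ((le_max_right _ _).trans hk)⟩⟩)
  refine ⟨x', hx', secs_ext ?_ fun k hk => (hP k hk).1, w', hw', secs_ext ?_ fun k hk =>
    (hP k hk).2 hk⟩
  · exact (congrArg d.inf.hom hxx).trans hdx
  · exact hxw.trans (congrArg₂ (· + ·) (congrArg f.inf.hom hxx.symm) (congrArg e'.inf.hom hww.symm))

/-- The extension by zero of a vector over `p ^ k ℤ_p`. -/
abbrev AlgModel.ext {M : AlgModel p} {k : ℕ} (v : (M.fin k).V) : (M.secs k).V :=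
  ((algToSh p).obj M).extSection (M.fin_fixed k v)

theorem ext_self {M : AlgModel p} {k : ℕ} (v : (M.fin k).V) :
    (AlgModel.ext v).1 ⟨some k, mem_S_some.2 le_rfl⟩ = v :=
  ((algToSh p).obj M).extSection_self (M.fin_fixed k v)

theorem ext_mem {M : AlgModel p} {k : ℕ} (v : (M.fin k).V) :
    AlgModel.ext v ∈ fixedPts (M.secs k) k :=
  ((algToSh p).obj M).extSection_mem (M.fin_fixed k v)

theorem secsMap_ext {M N : AlgModel p} (g : M ⟶ N) {k : ℕ} (v : (M.fin k).V) :
    (secsMap g k).hom (AlgModel.ext v) = AlgModel.ext ((g.fin k).hom v) := by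
  refine eq_of_ext ?_ (map_zero g.inf.hom) fun i hi h => ?_
  · exact (congrArg (g.fin k).hom (ext_self v)).trans (ext_self _).symm
  · exact (congrArg (g.fin i).hom (((algToSh p).obj M).extSection_of_ne
      (M.fin_fixed k v) hi h)).trans
      ((map_zero (g.fin i).hom).trans
        (((algToSh p).obj N).extSection_of_ne (N.fin_fixed k _) hi h).symm)

theorem ext_zero {M : AlgModel p} {k : ℕ} : AlgModel.ext (0 : (M.fin k).V) = 0 := by
  refine eq_of_ext (ext_self _) rfl fun i hi h => ?_
  exact ((algToSh p).obj M).extSection_of_ne (M.fin_fixed k 0) hi h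

/-- Restriction of sections from `S_m` to `S_n`. -/
abbrev AlgModel.secsRes {M : AlgModel p} {m n : ℕ} (h : m ≤ n) : M.secs m ⟶ M.secs n :=
  (((algToSh p).obj M).sectionsRes (S_anti h)).hom

theorem exists_secs_of_inf {M : AlgModel p} (v : M.inf.V) :
    ∃ q, ∃ x ∈ fixedPts (M.secs q) q, x.1 ⟨none, mem_S_none q⟩ = v :=
  ((algToSh p).obj M).exists_section_of_inf v

theorem exists_secsRes_eq_zero {M : AlgModel p} {q : ℕ} {x : (M.secs q).V}
    (hx : x.1 ⟨none, mem_S_none q⟩ = 0) : ∃ q₀, ∃ h : q ≤ q₀, (secsRes h).hom x = 0 :=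
  exists_resS_eq_zero (M := (algToSh p).obj M) hx

theorem secsRes_mem {M : AlgModel p} {m n : ℕ} (h : m ≤ n) {x : (M.secs m).V}
    (hx : x ∈ fixedPts (M.secs m) m) : (secsRes h).hom x ∈ fixedPts (M.secs n) n :=
  fixedPts_mono _ h (map_mem_fixedPts _ hx)

end Exactness

/-! ### Fibrations and equivalences of `dg 𝒜` tested by the objects `A(n)` -/

theorem algFib_eq : (algData p).fib = fibOf (AlgModel.A p) := by
  ext K L f
  rw [fibOf_A_iff]
  constructor
  · rintro ⟨hk, hinf⟩ n i y hy
    exact exists_secs_lift (f.f i) hy (fun k _ => hk k i _) (hinf i _)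
  · intro h
    -- Values at points are recovered from fixed sections: a vector at `k` is extended by zero over
    -- `S_k`, and a vector at infinity extends to a section over some small `S_q`.
    refine ⟨fun k i y => ?_, fun i y => ?_⟩
    · obtain ⟨x, -, hx⟩ := h k i _ (ext_mem y)
      refine ⟨x.1 ⟨some k, mem_S_some.2 le_rfl⟩, ?_⟩
      exact (congrArg (fun z : ((L.X i).secs k).V => z.1 ⟨some k, mem_S_some.2 le_rfl⟩) hx).trans
        (ext_self y)
    · obtain ⟨q, y', hy', rfl⟩ := exists_secs_of_inf y
      obtain ⟨x, -, rfl⟩ := h q i y' hy'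
      exact ⟨_, rfl⟩

theorem algWe_iff {K L : DgAlg p} (f : K ⟶ L) : (algData p).we f ↔
    (∀ k i, (∀ x : ((K.X i).fin k).V, ((K.d i (i - 1)).fin k).hom x = 0 →
        ∀ y : ((L.X (i + 1)).fin k).V, ((f.f i).fin k).hom x = ((L.d (i + 1) i).fin k).hom y →
          ∃ z : ((K.X (i + 1)).fin k).V, ((K.d (i + 1) i).fin k).hom z = x) ∧
      (∀ y : ((L.X i).fin k).V, ((L.d i (i - 1)).fin k).hom y = 0 →
        ∃ x : ((K.X i).fin k).V, ((K.d i (i - 1)).fin k).hom x = 0 ∧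
          ∃ w : ((L.X (i + 1)).fin k).V,
            y = ((f.f i).fin k).hom x + ((L.d (i + 1) i).fin k).hom w)) ∧
    (∀ i, (∀ x : (K.X i).inf.V, (K.d i (i - 1)).inf.hom x = 0 →
        ∀ y : (L.X (i + 1)).inf.V, (f.f i).inf.hom x = (L.d (i + 1) i).inf.hom y →
          ∃ z : (K.X (i + 1)).inf.V, (K.d (i + 1) i).inf.hom z = x) ∧
      (∀ y : (L.X i).inf.V, (L.d i (i - 1)).inf.hom y = 0 →
        ∃ x : (K.X i).inf.V, (K.d i (i - 1)).inf.hom x = 0 ∧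
          ∃ w : (L.X (i + 1)).inf.V, y = (f.f i).inf.hom x + (L.d (i + 1) i).inf.hom w)) :=
  and_congr (forall_congr' fun k =>
      quasiIso_rep_iff (((AlgModel.evFin p k).mapHomologicalComplex _).map f))
    (quasiIso_rep_iff (((AlgModel.evInf p).mapHomologicalComplex _).map f))

theorem algWe_eq : (algData p).we = weOf (AlgModel.A p) := by
  ext K L f
  rw [algWe_iff, weOf_A_iff]
  constructor
  · rintro ⟨hk, hinf⟩ n i
    refine ⟨fun x hx hdx y _ hxy => ?_, fun y hy hdy => ?_⟩
    · refine exists_secs_lift (K.d (i + 1) i) hx (fun k h => ?_) ?_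
      · exact (hk k i).1 _ (congrFun (congrArg Subtype.val hdx) ⟨some k, mem_S_some.2 h⟩)
          (y.1 ⟨some k, mem_S_some.2 h⟩)
          (congrFun (congrArg Subtype.val hxy) ⟨some k, mem_S_some.2 h⟩)
      · exact (hinf i).1 _ (congrFun (congrArg Subtype.val hdx) ⟨none, mem_S_none n⟩)
          (y.1 ⟨none, mem_S_none n⟩) (congrFun (congrArg Subtype.val hxy) ⟨none, mem_S_none n⟩)
    · refine exists_secs_add (K.d i (i - 1)) (f.f i) (L.d (i + 1) i) hy (fun k h => ?_) ?_
      · exact (hk k i).2 _ (congrFun (congrArg Subtype.val hdy) ⟨some k, mem_S_some.2 h⟩)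
      · exact (hinf i).2 _ (congrFun (congrArg Subtype.val hdy) ⟨none, mem_S_none n⟩)
  · intro h
    refine ⟨fun k i => ⟨fun x hdx y hxy => ?_, fun y hdy => ?_⟩,
      fun i => ⟨fun x hdx y hxy => ?_, fun y hdy => ?_⟩⟩
    -- Extension by zero is natural, so relations between vectors at `k` remain relations between
    -- fixed sections over `S_k`.
    · obtain ⟨z, -, hz⟩ := (h k i).1 _ (ext_mem x)
        (by rw [secsMap_ext, hdx, ext_zero]) _ (ext_mem y) (by rw [secsMap_ext, secsMap_ext, hxy])
      exact ⟨z.1 ⟨some k, mem_S_some.2 le_rfl⟩,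
        (congrFun (congrArg Subtype.val hz) ⟨some k, mem_S_some.2 le_rfl⟩).trans (ext_self x)⟩
    · obtain ⟨x, -, hx, w, -, hw⟩ := (h k i).2 _ (ext_mem y) (by rw [secsMap_ext, hdy, ext_zero])
      exact ⟨x.1 ⟨some k, mem_S_some.2 le_rfl⟩,
        congrFun (congrArg Subtype.val hx) ⟨some k, mem_S_some.2 le_rfl⟩,
        w.1 ⟨some k, mem_S_some.2 le_rfl⟩, (ext_self y).symm.trans
          (congrFun (congrArg Subtype.val hw) ⟨some k, mem_S_some.2 le_rfl⟩)⟩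
    · obtain ⟨q₁, x₁, hx₁, rfl⟩ := exists_secs_of_inf x
      obtain ⟨q₂, y₁, hy₁, rfl⟩ := exists_secs_of_inf y
      -- Extensions of `x` and `y` satisfy `d x = 0` and `f x = d y` only at the trivial group. Both
      -- relations hold over a smaller `S_m`, and the extensions stay fixed at level `m` because `m`
      -- is larger than the initial indices.
      let q := max q₁ q₂
      let x₂ := (secsRes (le_max_left q₁ q₂)).hom x₁
      let y₂ := (secsRes (le_max_right q₁ q₂)).hom y₁
      obtain ⟨m₁, hm₁, h₁⟩ := exists_secsRes_eq_zero (M := K.X (i - 1)) (q := q)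
        (x := (secsMap (K.d i (i - 1)) q).hom x₂) hdx
      obtain ⟨m₂, hm₂, h₂⟩ := exists_secsRes_eq_zero (M := L.X i) (q := q)
        (x := (secsMap (f.f i) q).hom x₂ - (secsMap (L.d (i + 1) i) q).hom y₂) (sub_eq_zero.2 hxy)
      let m := max m₁ m₂
      have hqm : q ≤ m := hm₁.trans (le_max_left _ _)
      obtain ⟨z, -, hz⟩ := (h m i).1 ((secsRes hqm).hom x₂)
        (secsRes_mem _ (secsRes_mem _ hx₁))
        (congrArg (secsRes (M := K.X (i - 1)) (le_max_left m₁ m₂)).hom h₁)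
        ((secsRes hqm).hom y₂) (secsRes_mem _ (secsRes_mem _ hy₁))
        (sub_eq_zero.1 (congrArg (secsRes (M := L.X i) (le_max_right m₁ m₂)).hom h₂))
      exact ⟨z.1 ⟨none, mem_S_none m⟩, congrFun (congrArg Subtype.val hz) ⟨none, mem_S_none m⟩⟩
    · obtain ⟨q, y₁, hy₁, rfl⟩ := exists_secs_of_inf y
      obtain ⟨m, hm, h₁⟩ := exists_secsRes_eq_zero (M := L.X (i - 1)) (q := q)
        (x := (secsMap (L.d i (i - 1)) q).hom y₁) hdy
      obtain ⟨x, -, hx, w, -, hw⟩ := (h m i).2 ((secsRes hm).hom y₁) (secsRes_mem _ hy₁) h₁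
      exact ⟨x.1 ⟨none, mem_S_none m⟩, congrFun (congrArg Subtype.val hx) ⟨none, mem_S_none m⟩,
        w.1 ⟨none, mem_S_none m⟩, congrFun (congrArg Subtype.val hw) ⟨none, mem_S_none m⟩⟩

theorem algData_eq : algData p = .ofFibWe (fibOf (AlgModel.A p)) (weOf (AlgModel.A p)) := by
  rw [← algFib_eq, ← algWe_eq]
  rfl

theorem isModel_algData : (algData p).IsModel := by
  rw [algData_eq]
  exact isModel_ofFibWe _ _ (Cardinal.aleph.{0} 1) (fun _ => inferInstance) le_rfl

theorem genAcyclicCof_rlp : (genAcyclicCof p).rlp = (algData p).fib :=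
  (discGen_rlp (AlgModel.A p)).trans algFib_eq.symm

theorem genCof_rlp : (genCof p).rlp = (algData p).fib ⊓ (algData p).we :=
  (sphereGen_rlp (AlgModel.A p)).trans (by rw [algFib_eq, algWe_eq])

/-! ### Quillen pairs and Quillen equivalences -/

namespace ModelData

variable {C D : Type*} [Category* C] [Category* D]

theorem IsModel.le_llp {M : ModelData C} (h : M.IsModel) : M.cof ⊓ M.we ≤ M.fib.llp := by
  obtain ⟨m, hc, hf, hw⟩ := h
  have hc' : cofibrations C = M.cof := congrArg (·.cofibrations) hc
  have hf' : fibrations C = M.fib := congrArg (·.fibrations) hf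
  have hw' : weakEquivalences C = M.we :=
    congrArg (·.weakEquivalences) hw
  intro A B i hi X Y q hq
  have : Cofibration i := ⟨hc' ▸ hi.1⟩
  have : WeakEquivalence i := ⟨hw' ▸ hi.2⟩
  have : Fibration q := ⟨hf' ▸ hq⟩
  infer_instance

theorem IsModel.exists_fac {M : ModelData C} (h : M.IsModel) {X Y : C} (f : X ⟶ Y) :
    ∃ (Z : C) (i : X ⟶ Z) (q : Z ⟶ Y), (M.cof ⊓ M.we) i ∧ M.fib q ∧ i ≫ q = f := by
  obtain ⟨m, hc, hf, hw⟩ := h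
  have hc' : cofibrations C = M.cof := congrArg (·.cofibrations) hc
  have hf' : fibrations C = M.fib := congrArg (·.fibrations) hf
  have hw' : weakEquivalences C = M.we :=
    congrArg (·.weakEquivalences) hw
  have d := MorphismProperty.factorizationData (trivialCofibrations C) (fibrations C) f
  exact ⟨_, d.i, d.p, ⟨hc' ▸ d.hi.1, hw' ▸ d.hi.2⟩, hf' ▸ d.hp, d.fac⟩

end ModelData

/-! ### Lifting properties and relative equivalences along an adjunction -/

section Transport

variable {C D : Type*} [Category.{0} C] [Category.{0} D] [Preadditive C] [Preadditive D]
  {F : C ⥤ D} {G : D ⥤ C} [G.Additive]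
  {ι : Type*} (A : ι → C)

theorem rlp_ofHoms_map {C D : Type*} [Category* C] [Category* D] {F : C ⥤ D} {G : D ⥤ C}
    (adj : F ⊣ G) {κ : Type*} {X Y : κ → C} (i : ∀ k, X k ⟶ Y k) {K L : D} (f : K ⟶ L) :
    (MorphismProperty.ofHoms fun k => F.map (i k)).rlp f ↔
      (MorphismProperty.ofHoms i).rlp (G.map f) := by
  constructor
  · rintro h _ _ _ ⟨k⟩
    exact (adj.hasLiftingProperty_iff _ _).1 (h _ ⟨k⟩)
  · rintro h _ _ _ ⟨k⟩
    exact (adj.hasLiftingProperty_iff _ _).2 (h _ ⟨k⟩)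

theorem llp_map {C D : Type*} [Category* C] [Category* D] {F : C ⥤ D} {G : D ⥤ C}
    (adj : F ⊣ G) {W : MorphismProperty C} {V : MorphismProperty D}
    (h : ∀ ⦃K L : D⦄ (f : K ⟶ L), V f → W (G.map f)) {X Y : C} {i : X ⟶ Y} (hi : W.llp i) :
    V.llp (F.map i) :=
  fun _ _ _ hq => (adj.hasLiftingProperty_iff _ _).2 (hi _ (h _ hq))

/-- Adjunction isomorphisms on groups of morphisms. -/
def coyonedaAdjIso [F.Additive] (adj : F ⊣ G) (X : C) :
    preadditiveCoyoneda.obj (op (F.obj X)) ≅ G ⋙ preadditiveCoyoneda.obj (op X) :=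
  NatIso.ofComponents
    (fun M => AddEquiv.toAddCommGrpIso (adj.homAddEquiv X M : (F.obj X ⟶ M) ≃+ (X ⟶ G.obj M)))
    fun {M N} g => by
      ext x
      exact adj.homEquiv_naturality_right x g

theorem weOf_map_right [F.Additive] (adj : F ⊣ G) {K L : ChainComplex D ℤ} (f : K ⟶ L) :
    weOf A ((G.mapHomologicalComplex _).map f) ↔ weOf (fun a => F.obj (A a)) f :=
  forall_congr' fun a => (quasiIso_iff_of_arrow_mk_iso _ _
    (Arrow.isoOfNatIso (NatIso.mapHomologicalComplex (coyonedaAdjIso adj (A a)) _)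
      (Arrow.mk f))).symm

theorem fibOf_map_right (adj : F ⊣ G) {K L : ChainComplex D ℤ} (f : K ⟶ L) :
    fibOf A ((G.mapHomologicalComplex _).map f) ↔ fibOf (fun a => F.obj (A a)) f := by
  refine forall_congr' fun a => forall_congr' fun i => ?_
  constructor
  · intro h y
    obtain ⟨x, hx⟩ := h (adj.homEquiv _ _ y)
    refine ⟨(adj.homEquiv _ _).symm x, ?_⟩
    exact (adj.homEquiv_naturality_right_symm x (f.f i)).symm.trans
      ((adj.homEquiv _ _).symm_apply_eq.2 hx)
  · intro h y
    obtain ⟨x, hx⟩ := h ((adj.homEquiv _ _).symm y)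
    refine ⟨adj.homEquiv _ _ x, ?_⟩
    exact (adj.homEquiv_naturality_right x (f.f i)).symm.trans
      ((adj.homEquiv _ _).eq_symm_apply.1 hx)

end Transport

/-! ### The model structures on `dg ℬ` seen through `R` -/

theorem fibOf_A_map_iff {K L : DgSheaf p} (f : K ⟶ L) :
    fibOf (AlgModel.A p) ((dgR p).map f) ↔ fibOf (UA p) f :=
  fibOf_map_right (AlgModel.A p) (adjUR p) f

/-- The complexes `Hom(A(n), R K)` and `Hom(UA(n), K)` are naturally isomorphic. The cellular
equivalences are therefore exactly the maps that `R` sends to weak equivalences. -/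
theorem weOf_A_map_iff {K L : DgSheaf p} (f : K ⟶ L) :
    weOf (AlgModel.A p) ((dgR p).map f) ↔ weOf (UA p) f :=
  weOf_map_right (AlgModel.A p) (adjUR p) f

theorem rlp_map_zeroToDisc : (MorphismProperty.ofHoms fun x : ℕ × ℤ =>
    (dgU p).map (zeroToDisc (AlgModel.A p x.1) x.2)).rlp = fibOf (UA p) := by
  ext K L f
  refine (rlp_ofHoms_map (dgAdjUR p) _ f).trans (Iff.trans ?_ (fibOf_A_map_iff f))
  rw [← algFib_eq, ← genAcyclicCof_rlp]
  rfl

theorem rlp_map_sphereToDisc : (MorphismProperty.ofHoms fun x : ℕ × ℤ =>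
    (dgU p).map (sphereToDisc (AlgModel.A p x.1) x.2)).rlp = fibOf (UA p) ⊓ weOf (UA p) := by
  ext K L f
  refine (rlp_ofHoms_map (dgAdjUR p) _ f).trans
    (Iff.trans ?_ (and_congr (fibOf_A_map_iff f) (weOf_A_map_iff f)))
  rw [← algFib_eq, ← algWe_eq]
  change _ ↔ ((algData p).fib ⊓ (algData p).we) _
  rw [← genCof_rlp]
  rfl

instance : HasBinaryBiproducts (SheafModel p) := .of_hasBinaryProducts

/-- A composite of a generated acyclic cofibration and an acyclic fibration is a cellular
equivalence by the path complex argument. Conversely, a cellular equivalence is factored in the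
relative model structure, and two-out-of-three makes the second factor acyclic. -/
theorem cellData_eq : cellData p = .ofFibWe (fibOf (UA p)) (weOf (UA p)) := by
  rw [cellData, ModelData.ofGenerators, rlp_map_zeroToDisc, rlp_map_sphereToDisc]
  refine congrArg (ModelData.mk _ _) ?_
  ext K L f
  constructor
  · rintro ⟨Z, i, q, hi, hq, rfl⟩
    exact (weOf (UA p)).comp_mem _ _ (weOf_of_fibOf_llp _ _ _ hi) hq.2
  · intro hf
    obtain ⟨Z, i, q, hi, hq, rfl⟩ := (isModel_ofFibWe_UA (p := p)).exists_fac f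
    exact ⟨Z, i, q, isModel_ofFibWe_UA.le_llp _ hi, ⟨hq,
      MorphismProperty.of_precomp (W := weOf (UA p)) (W' := weOf (UA p)) i q hi.2 hf⟩, rfl⟩

theorem isModel_cellData : (cellData p).IsModel := by
  rw [cellData_eq]
  exact isModel_ofFibWe_UA

theorem cellData_we : (cellData p).we = cellWe p := by
  rw [cellData_eq]
  rfl

/-- By adjunction it suffices that `R` carries fibrations and acyclic fibrations to maps of the same
kind. The image of an acyclic cofibration then lifts against `fib`, and `hJ` turns this lifting
property into a weak equivalence. -/
theorem isQuillenPair {fib we : MorphismProperty (DgSheaf p)} (hf : fib ≤ fibOf (UA p))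
    (hw : we ≤ cellWe p) (hJ : fib.llp ≤ we) :
    ModelData.IsQuillenPair (algData p) (.ofFibWe fib we) (dgAdjUR p) := by
  refine ⟨fun X Y i hi => llp_map (dgAdjUR p) (W := (algData p).fib ⊓ (algData p).we)
    (V := fib ⊓ we) (fun K L f h => ?_) hi, fun X Y i hi hiw => hJ _ (llp_map (dgAdjUR p)
    (fun K L f h => ?_) (isModel_algData.le_llp i ⟨hi, hiw⟩))⟩
  · rw [algFib_eq, algWe_eq]
    exact ⟨(fibOf_A_map_iff f).2 (hf _ h.1), (weOf_A_map_iff f).2 (hw _ h.2)⟩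
  · rw [algFib_eq]
    exact (fibOf_A_map_iff f).2 (hf _ h)

/-- The adjoint of `f` is the unit followed by `R f`. The unit is an isomorphism in each degree
because `U` is full and faithful, and `R` detects cellular equivalences. This is the whole content
of the Quillen equivalences beyond the Quillen pairs. -/
theorem weOf_homEquiv {X : DgAlg p} {Y : DgSheaf p} (f : (dgU p).obj X ⟶ Y) :
    weOf (AlgModel.A p) ((dgAdjUR p).homEquiv X Y f) ↔ weOf (UA p) f := by
  have : IsIso ((dgAdjUR p).unit.app X) := by
    have (i : ℤ) : IsIso (((dgAdjUR p).unit.app X).f i) :=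
      inferInstanceAs (IsIso ((adjUR p).unit.app (X.X i)))
    exact HomologicalComplex.Hom.isIso_of_components _
  rw [← weOf_A_map_iff, Adjunction.homEquiv_unit]
  exact (weOf (AlgModel.A p)).cancel_left_of_respectsIso _ _

theorem isQuillenEquivalence {fib : MorphismProperty (DgSheaf p)} (hf : fib ≤ fibOf (UA p))
    (hJ : fib.llp ≤ cellWe p) :
    ModelData.IsQuillenEquivalence (algData p) (.ofFibWe fib (cellWe p)) (dgAdjUR p) :=
  ⟨isQuillenPair hf le_rfl hJ, fun X Y _ _ f => by
    rw [algWe_eq]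
    exact (weOf_homEquiv f).symm⟩

theorem isQuillenPair_levelData :
    ModelData.IsQuillenPair (algData p) (levelData p) (dgAdjUR p) :=
  isQuillenPair (levelFib_eq.trans_le fibOf_free_le) levelWe_le_cellWe fun _ _ i hi => by
    rw [levelFib_eq] at hi
    rw [levelWe_eq]
    exact weOf_of_fibOf_llp _ _ _ hi

theorem isQuillenEquivalence_cellData :
    ModelData.IsQuillenEquivalence (algData p) (cellData p) (dgAdjUR p) := by
  rw [cellData_eq]
  exact isQuillenEquivalence le_rfl fun _ _ i hi => weOf_of_fibOf_llp _ _ _ hi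

theorem isQuillenEquivalence_cellularisation :
    ModelData.IsQuillenEquivalence (algData p) (cellularisation p) (dgAdjUR p) :=
  isQuillenEquivalence (levelFib_eq.trans_le fibOf_free_le) fun _ _ i hi => by
    rw [levelFib_eq] at hi
    exact weOf_of_fibOf_llp _ (UA p) _ hi

end PadicModel

end

theorem mainTheorem11 (p : ℕ) [Fact p.Prime] :
    ∃ (adj : PadicModel.U p ⊣ PadicModel.R p) (dgAdj : PadicModel.dgU p ⊣ PadicModel.dgR p),
      -- `U` is full and faithful
      (PadicModel.U p).Full ∧ (PadicModel.U p).Faithful ∧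
      -- the adjunction on differential graded objects is induced by `adj`
      (∀ (X : PadicModel.DgAlg p) (i : ℤ),
        (dgAdj.unit.app X).f i = adj.unit.app (X.X i)) ∧
      -- the model structure on `dg 𝒜`, and its generating sets
      (PadicModel.algData p).IsModel ∧
      (PadicModel.genAcyclicCof p).rlp = (PadicModel.algData p).fib ∧
      (PadicModel.genCof p).rlp = (PadicModel.algData p).fib ⊓ (PadicModel.algData p).we ∧
      -- a Quillen pair for the levelwise model structure on `dg ℬ`
      (PadicModel.levelData p).IsModel ∧
      PadicModel.ModelData.IsQuillenPair (PadicModel.algData p) (PadicModel.levelData p) dgAdj ∧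
      -- a Quillen equivalence for the model structure on `dg ℬ` generated by the images under `U`
      (PadicModel.cellData p).IsModel ∧ (PadicModel.cellData p).we = PadicModel.cellWe p ∧
      PadicModel.ModelData.IsQuillenEquivalence (PadicModel.algData p) (PadicModel.cellData p)
        dgAdj ∧
      -- a Quillen equivalence for the cellularisation of the levelwise model structure
      (PadicModel.cellularisation p).IsModel ∧
      PadicModel.ModelData.IsQuillenEquivalence (PadicModel.algData p)
        (PadicModel.cellularisation p) dgAdj := by
  exact ⟨PadicModel.adjUR p, PadicModel.dgAdjUR p, inferInstance, inferInstance,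
    PadicModel.dgAdjUR_unit, PadicModel.isModel_algData, PadicModel.genAcyclicCof_rlp,
    PadicModel.genCof_rlp, PadicModel.isModel_levelData, PadicModel.isQuillenPair_levelData,
    PadicModel.isModel_cellData, PadicModel.cellData_we, PadicModel.isQuillenEquivalence_cellData,
    PadicModel.isModel_cellularisation, PadicModel.isQuillenEquivalence_cellularisation⟩
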